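/- Let $\omega>0$ be irrational, $q=e^{2\pi i\omega}$, and $q^{s}:=e^{2\pi i\omega s}$ for $s\in\mathbb C$. Let $S_2(x\,|\,1,\tfrac1\omega)$ be the double sine function, i.e. the meromorphic function on $\mathbb C$ given for $0<\operatorname{Re}x<1+\frac1\omega$ by $$\log S_2(x\,|\,1,\tfrac1\omega)=\int_0^\infty\Big(\frac{\sinh\big((x-\frac12(1+\frac1\omega))t\big)}{2\sinh\frac t2\,\sinh\frac t{2\omega}}-\frac{2x-1-\frac1\omega}{t/\omega}\Big)\frac{dt}{t},$$ and continued by $S_2(x+1)=S_2(x)/(2\sin\pi\omega x)$. Put $$\langle x\rangle:=\exp\!\Big(\tfrac{\pi i}{2}\big((1+\omega)x-\omega x^2\big)\Big)\,S_2(x\,|\,1,\tfrac1\omega).$$ Its zeros are $\mathbb Z_{\le0}+\frac1\omega\mathbb Z_{\le0}$ and its poles are $\mathbb Z_{\ge1}+\frac1\omega\mathbb Z_{\ge1}$. Define $$\Psi(\alpha,\beta,\gamma;x):=\frac{\langle\alpha\rangle\langle\beta\rangle}{\langle1\rangle\langle\gamma\rangle}\int_{C_0}q^{xz}\,\frac{\langle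 z+1+\frac1\omega\rangle\langle z+\gamma\rangle}{\langle z+\alpha\rangle\langle z+\beta\rangle}\,dz ,$$ where $C_0$ is the imaginary axis from $-i\infty$ to $i\infty$, deformed in a bounded region so that the points of $-\alpha+\mathbb Z_{\le0}+\frac1\omega\mathbb Z_{\le0}$ and $-\beta+\mathbb Z_{\le0}+\frac1\omega\mathbb Z_{\le0}$ are on its left and those of $\mathbb Z_{\ge0}+\frac1\omega\mathbb Z_{\ge0}$ and $-\gamma+\mathbb Z_{\ge1}+\frac1\omega\mathbb Z_{\ge1}$ are on its right. The integral converges absolutely for $0<\operatorname{Re}x<1+\frac1\omega+\operatorname{Re}(\gamma-\alpha-\beta)$. Let $$\phi(a,b,c;t):=\sum_{k\ge0}\frac{(a;q)_k(b;q)_k}{(q;q)_k(c;q)_k}\,t^k,\qquad (a;q)_k:=\prod_{j=0}^{k-1}(1-aq^j);$$ for $a=q^{-n}$ the terms with $k>n$ vanish and are taken to be $0$. Let $$p_n^{(\alpha,\beta)}(t):=\phi(q^{-n},q^{\alpha+\beta+n+1},q^{\alpha+1};qt)$$ be the $q$-little Jacobi polynomials. Let $n\in\mathbb Z_{\ge0}$.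 Call $(\beta,\gamma)\in\mathbb C^2$ admissible if $\langle\cdot\rangle$ has neither a zero nor a pole at $\beta$ or at $\gamma$, $\gamma-\beta\notin\mathbb Z_{\ge1}+\frac1\omega\mathbb Z_{\ge1}$, and $(q^\gamma;q)_n\ne0$. **(1)** Let $(\beta,\gamma)$ be admissible. Then $\phi(q^{-n},q^\beta,q^\gamma;t)$ is a polynomial in $t$ of degree at most $n$, and for every $x\in\mathbb C$ with $0<\operatorname{Re}x<1+\frac1\omega+\operatorname{Re}\gamma+n-\operatorname{Re}\beta$, $$\lim_{\alpha\to-n}\Psi(\alpha,\beta,\gamma;x)=\phi(q^{-n},q^\beta,q^\gamma;q^x),$$ where $\alpha\to-n$ through complex values $\alpha\neq-n$. **(2)** Consequently, if $(\alpha+\beta+n+1,\ \alpha+1)$ is admissible and $0<\operatorname{Re}(x+1)<1+\frac1\omega-\operatorname{Re}\beta$, then $$p_n^{(\alpha,\beta)}(q^x)=\Psi(-n,\alpha+\beta+n+1,\alpha+1;x+1),$$ where the right-hand side denotes the limit of $\Psi(a,\alpha+\beta+n+1,\alpha+1;x+1)$ as $a\to-n$, $a\ne-n$. -/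

import Mathlib

open Filter Topology

noncomputable section

namespace QHyp

/-! ### The double sine function -/

/-- The double sine function `S₂(x | w₁, w₂)` (for `w₁, w₂ > 0`) in the strip
`0 < Re x < w₁ + w₂`, through its absolutely convergent integral representation
`log S₂(x) = ∫₀^∞ (sinh((x - (w₁+w₂)/2) t) / (2 sinh(w₁ t/2) sinh(w₂ t/2))
  - (2x - w₁ - w₂) / (w₁ w₂ t)) dt/t`. -/
def doubleSineStrip (w₁ w₂ : ℝ) (x : ℂ) : ℂ :=
  Complex.exp (∫ t in Set.Ioi (0 : ℝ),
    (Complex.sinh ((x - (w₁ + w₂) / 2) * t)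
        / (2 * Complex.sinh (w₁ * t / 2) * Complex.sinh (w₂ * t / 2))
      - (2 * x - w₁ - w₂) / (w₁ * w₂ * t)) / t)

/-- The double sine function `S₂(x | w₁, w₂)` on the whole plane: the meromorphic continuation of
`doubleSineStrip` by means of `S₂(x + w₁) = S₂(x) / (2 sin (π x / w₂))`. The integer
`m = 1 - ⌈Re x / w₁⌉` is the one with `0 < Re (x + m w₁) ≤ w₁`. The zeros are the points of
`w₁ ℤ_{≤0} + w₂ ℤ_{≤0}`, the poles (where the value is `0` by division by zero) those of
`w₁ ℤ_{≥1} + w₂ ℤ_{≥1}`. -/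
def doubleSine (w₁ w₂ : ℝ) (x : ℂ) : ℂ :=
  let m : ℤ := 1 - ⌈x.re / w₁⌉
  doubleSineStrip w₁ w₂ (x + m * w₁)
    * (∏ j ∈ Finset.range m.toNat, 2 * Complex.sin (Real.pi * (x + j * w₁) / w₂))
    / (∏ j ∈ Finset.range (-m).toNat, 2 * Complex.sin (Real.pi * (x - (j + 1) * w₁) / w₂))

/-- The function `⟨x⟩ = exp((πi/2) ((1 + ω) x - ω x²)) S₂(x | 1, 1/ω)`. -/
def brk (ω : ℝ) (x : ℂ) : ℂ :=
  Complex.exp (Real.pi * Complex.I / 2 * ((1 + ω) * x - ω * x ^ 2)) * doubleSine 1 (1 / ω) x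

/-- `q ^ s = exp(2πi ω s)`, where `q = exp(2πi ω)`. -/
def qpow (ω : ℝ) (s : ℂ) : ℂ := Complex.exp (2 * Real.pi * Complex.I * ω * s)

/-! ### Contours: the imaginary axis, modified on a bounded part -/

/-- The integral of `f` along the polygonal path with the given successive vertices. -/
def polyIntegral (f : ℂ → ℂ) : List ℂ → ℂ
  | v :: w :: l =>
      (∫ t in (0 : ℝ)..1, f (v + t * (w - v))) * (w - v) + polyIntegral f (w :: l)
  | _ => 0

/-- The set of points on the polygonal path with the given successive vertices. -/
def polySupport : List ℂ → Set ℂ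
  | v :: w :: l => segment ℝ v w ∪ polySupport (w :: l)
  | _ => ∅

/-- A contour from `-i∞` to `i∞` that follows the imaginary axis up to `-iR`, then a polygonal path
from `-iR` to `iR` with intermediate vertices `mid`, then the imaginary axis from `iR` on. -/
structure Contour where
  R : ℝ
  R_pos : 0 < R
  mid : List ℂ

namespace Contour

/-- The vertices of the bounded part of the contour. -/
def vertices (C : Contour) : List ℂ :=
  (-(C.R * Complex.I)) :: (C.mid ++ [C.R * Complex.I])

/-- The set of points on the contour. -/
def support (C : Contour) : Set ℂ :=
  {z | ∃ y : ℝ, C.R ≤ |y| ∧ z = y * Complex.I} ∪ polySupport C.vertices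

/-- The integral `∫_C f(z) dz`. -/
def integral (C : Contour) (f : ℂ → ℂ) : ℂ :=
  (∫ y in Set.Iic (-C.R), f (y * Complex.I)) * Complex.I
    + polyIntegral f C.vertices
    + (∫ y in Set.Ioi C.R, f (y * Complex.I)) * Complex.I

/-- The symmetric improper integral `∫_C dz / (z - p)` exists and equals `v`. It is `i` times the
total variation of `arg (z - p)` along `C`. -/
def HasTurning (C : Contour) (p v : ℂ) : Prop :=
  Tendsto (fun T : ℝ => polyIntegral (fun z => (z - p)⁻¹)
      ((-(T * Complex.I)) :: (C.vertices ++ [T * Complex.I]))) atTop (𝓝 v)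

/-- The point `p` is on the left of the contour: the vector from `p` to the point running through
the contour makes half a turn counterclockwise in total. -/
def IsLeft (C : Contour) (p : ℂ) : Prop :=
  p ∉ C.support ∧ C.HasTurning p (Real.pi * Complex.I)

/-- The point `p` is on the right of the contour: the vector from `p` to the point running through
the contour makes half a turn clockwise in total. -/
def IsRight (C : Contour) (p : ℂ) : Prop :=
  p ∉ C.support ∧ C.HasTurning p (-(Real.pi * Complex.I))

end Contour

/-! ### The hypergeometric function of Barnes type at `|q| = 1` -/

/-- `ℤ_{≤0} + (1/ω) ℤ_{≤0}`, the zeros of `⟨·⟩`. -/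
def latNonpos (ω : ℝ) : Set ℂ := {z | ∃ j k : ℕ, z = -(j + k / ω)}

/-- `ℤ_{≥1} + (1/ω) ℤ_{≥1}`, the poles of `⟨·⟩`. -/
def latPos (ω : ℝ) : Set ℂ := {z | ∃ j k : ℕ, z = (j + 1) + (k + 1) / ω}

/-- `-α + ℤ_{≤0} + (1/ω) ℤ_{≤0}` and `-β + ℤ_{≤0} + (1/ω) ℤ_{≤0}`. -/
def leftPoles (ω : ℝ) (α β : ℂ) : Set ℂ :=
  {p | p + α ∈ latNonpos ω ∨ p + β ∈ latNonpos ω}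

/-- `ℤ_{≥0} + (1/ω) ℤ_{≥0}` and `-γ + ℤ_{≥1} + (1/ω) ℤ_{≥1}`. -/
def rightPoles (ω : ℝ) (γ : ℂ) : Set ℂ :=
  {p | -p ∈ latNonpos ω ∨ p + γ ∈ latPos ω}

/-- The contour `C₀` attached to `(α, β, γ)`. -/
def IsSeparating (ω : ℝ) (α β γ : ℂ) (C : Contour) : Prop :=
  (∀ p ∈ leftPoles ω α β, C.IsLeft p) ∧ (∀ p ∈ rightPoles ω γ, C.IsRight p)

/-- The integrand `q^{xz} ⟨z+1+1/ω⟩⟨z+γ⟩ / (⟨z+α⟩⟨z+β⟩)`. -/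
def integrand (ω : ℝ) (α β γ x z : ℂ) : ℂ :=
  qpow ω (x * z) * (brk ω (z + 1 + 1 / ω) * brk ω (z + γ)) / (brk ω (z + α) * brk ω (z + β))

open Classical in
/-- `Ψ(α, β, γ; x) = ⟨α⟩⟨β⟩ / (⟨1⟩⟨γ⟩) ∫_{C₀} q^{xz} ⟨z+1+1/ω⟩⟨z+γ⟩ / (⟨z+α⟩⟨z+β⟩) dz`, the integral
being taken along a contour that separates the two sets of poles (by Cauchy's theorem the choice
does not matter). The value is set to `0` if there is no such contour. -/
def Psi (ω : ℝ) (α β γ x : ℂ) : ℂ :=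
  if h : ∃ C : Contour, IsSeparating ω α β γ C then
    brk ω α * brk ω β / (brk ω 1 * brk ω γ) * h.choose.integral (integrand ω α β γ x)
  else 0

/-! ### Basic hypergeometric series and little Jacobi polynomials -/

/-- `(a; q)_k = ∏_{j=0}^{k-1} (1 - a q^j)`. -/
def qPoch (q a : ℂ) (k : ℕ) : ℂ := ∏ j ∈ Finset.range k, (1 - a * q ^ j)

/-- `φ(a, b, c; t) = ∑_k (a; q)_k (b; q)_k / ((q; q)_k (c; q)_k) t^k`. If `a = q^{-n}` all terms
with `k > n` vanish. -/
def basicHyp (q a b c t : ℂ) : ℂ :=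
  ∑' k : ℕ, qPoch q a k * qPoch q b k / (qPoch q q k * qPoch q c k) * t ^ k

/-- The little Jacobi polynomial
`p_n^{(α,β)}(t) = φ(q^{-n}, q^{α+β+n+1}, q^{α+1}; q t)` with `q = exp(2πi ω)`. -/
def littleJacobi (ω : ℝ) (n : ℕ) (α β t : ℂ) : ℂ :=
  basicHyp (qpow ω 1) (qpow ω (-n)) (qpow ω (α + β + n + 1)) (qpow ω (α + 1)) (qpow ω 1 * t)

/-- The parameters for which both sides of the limit formula are defined: `⟨β⟩` and `⟨γ⟩` are
finite and nonzero, the poles attached to `β` and those attached to `γ` do not meet, and no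
denominator `(q^γ; q)_k` with `k ≤ n` vanishes. -/
structure Admissible (ω : ℝ) (n : ℕ) (β γ : ℂ) : Prop where
  beta_nonpos : β ∉ latNonpos ω
  beta_pos : β ∉ latPos ω
  gamma_nonpos : γ ∉ latNonpos ω
  gamma_pos : γ ∉ latPos ω
  gamma_sub_beta : γ - β ∉ latPos ω
  denom_ne_zero : qPoch (qpow ω 1) (qpow ω γ) n ≠ 0

end QHyp

end

namespace QHyp

open MeasureTheory

/-! As `α → -n` the left poles `-α - j` with `j ≤ n` run into the right poles `0, 1, …, n` and pinch
the contour `C₀`. At `α = -n` no other coincidences occur, because `ω` is irrational and `(β, γ)` is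
admissible. So there is a contour `C` with all left poles for `α = -n`, hence also `0, …, n`, on its
left and the remaining right poles on its right. For `α` near `-n` the left poles move only a little
and `C` stays valid. Passing from `C₀` to `C` costs `-2πi` times the residues at `0, …, n`: `Ψ =
prefactor · ∫_C + ∑_{k ≤ n} prefactor · (-2πi) · Res_k`. The integral over `C` stays bounded while
the prefactor contains `⟨α⟩ → ⟨-n⟩ = 0`, so the first term dies. By `⟨x⟩ = ⟨x + k⟩ (q^x; q)_k` and
`⟨1/ω⟩ = ω⟨1⟩` the `k`-th residue term is exactly the `k`-th term of `φ(q^α, q^β, q^γ; q^x)`, which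
is continuous in `α`. This is `tendsto_Psi`; part (2) is a substitution.

The analysis of `⟨·⟩` rests on two facts. The functional equation `⟨x + 1⟩ = ⟨x⟩ / (1 - q^x)` comes
from the integral representation: a difference of two kernels integrates to minus the logarithm of a
sine (`exp_integral_cshKernel`). It yields the continuation, the zeros and the poles. The growth
estimate `log|⟨x⟩| = -πω (Re x - (1 + 1/ω)/2)(|Im x| - Im x) + O(1)` (`exists_abs_log_norm_brk_le`)
gives exponential decay of the integrand on the imaginary axis, uniformly in `α`
(`exists_norm_integrand_le`).

The geometry uses only polygons and primitives. Sides of a contour are measured by the limit of `∫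
dz / (z - p)`. A separating contour is a vertical line with finitely many square loops, each moving
one pole to the other side (`exists_contour_separating`). The residue theorem
(`polyIntegral_sub_eq_sum_residues`) weighs each residue by the difference of these integrals, so
only poles lying on different sides of the two contours contribute. -/

/-! ### Convergence and holomorphy of the double sine integral in the strip. -/

theorem norm_sinh_sub_self_le (w : ℂ) : ‖Complex.sinh w - w‖ ≤ ‖w‖ ^ 3 * Real.exp ‖w‖ := by
  have h1 := Complex.norm_exp_sub_sum_le_norm_mul_exp w 3
  have h2 := Complex.norm_exp_sub_sum_le_norm_mul_exp (-w) 3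
  rw [norm_neg] at h2
  have h3 : Complex.sinh w - w = ((Complex.exp w - ∑ m ∈ Finset.range 3, w ^ m / m.factorial)
      - (Complex.exp (-w) - ∑ m ∈ Finset.range 3, (-w) ^ m / m.factorial)) / 2 := by
    simp only [Finset.sum_range_succ, Finset.sum_range_zero, Complex.sinh, Nat.factorial]
    push_cast
    ring
  rw [h3, norm_div, Complex.norm_two, div_le_iff₀ two_pos]
  exact (norm_sub_le _ _).trans (by linarith)

theorem norm_sinh_le_exp_abs_re (w : ℂ) : ‖Complex.sinh w‖ ≤ Real.exp |w.re| := by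
  rw [Complex.sinh, norm_div, Complex.norm_two, div_le_iff₀ two_pos]
  refine (norm_sub_le _ _).trans ?_
  rw [Complex.norm_exp, Complex.norm_exp, Complex.neg_re]
  have h1 := Real.exp_le_exp.2 (le_abs_self w.re)
  have h2 := Real.exp_le_exp.2 (neg_le_abs w.re)
  linarith

theorem sinh_le_mul_exp (u : ℝ) : Real.sinh u ≤ u * Real.exp u := by
  have h1 := Real.add_one_le_exp (-(2 * u))
  have h2 : Real.exp (-u) = Real.exp (-(2 * u)) * Real.exp u := by
    rw [← Real.exp_add]; ring_nf
  rw [Real.sinh_eq, h2]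
  nlinarith [Real.exp_pos u]

theorem sinh_sub_self_le {u : ℝ} (hu : 0 ≤ u) : Real.sinh u - u ≤ u ^ 3 * Real.exp u := by
  have h := norm_sinh_sub_self_le (u : ℂ)
  rw [← Complex.ofReal_sinh, ← Complex.ofReal_sub, Complex.norm_real, Complex.norm_real,
    Real.norm_of_nonneg hu] at h
  exact (le_abs_self _).trans h

theorem exp_mul_le_sinh {u₀ u : ℝ} (h : u₀ ≤ u) :
    (1 - Real.exp (-(2 * u₀))) / 2 * Real.exp u ≤ Real.sinh u := by
  have h2 : Real.exp (-u) = Real.exp (-(2 * u)) * Real.exp u := by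
    rw [← Real.exp_add]; ring_nf
  have h3 : Real.exp (-(2 * u)) ≤ Real.exp (-(2 * u₀)) := Real.exp_le_exp.2 (by linarith)
  rw [Real.sinh_eq, h2]
  nlinarith [Real.exp_pos u]

/-- The integrand of `log S₂`, as a function of `a = x - (w₁ + w₂) / 2`. -/
noncomputable def dsKernel (w₁ w₂ : ℝ) (a : ℂ) (t : ℝ) : ℂ :=
  (Complex.sinh (a * t) / (2 * Complex.sinh (w₁ * t / 2) * Complex.sinh (w₂ * t / 2))
    - 2 * a / (w₁ * w₂ * t)) / t

theorem doubleSineStrip_eq (w₁ w₂ : ℝ) (x : ℂ) :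
    doubleSineStrip w₁ w₂ x =
      Complex.exp (∫ t in Set.Ioi (0 : ℝ), dsKernel w₁ w₂ (x - (w₁ + w₂) / 2) t) := by
  unfold doubleSineStrip dsKernel
  congr 2
  ext t
  ring_nf

variable {w₁ w₂ : ℝ}

/-- The singularities at `t = 0` cancel. With `D = 2 sinh(w₁t/2) sinh(w₂t/2) ≥ w₁w₂t²/2`, the kernel
is `(sinh(at) - at)/(Dt)`, a cubic quantity over a cubic one, plus `a` times a quotient whose
numerator and denominator are both of order `t⁴`. -/
theorem norm_dsKernel_le_of_le_one (hw₁ : 0 < w₁) (hw₂ : 0 < w₂) (M : ℝ) (hM : 0 ≤ M) :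
    ∃ K, 0 ≤ K ∧ ∀ a : ℂ, ‖a‖ ≤ M → ∀ t : ℝ, 0 < t → t ≤ 1 → ‖dsKernel w₁ w₂ a t‖ ≤ K := by
  refine ⟨M ^ 3 * Real.exp M * 2 / (w₁ * w₂) + M * (4 * ((w₁ * w₂ ^ 3 + w₂ * w₁ ^ 3) / 16
    * Real.exp ((w₁ + w₂) / 2)) / ((w₁ * w₂) ^ 2 / 2)), by positivity, fun a ha t ht0 ht1 => ?_⟩
  set u := w₁ * t / 2 with hu
  set v := w₂ * t / 2 with hv
  have hu0 : 0 < u := by positivity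
  have hv0 : 0 < v := by positivity
  have hsu : u ≤ Real.sinh u := Real.self_le_sinh_iff.2 hu0.le
  have hsv : v ≤ Real.sinh v := Real.self_le_sinh_iff.2 hv0.le
  set D : ℝ := 2 * Real.sinh u * Real.sinh v with hD
  have huv : u * v ≤ Real.sinh u * Real.sinh v := mul_le_mul hsu hsv hv0.le (hu0.le.trans hsu)
  have hDle : w₁ * w₂ * t ^ 2 / 2 ≤ D := by
    have : w₁ * w₂ * t ^ 2 / 2 = 2 * (u * v) := by rw [hu, hv]; ring
    rw [this, hD]; linarith
  have hDpos : 0 < D := lt_of_lt_of_le (by positivity) hDle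
  have hker : dsKernel w₁ w₂ a t = (Complex.sinh (a * t) - a * t) / ((D * t : ℝ) : ℂ)
      + a * (((-(2 * D - w₁ * w₂ * t ^ 2)) / (D * (w₁ * w₂ * t) * t) : ℝ) : ℂ) := by
    have hDc : (D : ℂ) = 2 * Complex.sinh (w₁ * t / 2) * Complex.sinh (w₂ * t / 2) := by
      rw [hD, hu, hv]; push_cast; ring
    have h1 : (D : ℂ) ≠ 0 := Complex.ofReal_ne_zero.2 hDpos.ne'
    have h2 : (t : ℂ) ≠ 0 := Complex.ofReal_ne_zero.2 ht0.ne'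
    have h3 : (w₁ : ℂ) ≠ 0 := Complex.ofReal_ne_zero.2 hw₁.ne'
    have h4 : (w₂ : ℂ) ≠ 0 := Complex.ofReal_ne_zero.2 hw₂.ne'
    unfold dsKernel
    rw [← hDc]
    push_cast
    field_simp
    ring
  rw [hker]
  refine (norm_add_le _ _).trans (add_le_add ?_ ?_)
  · rw [norm_div, Complex.norm_real, Real.norm_of_nonneg (by positivity), div_le_iff₀ (by positivity)]
    refine (norm_sinh_sub_self_le _).trans ?_
    have hn : ‖a * t‖ ≤ M * t := by
      rw [norm_mul, Complex.norm_real, Real.norm_of_nonneg ht0.le]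
      gcongr
    have hn2 : ‖a * t‖ ≤ M := hn.trans (mul_le_of_le_one_right hM ht1)
    calc ‖a * t‖ ^ 3 * Real.exp ‖a * t‖ ≤ (M * t) ^ 3 * Real.exp M := by gcongr
      _ = M ^ 3 * Real.exp M * 2 / (w₁ * w₂) * (w₁ * w₂ * t ^ 2 / 2 * t) := by
          field_simp
      _ ≤ _ := by gcongr
  · rw [norm_mul, Complex.norm_real, Real.norm_eq_abs, neg_div, abs_neg]
    have h0 : 0 ≤ 2 * D - w₁ * w₂ * t ^ 2 := by linarith
    refine mul_le_mul ha ?_ (abs_nonneg _) hM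
    rw [abs_of_nonneg (by positivity)]
    have hnum : 2 * D - w₁ * w₂ * t ^ 2 ≤ 4 * ((w₁ * w₂ ^ 3 + w₂ * w₁ ^ 3) / 16
        * Real.exp ((w₁ + w₂) / 2)) * t ^ 4 := by
      -- Here `w₁w₂t² = 4uv`, so the numerator is `4(sinh u sinh v - uv)`, split so that each
      -- summand has a factor `sinh - id` of third order.
      have e1 : 2 * D - w₁ * w₂ * t ^ 2
          = 4 * (Real.sinh u * (Real.sinh v - v) + v * (Real.sinh u - u)) := by
        rw [hD, hu, hv]; ring
      have e2 : Real.sinh u * (Real.sinh v - v) ≤ (u * Real.exp u) * (v ^ 3 * Real.exp v) :=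
        mul_le_mul (sinh_le_mul_exp u) (sinh_sub_self_le hv0.le) (by linarith) (by positivity)
      have e3 : v * (Real.sinh u - u) ≤ v * (u ^ 3 * Real.exp u) := by
        gcongr; exact sinh_sub_self_le hu0.le
      have e4 : Real.exp u ≤ Real.exp (u + v) := Real.exp_le_exp.2 (by linarith)
      have e5 : Real.exp (u + v) ≤ Real.exp ((w₁ + w₂) / 2) := by
        apply Real.exp_le_exp.2
        rw [hu, hv]
        nlinarith
      calc 2 * D - w₁ * w₂ * t ^ 2
          ≤ 4 * ((u * Real.exp u) * (v ^ 3 * Real.exp v) + v * (u ^ 3 * Real.exp u)) := by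
            rw [e1]; linarith
        _ = 4 * (u * v ^ 3 * Real.exp (u + v) + v * u ^ 3 * Real.exp u) := by
            rw [Real.exp_add]; ring
        _ ≤ 4 * (u * v ^ 3 * Real.exp ((w₁ + w₂) / 2) + v * u ^ 3 * Real.exp ((w₁ + w₂) / 2)) := by
            have e6 := e4.trans e5
            gcongr
        _ = _ := by rw [hu, hv]; ring
    have hden : (w₁ * w₂) ^ 2 / 2 * t ^ 4 ≤ D * (w₁ * w₂ * t) * t := by
      calc (w₁ * w₂) ^ 2 / 2 * t ^ 4 = w₁ * w₂ * t ^ 2 / 2 * (w₁ * w₂ * t) * t := by ring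
        _ ≤ _ := by gcongr
    rw [div_le_iff₀ (by positivity)]
    calc _ ≤ _ := hnum
      _ = 4 * ((w₁ * w₂ ^ 3 + w₂ * w₁ ^ 3) / 16 * Real.exp ((w₁ + w₂) / 2)) / ((w₁ * w₂) ^ 2 / 2)
          * ((w₁ * w₂) ^ 2 / 2 * t ^ 4) := by field_simp
      _ ≤ _ := by gcongr

/-- The numerator is at most `e^{st}` and the denominator is at least a multiple of
`e^{(w₁+w₂)t/2}`, so the first part decays exponentially with rate `d = (w₁+w₂)/2 - s`. The
subtracted term is what limits the decay to `t⁻²`. -/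
theorem norm_dsKernel_le_of_one_le (hw₁ : 0 < w₁) (hw₂ : 0 < w₂) {s M : ℝ} (hM : 0 ≤ M)
    (hs : s < (w₁ + w₂) / 2) :
    ∃ K, 0 ≤ K ∧ ∀ a : ℂ, |a.re| ≤ s → ‖a‖ ≤ M → ∀ t : ℝ, 1 ≤ t →
      ‖dsKernel w₁ w₂ a t‖ ≤ K * (t ^ 2)⁻¹ := by
  set k₁ := (1 - Real.exp (-(2 * (w₁ / 2)))) / 2 with hk₁
  set k₂ := (1 - Real.exp (-(2 * (w₂ / 2)))) / 2 with hk₂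
  have hk₁0 : 0 < k₁ := by
    have : Real.exp (-(2 * (w₁ / 2))) < 1 := by
      rw [Real.exp_lt_one_iff]; linarith
    rw [hk₁]; linarith
  have hk₂0 : 0 < k₂ := by
    have : Real.exp (-(2 * (w₂ / 2))) < 1 := by
      rw [Real.exp_lt_one_iff]; linarith
    rw [hk₂]; linarith
  set d := (w₁ + w₂) / 2 - s with hd
  have hd0 : 0 < d := by rw [hd]; linarith
  refine ⟨(2 * (k₁ * k₂))⁻¹ * d⁻¹ + 2 * M / (w₁ * w₂), by positivity, fun a ha haM t ht => ?_⟩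
  have ht0 : 0 < t := by linarith
  set D : ℝ := 2 * Real.sinh (w₁ * t / 2) * Real.sinh (w₂ * t / 2) with hD
  have hDc : (D : ℂ) = 2 * Complex.sinh (w₁ * t / 2) * Complex.sinh (w₂ * t / 2) := by
    rw [hD]; push_cast; ring
  have hDle : 2 * (k₁ * k₂) * Real.exp ((w₁ + w₂) / 2 * t) ≤ D := by
    have h1 : k₁ * Real.exp (w₁ * t / 2) ≤ Real.sinh (w₁ * t / 2) :=
      exp_mul_le_sinh (by nlinarith)
    have h2 : k₂ * Real.exp (w₂ * t / 2) ≤ Real.sinh (w₂ * t / 2) :=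
      exp_mul_le_sinh (by nlinarith)
    have h3 : 0 ≤ Real.sinh (w₁ * t / 2) := Real.sinh_nonneg_iff.2 (by positivity)
    calc _ = 2 * ((k₁ * Real.exp (w₁ * t / 2)) * (k₂ * Real.exp (w₂ * t / 2))) := by
          rw [show (w₁ + w₂) / 2 * t = w₁ * t / 2 + w₂ * t / 2 by ring, Real.exp_add]; ring
      _ ≤ 2 * (Real.sinh (w₁ * t / 2) * Real.sinh (w₂ * t / 2)) := by gcongr
      _ = D := by rw [hD]; ring
  have hDpos : 0 < D := lt_of_lt_of_le (by positivity) hDle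
  have hker : dsKernel w₁ w₂ a t = Complex.sinh (a * t) / ((D * t : ℝ) : ℂ)
      - 2 * a / ((w₁ * w₂ * t ^ 2 : ℝ) : ℂ) := by
    unfold dsKernel
    rw [← hDc]
    push_cast
    rw [sub_div, div_div, div_div]
    ring
  rw [hker, add_mul]
  refine (norm_sub_le _ _).trans (add_le_add ?_ ?_)
  · rw [norm_div, Complex.norm_real, Real.norm_of_nonneg (by positivity), div_le_iff₀ (by positivity)]
    refine (norm_sinh_le_exp_abs_re _).trans ?_
    have h1 : |(a * t).re| ≤ s * t := by
      rw [Complex.re_mul_ofReal, abs_mul, abs_of_pos ht0]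
      gcongr
    have h2 : d * t ≤ Real.exp (d * t) := by linarith [Real.add_one_le_exp (d * t)]
    -- The bound `dt ≤ e^{dt}` trades the exponential gain for the missing power of `t`.
    calc Real.exp |(a * t).re| ≤ Real.exp (s * t) := Real.exp_le_exp.2 h1
      _ = (2 * (k₁ * k₂))⁻¹ * d⁻¹ * (t ^ 2)⁻¹ * ((2 * (k₁ * k₂)) * ((d * t) * Real.exp (s * t)) * t) := by
          field_simp
      _ ≤ (2 * (k₁ * k₂))⁻¹ * d⁻¹ * (t ^ 2)⁻¹ *
          ((2 * (k₁ * k₂)) * (Real.exp (d * t) * Real.exp (s * t)) * t) := by gcongr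
      _ = (2 * (k₁ * k₂))⁻¹ * d⁻¹ * (t ^ 2)⁻¹ *
          ((2 * (k₁ * k₂)) * Real.exp ((w₁ + w₂) / 2 * t) * t) := by
          rw [← Real.exp_add, hd]; ring_nf
      _ ≤ _ := by gcongr
  · rw [norm_div, norm_mul, Complex.norm_two, Complex.norm_real, Real.norm_of_nonneg (by positivity)]
    rw [← div_eq_mul_inv, div_div]
    gcongr

theorem exists_norm_dsKernel_le (hw₁ : 0 < w₁) (hw₂ : 0 < w₂) {s : ℝ} (M : ℝ)
    (hs : s < (w₁ + w₂) / 2) :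
    ∃ K, 0 ≤ K ∧ ∀ a : ℂ, |a.re| ≤ s → ‖a‖ ≤ M → ∀ t : ℝ, 0 < t →
      ‖dsKernel w₁ w₂ a t‖ ≤ K * (1 + t ^ 2)⁻¹ := by
  rcases lt_or_ge M 0 with hM | hM
  · exact ⟨0, le_rfl, fun a _ ha => absurd (norm_nonneg a) (by linarith)⟩
  obtain ⟨K₁, h₁0, h₁⟩ := norm_dsKernel_le_of_le_one hw₁ hw₂ M hM
  obtain ⟨K₂, h₂0, h₂⟩ := norm_dsKernel_le_of_one_le hw₁ hw₂ hM hs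
  refine ⟨2 * K₁ + 2 * K₂, by positivity, fun a ha haM t ht => ?_⟩
  rw [← div_eq_mul_inv, le_div_iff₀ (by positivity)]
  rcases le_total t 1 with h | h
  · calc _ ≤ K₁ * 2 := by
          refine mul_le_mul (h₁ a haM t ht h) ?_ (by positivity) h₁0
          nlinarith
      _ ≤ _ := by linarith
  · have := h₂ a ha haM t h
    calc _ ≤ K₂ * (t ^ 2)⁻¹ * (2 * t ^ 2) := by
          refine mul_le_mul this ?_ (by positivity) (by positivity)
          nlinarith
      _ = 2 * K₂ := by field_simp
      _ ≤ _ := by linarith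

/-- For holomorphic integrands a majorant of `G` alone suffices: Cauchy's estimate on discs of
radius `r/4` turns it into a majorant of the derivative. -/
theorem hasDerivAt_integral_of_norm_le {X : Type*} [MeasurableSpace X] {μ : Measure X}
    {G : ℂ → X → ℂ} {U : Set ℂ} (hU : IsOpen U) {x₀ : ℂ} (hx₀ : x₀ ∈ U) {bound : X → ℝ}
    (hb : Integrable bound μ) (hG : ∀ᵐ t ∂μ, ∀ x ∈ U, ‖G x t‖ ≤ bound t)
    (hd : ∀ᵐ t ∂μ, DifferentiableOn ℂ (fun x => G x t) U)
    (hm : ∀ x ∈ U, AEStronglyMeasurable (G x) μ) :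
    Integrable (fun t => deriv (fun x => G x t) x₀) μ ∧
      HasDerivAt (fun x => ∫ t, G x t ∂μ) (∫ t, deriv (fun x => G x t) x₀ ∂μ) x₀ := by
  obtain ⟨r, hr, hrU⟩ := Metric.isOpen_iff.1 hU x₀ hx₀
  have hsub : ∀ x ∈ Metric.ball x₀ (r / 2), Metric.closedBall x (r / 4) ⊆ U := by
    intro x hx y hy
    apply hrU
    rw [Metric.mem_ball] at hx ⊢
    rw [Metric.mem_closedBall] at hy
    linarith [dist_triangle y x x₀]
  have hmem : ∀ n : ℕ, x₀ + (r / 2 * (1 / ((n : ℝ) + 1)) : ℝ) ∈ U := by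
    intro n
    apply hrU
    have h1 : 1 / ((n : ℝ) + 1) ≤ 1 := by
      rw [div_le_one (by positivity)]; linarith [(Nat.cast_nonneg n : (0 : ℝ) ≤ n)]
    rw [Metric.mem_ball, dist_eq_norm, add_sub_cancel_left, Complex.norm_real,
      Real.norm_of_nonneg (by positivity)]
    nlinarith
  refine hasDerivAt_integral_of_dominated_loc_of_deriv_le
    (F' := fun x t => deriv (fun y => G y t) x) (bound := fun t => bound t / (r / 4))
    (Metric.ball_mem_nhds x₀ (half_pos hr)) ?_ ?_ ?_ ?_ (hb.div_const _) ?_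
  · filter_upwards [hU.mem_nhds hx₀] with x hx using hm x hx
  · exact hb.mono' (hm x₀ hx₀) (by filter_upwards [hG] with t ht using ht x₀ hx₀)
  -- The derivative at `x₀` is measurable in `t` as a pointwise limit of difference quotients along
  -- a sequence tending to `x₀`.
  · refine aestronglyMeasurable_of_tendsto_ae (u := atTop) (f := fun (n : ℕ) t =>
      slope (fun x => G x t) x₀ (x₀ + (r / 2 * (1 / ((n : ℝ) + 1)) : ℝ))) ?_ ?_
    · intro n
      simp only [slope_def_field, div_eq_mul_inv]
      exact ((hm _ (hmem n)).sub (hm _ hx₀)).mul_const _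
    · filter_upwards [hd] with t ht
      have h1 := (ht.differentiableAt (hU.mem_nhds hx₀)).hasDerivAt.tendsto_slope
      refine h1.comp (tendsto_nhdsWithin_iff.2 ⟨?_, ?_⟩)
      · have h2 : Tendsto (fun n : ℕ => r / 2 * (1 / ((n : ℝ) + 1))) atTop (𝓝 0) := by
          simpa using tendsto_one_div_add_atTop_nhds_zero_nat.const_mul (r / 2)
        have h3 := (Complex.continuous_ofReal.tendsto 0).comp h2
        simpa using h3.const_add x₀
      · filter_upwards with n
        have : (r / 2 * (1 / ((n : ℝ) + 1)) : ℝ) ≠ 0 := by positivity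
        rw [Set.mem_compl_iff, Set.mem_singleton_iff, add_eq_left, Complex.ofReal_eq_zero]
        exact this
  · filter_upwards [hG, hd] with t ht htd x hx
    refine Complex.norm_deriv_le_of_forall_mem_sphere_norm_le (by positivity) ?_ ?_
    · apply DifferentiableOn.diffContOnCl
      rw [closure_ball _ (by positivity)]
      exact htd.mono (hsub x hx)
    · exact fun z hz => ht z (hsub x hx (Metric.sphere_subset_closedBall hz))
  · filter_upwards [hd] with t ht x hx
    refine (ht.differentiableAt (hU.mem_nhds ?_)).hasDerivAt
    exact hsub x hx (Metric.mem_closedBall_self (by positivity))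

theorem sinh_ofReal_ne_zero {u : ℝ} (hu : u ≠ 0) : Complex.sinh u ≠ 0 := by
  rw [← Complex.ofReal_sinh, Complex.ofReal_ne_zero]
  rwa [Ne, Real.sinh_eq_zero]

theorem sinh_mul_div_two_ne_zero {w t : ℝ} (hw : 0 < w) (ht : 0 < t) :
    Complex.sinh (w * t / 2) ≠ 0 := by
  have := sinh_ofReal_ne_zero (u := w * t / 2) (by positivity)
  push_cast at this
  exact this

theorem continuousOn_dsKernel (hw₁ : 0 < w₁) (hw₂ : 0 < w₂) (a : ℂ) :
    ContinuousOn (dsKernel w₁ w₂ a) (Set.Ioi 0) := by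
  intro t ht
  have h1 := sinh_mul_div_two_ne_zero hw₁ ht
  have h2 := sinh_mul_div_two_ne_zero hw₂ ht
  have h3 : (t : ℂ) ≠ 0 := Complex.ofReal_ne_zero.2 (ne_of_gt ht)
  have h4 : (w₁ : ℂ) ≠ 0 := Complex.ofReal_ne_zero.2 hw₁.ne'
  have h5 : (w₂ : ℂ) ≠ 0 := Complex.ofReal_ne_zero.2 hw₂.ne'
  apply ContinuousAt.continuousWithinAt
  unfold dsKernel
  refine ContinuousAt.div (ContinuousAt.sub (ContinuousAt.div (by fun_prop) (by fun_prop) ?_)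
    (ContinuousAt.div (by fun_prop) (by fun_prop) ?_)) (by fun_prop) h3
  · exact mul_ne_zero (mul_ne_zero two_ne_zero h1) h2
  · exact mul_ne_zero (mul_ne_zero h4 h5) h3

theorem aestronglyMeasurable_dsKernel (hw₁ : 0 < w₁) (hw₂ : 0 < w₂) (a : ℂ) :
    AEStronglyMeasurable (dsKernel w₁ w₂ a) (volume.restrict (Set.Ioi 0)) :=
  (continuousOn_dsKernel hw₁ hw₂ a).aestronglyMeasurable measurableSet_Ioi

theorem integrableOn_mul_inv_one_add_sq (K : ℝ) (s : Set ℝ) :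
    IntegrableOn (fun t : ℝ => K * (1 + t ^ 2)⁻¹) s :=
  (integrable_inv_one_add_sq.const_mul K).integrableOn

theorem integrableOn_dsKernel (hw₁ : 0 < w₁) (hw₂ : 0 < w₂) {a : ℂ}
    (ha : |a.re| < (w₁ + w₂) / 2) : IntegrableOn (dsKernel w₁ w₂ a) (Set.Ioi 0) := by
  obtain ⟨K, _, hK⟩ := exists_norm_dsKernel_le hw₁ hw₂ ‖a‖ ha
  refine (integrableOn_mul_inv_one_add_sq K _).mono' (aestronglyMeasurable_dsKernel hw₁ hw₂ a) ?_
  filter_upwards [ae_restrict_mem measurableSet_Ioi] with t ht using hK a le_rfl le_rfl t ht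

theorem isOpen_abs_re_lt_inter_norm_lt (s M : ℝ) : IsOpen {a : ℂ | |a.re| < s ∧ ‖a‖ < M} :=
  (isOpen_lt (f := fun a : ℂ => |a.re|) (g := fun _ => s) (by fun_prop) (by fun_prop)).inter
    (isOpen_lt (f := fun a : ℂ => ‖a‖) (g := fun _ => M) (by fun_prop) (by fun_prop))

theorem differentiableAt_integral_dsKernel (hw₁ : 0 < w₁) (hw₂ : 0 < w₂) {a : ℂ}
    (ha : |a.re| < (w₁ + w₂) / 2) :
    DifferentiableAt ℂ (fun a => ∫ t in Set.Ioi (0 : ℝ), dsKernel w₁ w₂ a t) a := by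
  obtain ⟨s, hs1, hs2⟩ := exists_between ha
  obtain ⟨K, _, hK⟩ := exists_norm_dsKernel_le hw₁ hw₂ (‖a‖ + 1) hs2
  refine (hasDerivAt_integral_of_norm_le (isOpen_abs_re_lt_inter_norm_lt s (‖a‖ + 1))
    (x₀ := a) ⟨hs1, by linarith⟩ (integrableOn_mul_inv_one_add_sq K (Set.Ioi 0)) ?_ ?_ ?_).2.differentiableAt
  · filter_upwards [ae_restrict_mem measurableSet_Ioi] with t ht x hx
      using hK x hx.1.le hx.2.le t ht
  · filter_upwards with t
    unfold dsKernel
    fun_prop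
  · exact fun x _ => aestronglyMeasurable_dsKernel hw₁ hw₂ x

theorem differentiableAt_doubleSineStrip (hw₁ : 0 < w₁) (hw₂ : 0 < w₂) {x : ℂ}
    (h0 : 0 < x.re) (h1 : x.re < w₁ + w₂) : DifferentiableAt ℂ (doubleSineStrip w₁ w₂) x := by
  have h : doubleSineStrip w₁ w₂ = fun x : ℂ => Complex.exp
      ((fun a => ∫ t in Set.Ioi (0 : ℝ), dsKernel w₁ w₂ a t) (x - (w₁ + w₂) / 2)) :=
    funext fun x => doubleSineStrip_eq w₁ w₂ x
  rw [h]
  refine DifferentiableAt.cexp ?_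
  refine DifferentiableAt.comp (g := fun a => ∫ t in Set.Ioi (0 : ℝ), dsKernel w₁ w₂ a t) x
    (differentiableAt_integral_dsKernel hw₁ hw₂ ?_) (by fun_prop)
  have : (x - (w₁ + w₂) / 2 : ℂ).re = x.re - (w₁ + w₂) / 2 := by
    rw [Complex.sub_re]
    norm_num [← Complex.ofReal_add, Complex.div_re]
  rw [this, abs_lt]
  constructor <;> linarith

/-! ### The functional equation of the double sine function in the strip. -/

/-- The difference of two values of `dsKernel` at distance `w₁`. -/
noncomputable def cshKernel (w : ℝ) (b : ℂ) (t : ℝ) : ℂ :=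
  (Complex.cosh (b * t) / Complex.sinh (w * t / 2) - 2 / (w * t)) / t

/-- By the addition theorem the difference of the numerators is `2 cosh(bt) sinh(w₁t/2)`, and the
sine factor cancels. The result no longer involves `w₁`. -/
theorem dsKernel_sub_dsKernel (hw₁ : 0 < w₁) (hw₂ : 0 < w₂) (b : ℂ) {t : ℝ} (ht : 0 < t) :
    dsKernel w₁ w₂ (b + w₁ / 2) t - dsKernel w₁ w₂ (b - w₁ / 2) t = cshKernel w₂ b t := by
  have h1 := sinh_mul_div_two_ne_zero hw₁ ht
  have h2 := sinh_mul_div_two_ne_zero hw₂ ht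
  have h3 : (t : ℂ) ≠ 0 := Complex.ofReal_ne_zero.2 (ne_of_gt ht)
  have h4 : (w₁ : ℂ) ≠ 0 := Complex.ofReal_ne_zero.2 hw₁.ne'
  have h5 : (w₂ : ℂ) ≠ 0 := Complex.ofReal_ne_zero.2 hw₂.ne'
  have e1 : Complex.sinh ((b + w₁ / 2) * t) = Complex.sinh (b * t) * Complex.cosh (w₁ * t / 2)
      + Complex.cosh (b * t) * Complex.sinh (w₁ * t / 2) := by
    rw [← Complex.sinh_add]; ring_nf
  have e2 : Complex.sinh ((b - w₁ / 2) * t) = Complex.sinh (b * t) * Complex.cosh (w₁ * t / 2)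
      - Complex.cosh (b * t) * Complex.sinh (w₁ * t / 2) := by
    rw [← Complex.sinh_sub]; ring_nf
  unfold dsKernel cshKernel
  rw [e1, e2]
  generalize Complex.sinh (w₁ * t / 2) = s₁ at *
  generalize Complex.sinh (w₂ * t / 2) = s₂ at *
  field_simp
  ring

/-- Since `cshKernel` does not depend on `w₁`, it can be written as a difference of two values of
`dsKernel w w`, whose bounds are known. -/
theorem exists_norm_cshKernel_le {w : ℝ} (hw : 0 < w) {s : ℝ} (M : ℝ) (hs : s < w / 2) :
    ∃ K, 0 ≤ K ∧ ∀ b : ℂ, |b.re| ≤ s → ‖b‖ ≤ M → ∀ t : ℝ, 0 < t →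
      ‖cshKernel w b t‖ ≤ K * (1 + t ^ 2)⁻¹ := by
  obtain ⟨K, hK0, hK⟩ := exists_norm_dsKernel_le hw hw (s := s + w / 2) (M + w / 2) (by linarith)
  have hre : ((w : ℂ) / 2).re = w / 2 := by
    rw [← Complex.ofReal_ofNat, ← Complex.ofReal_div, Complex.ofReal_re]
  have hn : ‖(w : ℂ) / 2‖ = w / 2 := by
    rw [norm_div, Complex.norm_two, Complex.norm_real, Real.norm_of_nonneg hw.le]
  refine ⟨2 * K, by positivity, fun b hb hbM t ht => ?_⟩
  rw [← dsKernel_sub_dsKernel hw hw b ht]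
  rw [abs_le] at hb
  refine (norm_sub_le _ _).trans ?_
  have h1 := hK (b + w / 2) (by rw [Complex.add_re, hre, abs_le]; constructor <;> linarith)
    ((norm_add_le _ _).trans (by rw [hn]; linarith)) t ht
  have h2 := hK (b - w / 2) (by rw [Complex.sub_re, hre, abs_le]; constructor <;> linarith)
    ((norm_sub_le _ _).trans (by rw [hn]; linarith)) t ht
  linarith

theorem continuousOn_cshKernel {w : ℝ} (hw : 0 < w) (b : ℂ) :
    ContinuousOn (cshKernel w b) (Set.Ioi 0) := by
  intro t ht
  have h2 := sinh_mul_div_two_ne_zero hw ht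
  have h3 : (t : ℂ) ≠ 0 := Complex.ofReal_ne_zero.2 (ne_of_gt ht)
  have h4 : (w : ℂ) ≠ 0 := Complex.ofReal_ne_zero.2 hw.ne'
  apply ContinuousAt.continuousWithinAt
  unfold cshKernel
  exact ContinuousAt.div (ContinuousAt.sub (ContinuousAt.div (by fun_prop) (by fun_prop) h2)
    (ContinuousAt.div (by fun_prop) (by fun_prop) (mul_ne_zero h4 h3))) (by fun_prop) h3

theorem hasDerivAt_integral_cshKernel {w : ℝ} (hw : 0 < w) {b : ℂ} (hb : |b.re| < w / 2) :
    IntegrableOn (fun t : ℝ => Complex.sinh (b * t) / Complex.sinh (w * t / 2)) (Set.Ioi 0) ∧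
    HasDerivAt (fun b => ∫ t in Set.Ioi (0 : ℝ), cshKernel w b t)
      (∫ t in Set.Ioi (0 : ℝ), Complex.sinh (b * t) / Complex.sinh (w * t / 2)) b := by
  obtain ⟨s, hs1, hs2⟩ := exists_between hb
  obtain ⟨K, _, hK⟩ := exists_norm_cshKernel_le hw (‖b‖ + 1) hs2
  have h := hasDerivAt_integral_of_norm_le (G := cshKernel w)
    (isOpen_abs_re_lt_inter_norm_lt s (‖b‖ + 1))
    (x₀ := b) ⟨hs1, by linarith⟩ (integrableOn_mul_inv_one_add_sq K (Set.Ioi 0))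
    (by filter_upwards [ae_restrict_mem measurableSet_Ioi] with t ht x hx
          using hK x hx.1.le hx.2.le t ht)
    (by filter_upwards with t
        unfold cshKernel
        fun_prop)
    (fun x _ => (continuousOn_cshKernel hw x).aestronglyMeasurable measurableSet_Ioi)
  have hder : ∀ t ∈ Set.Ioi (0 : ℝ), deriv (fun x => cshKernel w x t) b
      = Complex.sinh (b * t) / Complex.sinh (w * t / 2) := by
    intro t ht
    have h3 : (t : ℂ) ≠ 0 := Complex.ofReal_ne_zero.2 (ne_of_gt ht)
    have h4 : HasDerivAt (fun x : ℂ => x * (t : ℂ)) (t : ℂ) b := hasDerivAt_mul_const _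
    have h5 := (((h4.ccosh).div_const (Complex.sinh (w * t / 2))).sub_const
      (2 / (w * t : ℂ))).div_const (t : ℂ)
    unfold cshKernel
    rw [h5.deriv]
    field_simp
  refine ⟨(integrableOn_congr_fun hder measurableSet_Ioi).1 h.1, ?_⟩
  rw [← setIntegral_congr_fun measurableSet_Ioi hder]
  exact h.2

/-- Expanding `1/sinh(wt/2)` in powers of `e^{-wt}` and integrating termwise gives the partial
fractions of the cotangent. The factor `1 - e^{-Nwt}` truncates the geometric series exactly, so
only finite sums are interchanged with the integral, and dominated convergence removes it. -/
theorem integral_sinh_div_sinh {w : ℝ} (hw : 0 < w) {b : ℂ} (hb : |b.re| < w / 2) :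
    ∫ t in Set.Ioi (0 : ℝ), Complex.sinh (b * t) / Complex.sinh (w * t / 2)
      = -(Real.pi / w * Complex.cot (Real.pi * ((b + w / 2) / w))) := by
  have hwc : (w : ℂ) ≠ 0 := Complex.ofReal_ne_zero.2 hw.ne'
  set y : ℂ := (b + w / 2) / w with hy
  have hyb : b = w * y - w / 2 := by rw [hy]; field_simp; ring
  have hyre : y.re = (b.re + w / 2) / w := by
    rw [hy, Complex.div_ofReal_re, Complex.add_re, ← Complex.ofReal_ofNat, ← Complex.ofReal_div,
      Complex.ofReal_re]
  rw [abs_lt] at hb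
  have hy0 : 0 < y.re := by rw [hyre]; apply div_pos _ hw; linarith
  have hy1 : y.re < 1 := by rw [hyre, div_lt_one hw]; linarith
  have hyint : y ∈ Complex.integerComplement := by
    rw [Complex.mem_integerComplement_iff]
    rintro ⟨n, hn⟩
    rw [← hn, Complex.intCast_re] at hy0 hy1
    norm_cast at hy0 hy1
    omega
  have hint := (hasDerivAt_integral_cshKernel hw (abs_lt.2 hb)).1
  have hlim1 : Tendsto (fun N : ℕ => ∫ t in Set.Ioi (0 : ℝ),
      Complex.sinh (b * t) / Complex.sinh (w * t / 2) * (1 - Complex.exp (-(w * t)) ^ N)) atTop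
      (𝓝 (∫ t in Set.Ioi (0 : ℝ), Complex.sinh (b * t) / Complex.sinh (w * t / 2))) := by
    have hexp : ∀ t : ℝ, 0 < t → ‖Complex.exp (-(w * t))‖ < 1 := by
      intro t ht
      rw [Complex.norm_exp, Real.exp_lt_one_iff]
      have : (-((w : ℂ) * t)).re = -(w * t) := by simp
      rw [this]
      have := mul_pos hw ht
      linarith
    refine tendsto_integral_of_dominated_convergence
      (fun t => 2 * ‖Complex.sinh (b * t) / Complex.sinh (w * t / 2)‖) ?_ (hint.norm.const_mul 2) ?_ ?_
    · intro N
      refine hint.aestronglyMeasurable.mul ?_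
      exact (by fun_prop : Continuous _).aestronglyMeasurable
    · intro N
      filter_upwards [ae_restrict_mem measurableSet_Ioi] with t ht
      rw [norm_mul, mul_comm]
      gcongr
      refine (norm_sub_le _ _).trans ?_
      rw [norm_one, norm_pow]
      have := pow_le_one₀ (n := N) (norm_nonneg _) (hexp t ht).le
      linarith
    · filter_upwards [ae_restrict_mem measurableSet_Ioi] with t ht
      have := ((tendsto_pow_atTop_nhds_zero_of_norm_lt_one (hexp t ht)).const_sub 1).const_mul
        (Complex.sinh (b * t) / Complex.sinh (w * t / 2))
      simpa using this
  have hterm : ∀ m : ℕ, IntegrableOn (fun t : ℝ => Complex.exp (-((m + 1 - y) * w) * t)) (Set.Ioi 0)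
      ∧ IntegrableOn (fun t : ℝ => Complex.exp (-((m + y) * w) * t)) (Set.Ioi 0)
      ∧ (∫ t in Set.Ioi (0 : ℝ), (Complex.exp (-((m + 1 - y) * w) * t)
          - Complex.exp (-((m + y) * w) * t))) = (1 / (m + 1 - y) - 1 / (m + y)) / w := by
    intro m
    have hm : (0 : ℝ) ≤ m := Nat.cast_nonneg m
    have h1 : (-((m + 1 - y) * w)).re < 0 := by
      rw [Complex.neg_re, Complex.re_mul_ofReal]
      simp only [Complex.sub_re, Complex.add_re, Complex.natCast_re, Complex.one_re]
      have : 0 < (m + 1 - y.re) * w := mul_pos (by linarith) hw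
      linarith
    have h2 : (-((m + y) * w)).re < 0 := by
      rw [Complex.neg_re, Complex.re_mul_ofReal]
      simp only [Complex.add_re, Complex.natCast_re]
      have : 0 < (m + y.re) * w := mul_pos (by linarith) hw
      linarith
    have i1 := integrableOn_exp_mul_complex_Ioi h1 0
    have i2 := integrableOn_exp_mul_complex_Ioi h2 0
    refine ⟨i1, i2, ?_⟩
    rw [integral_sub i1 i2, integral_exp_mul_complex_Ioi h1, integral_exp_mul_complex_Ioi h2]
    simp only [Complex.ofReal_zero, mul_zero, Complex.exp_zero]
    rw [div_neg, div_neg, neg_div, neg_div, neg_neg, neg_neg, sub_div, div_div, div_div]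
  have hfin : ∀ N : ℕ, ∫ t in Set.Ioi (0 : ℝ),
      Complex.sinh (b * t) / Complex.sinh (w * t / 2) * (1 - Complex.exp (-(w * t)) ^ N)
      = ∑ m ∈ Finset.range N, (1 / (m + 1 - y) - 1 / (m + y)) / w := by
    intro N
    rw [← Finset.sum_congr rfl fun m _ => (hterm m).2.2]
    have hsum := integral_finsetSum (μ := volume.restrict (Set.Ioi (0 : ℝ))) (Finset.range N)
      (f := fun (m : ℕ) (t : ℝ) => Complex.exp (-((m + 1 - y) * w) * t)
        - Complex.exp (-((m + y) * w) * t)) fun m _ => (hterm m).1.sub (hterm m).2.1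
    rw [← hsum]
    refine setIntegral_congr_fun measurableSet_Ioi fun t ht => ?_
    have hs := sinh_mul_div_two_ne_zero hw ht
    have e1 : ∀ m : ℕ, Complex.exp (-((m + 1 - y) * w) * t) - Complex.exp (-((m + y) * w) * t)
        = 2 * Complex.sinh (b * t) * Complex.exp (-(w * t / 2)) * Complex.exp (-(w * t)) ^ m := by
      intro m
      rw [← Complex.exp_nat_mul, Complex.sinh, hyb]
      rw [show 2 * ((Complex.exp ((w * y - w / 2) * t) - Complex.exp (-((w * y - w / 2) * t))) / 2)
        * Complex.exp (-(w * t / 2)) * Complex.exp (m * -(w * t))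
        = Complex.exp ((w * y - w / 2) * t) * Complex.exp (-(w * t / 2)) * Complex.exp (m * -(w * t))
        - Complex.exp (-((w * y - w / 2) * t)) * Complex.exp (-(w * t / 2)) * Complex.exp (m * -(w * t))
        by ring, ← Complex.exp_add, ← Complex.exp_add, ← Complex.exp_add, ← Complex.exp_add]
      ring_nf
    have e2 : Complex.exp (-(w * t / 2)) * 2 * Complex.sinh (w * t / 2)
        = 1 - Complex.exp (-(w * t)) := by
      rw [Complex.sinh, mul_assoc, mul_div_cancel₀ _ (two_ne_zero), mul_sub, ← Complex.exp_add,
        ← Complex.exp_add, neg_add_cancel, Complex.exp_zero]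
      ring_nf
    rw [Finset.sum_congr rfl fun m _ => e1 m, ← Finset.mul_sum, ← mul_neg_geom_sum, ← e2]
    generalize Complex.sinh (w * t / 2) = s₁ at *
    field_simp
  have hlim2 : Tendsto (fun N : ℕ => ∑ m ∈ Finset.range N,
      ((1 : ℂ) / (m + 1 - y) - 1 / (m + y)) / w) atTop
      (𝓝 (-(Real.pi / w * Complex.cot (Real.pi * y)))) := by
    -- `cotTerm` pairs `1/(y-(m+1))` with `1/(y+(m+1))`, whereas here `1/(m+1-y)` is paired with
    -- `1/(m+y)`. The index shift leaves the boundary terms `-1/y` and `1/(y+N)`.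
    have e : ∀ N : ℕ, ∑ m ∈ Finset.range N, ((1 : ℂ) / (m + 1 - y) - 1 / (m + y)) / w
        = (-(∑ m ∈ Finset.range N, cotTerm y m) - 1 / y + 1 / (y + N)) / w := by
      intro N
      induction N with
      | zero => simp
      | succ N ih =>
        rw [Finset.sum_range_succ, ih, Finset.sum_range_succ, cotTerm]
        have : (1 : ℂ) / (y - (N + 1)) = - (1 / (N + 1 - y)) := by
          rw [← div_neg]; ring_nf
        rw [this]
        push_cast
        ring
    simp_rw [e]
    have h0 : Tendsto (fun N : ℕ => 1 / (y + (N : ℂ))) atTop (𝓝 0) := by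
      simp_rw [one_div]
      refine tendsto_inv₀_cobounded.comp ?_
      refine (tendsto_const_add_cobounded (y : ℂ)).comp ?_
      exact tendsto_natCast_atTop_cobounded
    have h1 := ((((tendsto_logDeriv_euler_cot_sub hyint).neg).sub_const (1 / y)).add h0).div_const (w : ℂ)
    convert h1 using 2
    field_simp
    ring
  refine tendsto_nhds_unique hlim1 ?_
  simp_rw [hfin]
  exact hlim2

theorem sin_pi_mul_ne_zero_of_re_mem {y : ℂ} (h0 : 0 < y.re) (h1 : y.re < 1) :
    Complex.sin (Real.pi * y) ≠ 0 := by
  refine sin_pi_mul_ne_zero ?_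
  rw [Complex.mem_integerComplement_iff]
  rintro ⟨n, hn⟩
  rw [← hn, Complex.intCast_re] at h0 h1
  norm_cast at h0 h1
  omega

/-- Since `cosh(wt/4)/sinh(wt/2) = 1/(2 sinh(wt/4))`, the kernel at `-w/4` is a rescaling of the
kernel at `0`. This relation fixes the constant of integration in `exp_integral_cshKernel`. -/
theorem integral_cshKernel_quarter {w : ℝ} (hw : 0 < w) :
    2 * ∫ t in Set.Ioi (0 : ℝ), cshKernel w (-(w / 4 : ℝ)) t
      = ∫ t in Set.Ioi (0 : ℝ), cshKernel w 0 t := by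
  have h1 : ∀ t ∈ Set.Ioi (0 : ℝ), cshKernel w (-(w / 4 : ℝ)) t
      = (4⁻¹ : ℂ) * cshKernel w 0 (2⁻¹ * t) := by
    intro t ht
    have hs := sinh_mul_div_two_ne_zero hw ht
    have e : Complex.sinh (w * t / 2) = 2 * Complex.sinh (w * t / 4) * Complex.cosh (w * t / 4) := by
      rw [← Complex.sinh_two_mul]; ring_nf
    rw [e] at hs
    have hs1 : Complex.sinh (w * t / 4) ≠ 0 := by rintro h; simp [h] at hs
    have hs2 : Complex.cosh (w * t / 4) ≠ 0 := by rintro h; simp [h] at hs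
    have h3 : (t : ℂ) ≠ 0 := Complex.ofReal_ne_zero.2 (ne_of_gt ht)
    have h4 : (w : ℂ) ≠ 0 := Complex.ofReal_ne_zero.2 hw.ne'
    unfold cshKernel
    push_cast
    rw [show -(w / 4 : ℂ) * t = -(w * t / 4) by ring, Complex.cosh_neg, e, zero_mul,
      Complex.cosh_zero, show (w : ℂ) * (2⁻¹ * t) / 2 = w * t / 4 by ring]
    generalize Complex.sinh (w * t / 4) = s₁ at *
    generalize Complex.cosh (w * t / 4) = s₂ at *
    field_simp
    ring
  rw [setIntegral_congr_fun measurableSet_Ioi h1, integral_const_mul,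
    integral_comp_mul_left_Ioi (fun t => cshKernel w 0 t) 0 (by norm_num : (0 : ℝ) < 2⁻¹)]
  rw [mul_zero, inv_inv, Complex.real_smul]
  push_cast
  ring

/-- By `integral_sinh_div_sinh` the logarithmic derivatives of the two factors cancel, so `F` is
constant on the strip. With `E = exp ∫ cshKernel w (-w/4)` one finds `F 0 = 2E²` and `F (-w/4)² =
2E²`. Hence the constant satisfies `F² = F` and is nonzero, so it is `1`. -/
theorem exp_integral_cshKernel {w : ℝ} (hw : 0 < w) {b : ℂ} (hb : |b.re| < w / 2) :
    Complex.exp (∫ t in Set.Ioi (0 : ℝ), cshKernel w b t)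
      * (2 * Complex.sin (Real.pi * ((b + w / 2) / w))) = 1 := by
  have hwc : (w : ℂ) ≠ 0 := Complex.ofReal_ne_zero.2 hw.ne'
  set S : Set ℂ := {b | |b.re| < w / 2} with hS
  set F : ℂ → ℂ := fun b => Complex.exp (∫ t in Set.Ioi (0 : ℝ), cshKernel w b t)
      * (2 * Complex.sin (Real.pi * ((b + w / 2) / w))) with hF
  have hSo : IsOpen S := isOpen_lt (by fun_prop) (by fun_prop)
  have hSc : IsPreconnected S := by
    have : S = Complex.reLm ⁻¹' Metric.ball 0 (w / 2) := by
      ext z; simp [hS]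
    rw [this]
    exact ((convex_ball _ _).linear_preimage _).isPreconnected
  have hsin : ∀ b ∈ S, Complex.sin (Real.pi * ((b + w / 2) / w)) ≠ 0 := by
    intro b hb
    rw [hS, Set.mem_ofPred_eq, abs_lt] at hb
    have hyre : ((b + w / 2) / w).re = (b.re + w / 2) / w := by
      rw [Complex.div_ofReal_re, Complex.add_re, ← Complex.ofReal_ofNat, ← Complex.ofReal_div,
        Complex.ofReal_re]
    refine sin_pi_mul_ne_zero_of_re_mem ?_ ?_
    · rw [hyre]; apply div_pos _ hw; linarith
    · rw [hyre, div_lt_one hw]; linarith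
  have hder : ∀ b ∈ S, HasDerivAt F 0 b := by
    intro b hb
    have h1 := (hasDerivAt_integral_cshKernel hw hb).2
    rw [integral_sinh_div_sinh hw hb] at h1
    have h2 : HasDerivAt (fun b : ℂ => Real.pi * ((b + w / 2) / w)) (Real.pi * (1 / w) : ℂ) b :=
      (((hasDerivAt_id b).add_const _).div_const _).const_mul _
    have h3 := h1.cexp.mul ((h2.csin).const_mul 2)
    refine h3.congr_deriv ?_
    rw [Complex.cot_eq_cos_div_sin]
    have := hsin b hb
    generalize (Real.pi * ((b + w / 2) / w) : ℂ) = θ at *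
    field_simp
    ring
  have hconst : ∀ x ∈ S, ∀ y ∈ S, F x = F y := fun x hx y hy =>
    hSo.is_const_of_deriv_eq_zero hSc (fun z hz => (hder z hz).differentiableAt.differentiableWithinAt)
      (fun z hz => (hder z hz).deriv) hx hy
  have m0 : (0 : ℂ) ∈ S := by simp [hS, hw]
  have m1 : (-(w / 4 : ℝ) : ℂ) ∈ S := by
    rw [hS, Set.mem_ofPred_eq, Complex.neg_re, Complex.ofReal_re, abs_neg, abs_of_pos (by positivity)]
    linarith
  have hF0 : F 0 = Complex.exp (∫ t in Set.Ioi (0 : ℝ), cshKernel w (-(w / 4 : ℝ)) t) ^ 2 * 2 := by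
    simp only [hF]
    rw [← integral_cshKernel_quarter hw, two_mul, Complex.exp_add, zero_add,
      show (Real.pi * ((w / 2) / w) : ℂ) = Real.pi / 2 by field_simp, Complex.sin_pi_div_two]
    ring
  have hF1 : F (-(w / 4 : ℝ)) ^ 2
      = Complex.exp (∫ t in Set.Ioi (0 : ℝ), cshKernel w (-(w / 4 : ℝ)) t) ^ 2 * 2 := by
    simp only [hF]
    rw [show (Real.pi * (((-(w / 4 : ℝ) : ℂ) + w / 2) / w) : ℂ) = (Real.pi / 4 : ℝ) by
      push_cast; field_simp; ring, ← Complex.ofReal_sin, Real.sin_pi_div_four, mul_pow, mul_pow,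
      ← Complex.ofReal_pow, div_pow, Real.sq_sqrt (by norm_num)]
    push_cast
    ring
  have hsq : F 0 ^ 2 = F 0 := by
    conv_lhs => rw [hconst 0 m0 _ m1]
    rw [hF1, hF0]
  have hne : F 0 ≠ 0 := by
    rw [hF0]
    exact mul_ne_zero (pow_ne_zero _ (Complex.exp_ne_zero _)) two_ne_zero
  have h1 : F 0 = 1 := by
    have : F 0 * (F 0 - 1) = 0 := by rw [mul_sub, mul_one, ← sq, hsq, sub_self]
    rcases mul_eq_zero.1 this with h | h
    · exact absurd h hne
    · exact sub_eq_zero.1 h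
  have := hconst b hb 0 m0
  rw [h1] at this
  exact this

theorem doubleSineStrip_add_mul_sin {w₁ w₂ : ℝ} (hw₁ : 0 < w₁) (hw₂ : 0 < w₂) {x : ℂ}
    (h0 : 0 < x.re) (h1 : x.re < w₂) :
    doubleSineStrip w₁ w₂ (x + w₁) * (2 * Complex.sin (Real.pi * x / w₂))
      = doubleSineStrip w₁ w₂ x := by
  have hre : ∀ w : ℝ, ((w : ℂ) / 2).re = w / 2 := fun w => by
    rw [← Complex.ofReal_ofNat, ← Complex.ofReal_div, Complex.ofReal_re]
  set b : ℂ := x - w₂ / 2 with hb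
  have hbre : b.re = x.re - w₂ / 2 := by rw [hb, Complex.sub_re, hre]
  have hbabs : |b.re| < w₂ / 2 := by rw [hbre, abs_lt]; constructor <;> linarith
  rw [abs_lt] at hbabs
  have e1 : x + w₁ - (w₁ + w₂) / 2 = b + w₁ / 2 := by rw [hb]; ring
  have e2 : x - (w₁ + w₂) / 2 = b - w₁ / 2 := by rw [hb]; ring
  rw [doubleSineStrip_eq, doubleSineStrip_eq, e1, e2]
  have i1 : IntegrableOn (dsKernel w₁ w₂ (b + w₁ / 2)) (Set.Ioi 0) :=
    integrableOn_dsKernel hw₁ hw₂ (by rw [Complex.add_re, hre, abs_lt]; constructor <;> linarith)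
  have i2 : IntegrableOn (dsKernel w₁ w₂ (b - w₁ / 2)) (Set.Ioi 0) :=
    integrableOn_dsKernel hw₁ hw₂ (by rw [Complex.sub_re, hre, abs_lt]; constructor <;> linarith)
  have h := integral_sub i1 i2
  rw [setIntegral_congr_fun measurableSet_Ioi fun t ht => dsKernel_sub_dsKernel hw₁ hw₂ b ht] at h
  rw [← sub_add_cancel (∫ t in Set.Ioi (0 : ℝ), dsKernel w₁ w₂ (b + w₁ / 2) t)
    (∫ t in Set.Ioi (0 : ℝ), dsKernel w₁ w₂ (b - w₁ / 2) t), ← h, Complex.exp_add]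
  have h3 := exp_integral_cshKernel hw₂ (abs_lt.2 hbabs)
  rw [hb, sub_add_cancel, ← hb, ← mul_div_assoc] at h3
  linear_combination (Complex.exp (∫ t in Set.Ioi (0 : ℝ), dsKernel w₁ w₂ (b - w₁ / 2) t)) * h3

theorem doubleSineStrip_symm (w₁ w₂ : ℝ) (x : ℂ) :
    doubleSineStrip w₁ w₂ x = doubleSineStrip w₂ w₁ x := by
  unfold doubleSineStrip
  congr 2
  ext t
  ring_nf

theorem doubleSineStrip_ne_zero (w₁ w₂ : ℝ) (x : ℂ) : doubleSineStrip w₁ w₂ x ≠ 0 :=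
  Complex.exp_ne_zero _

/-- By symmetry there are functional equations for both periods. Comparing them at `s → 0⁺` gives
`S(s + w₁) sin(πs/w₂) = S(s + w₂) sin(πs/w₁)`, and division by `s` gives the relation in the limit.
-/
theorem mul_doubleSineStrip_periods {w₁ w₂ : ℝ} (hw₁ : 0 < w₁) (hw₂ : 0 < w₂) :
    w₁ * doubleSineStrip w₁ w₂ w₁ = w₂ * doubleSineStrip w₁ w₂ w₂ := by
  have hc : ∀ w : ℝ, 0 < w → w < w₁ + w₂ →
      Tendsto (fun s : ℝ => doubleSineStrip w₁ w₂ (s + w)) (𝓝[>] 0) (𝓝 (doubleSineStrip w₁ w₂ w)) := by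
    intro w h0 h1
    have h2 := (differentiableAt_doubleSineStrip hw₁ hw₂ (x := w) (by simpa) (by simpa)).continuousAt
    have h3 : Tendsto (fun s : ℝ => ((s : ℂ) + w)) (𝓝[>] 0) (𝓝 (w : ℂ)) := by
      have : Continuous fun s : ℝ => ((s : ℂ) + w) := by fun_prop
      simpa using (this.tendsto 0).mono_left nhdsWithin_le_nhds
    exact h2.tendsto.comp h3
  have hsin : ∀ w : ℝ, 0 < w →
      Tendsto (fun s : ℝ => Complex.sin (Real.pi * s / w) / s) (𝓝[>] 0) (𝓝 (Real.pi / w)) := by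
    intro w hw
    have h1 : HasDerivAt (fun s : ℝ => Complex.sin (Real.pi * s / w)) (Real.pi / w : ℂ) (0 : ℝ) := by
      have h2 : HasDerivAt (fun z : ℂ => Complex.sin (Real.pi * z / w)) (Real.pi / w : ℂ) ((0 : ℝ) : ℂ) := by
        have := (((hasDerivAt_id (0 : ℂ)).const_mul (Real.pi : ℂ)).div_const (w : ℂ)).csin
        simpa using this
      exact h2.comp_ofReal
    have h3 := h1.tendsto_slope
    refine (h3.mono_left (nhdsWithin_mono 0 fun s hs => ne_of_gt hs)).congr fun s => ?_
    simp only [slope, vsub_eq_sub, sub_zero, Complex.real_smul, Complex.ofReal_inv]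
    simp [div_eq_inv_mul]
  have l1 := (hc w₁ hw₁ (by linarith)).mul (hsin w₂ hw₂)
  have l2 := (hc w₂ hw₂ (by linarith)).mul (hsin w₁ hw₁)
  have hw₁c : (w₁ : ℂ) ≠ 0 := Complex.ofReal_ne_zero.2 hw₁.ne'
  have hw₂c : (w₂ : ℂ) ≠ 0 := Complex.ofReal_ne_zero.2 hw₂.ne'
  have hpi : (Real.pi : ℂ) ≠ 0 := Complex.ofReal_ne_zero.2 Real.pi_ne_zero
  have heq : (fun s : ℝ => doubleSineStrip w₁ w₂ (s + w₁) * (Complex.sin (Real.pi * s / w₂) / s))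
      =ᶠ[𝓝[>] 0] fun s : ℝ => doubleSineStrip w₁ w₂ (s + w₂) * (Complex.sin (Real.pi * s / w₁) / s) := by
    filter_upwards [Ioo_mem_nhdsGT (lt_min hw₁ hw₂)] with s hs
    have a1 := doubleSineStrip_add_mul_sin hw₁ hw₂ (x := s) (by simpa using hs.1)
      (by simpa using hs.2.trans_le (min_le_right _ _))
    have a2 := doubleSineStrip_add_mul_sin hw₂ hw₁ (x := s) (by simpa using hs.1)
      (by simpa using hs.2.trans_le (min_le_left _ _))
    rw [doubleSineStrip_symm w₂ w₁, doubleSineStrip_symm w₂ w₁, ← a1] at a2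
    rw [← mul_div_assoc, ← mul_div_assoc]
    congr 1
    linear_combination -a2 / 2
  have := tendsto_nhds_unique (l1.congr' heq) l2
  field_simp at this
  linear_combination this

/-! ### Growth of the double sine function in the imaginary direction. -/

theorem integrableOn_one_sub_cos_div_sq (y : ℝ) :
    IntegrableOn (fun t : ℝ => (1 - Real.cos (y * t)) / t ^ 2) (Set.Ioi 0) := by
  refine (integrableOn_mul_inv_one_add_sq (y ^ 2 / 2 + 2) (Set.Ioi 0)).mono' ?_ ?_
  · exact (Measurable.div (by fun_prop) (by fun_prop)).aestronglyMeasurable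
  · filter_upwards [ae_restrict_mem measurableSet_Ioi] with t ht
    have ht0 : (0 : ℝ) < t := ht
    have h1 := Real.one_sub_sq_div_two_le_cos (x := y * t)
    have h2 := Real.neg_one_le_cos (y * t)
    have h3 := Real.cos_le_one (y * t)
    rw [Real.norm_of_nonneg (div_nonneg (by linarith) (by positivity)),
      ← div_eq_mul_inv, div_le_div_iff₀ (by positivity) (by positivity)]
    nlinarith [sq_nonneg t]

theorem integral_one_sub_cos_div_sq_eq_abs_mul (y : ℝ) :
    ∫ t in Set.Ioi (0 : ℝ), (1 - Real.cos (y * t)) / t ^ 2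
      = |y| * ∫ t in Set.Ioi (0 : ℝ), (1 - Real.cos t) / t ^ 2 := by
  rcases eq_or_ne y 0 with rfl | hy
  · simp
  have h := integral_comp_mul_left_Ioi (fun t => (1 - Real.cos t) / t ^ 2) 0 (abs_pos.2 hy)
  rw [mul_zero, smul_eq_mul] at h
  have h2 : ∀ t : ℝ, (1 - Real.cos (y * t)) / t ^ 2
      = |y| ^ 2 * ((1 - Real.cos (|y| * t)) / (|y| * t) ^ 2) := by
    intro t
    have e : Real.cos (|y| * t) = Real.cos (y * t) := by
      rcases abs_choice y with h | h
      · rw [h]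
      · rw [h, neg_mul, Real.cos_neg]
    rw [e, mul_pow]
    have := abs_pos.2 hy
    field_simp
  simp_rw [h2]
  rw [integral_const_mul, h]
  have := abs_pos.2 hy
  field_simp

/-- Because `Re sinh((r + iy)t) = sinh(rt) cos(yt)`, the imaginary part enters only through a
bounded oscillating factor and an elementary integrand carrying all the growth. -/
theorem re_dsKernel (w₁ w₂ r y : ℝ) {t : ℝ} (ht : 0 < t) :
    (dsKernel w₁ w₂ (r + y * Complex.I) t).re
      = (dsKernel w₁ w₂ r t).re * Real.cos (y * t)
        - 2 * r / (w₁ * w₂) * ((1 - Real.cos (y * t)) / t ^ 2) := by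
  have key : ∀ z : ℂ, (dsKernel w₁ w₂ z t).re
      = ((Complex.sinh (z * t)).re / (2 * Real.sinh (w₁ * t / 2) * Real.sinh (w₂ * t / 2))
        - 2 * z.re / (w₁ * w₂ * t)) / t := by
    intro z
    unfold dsKernel
    have e1 : (2 * Complex.sinh (w₁ * t / 2) * Complex.sinh (w₂ * t / 2) : ℂ)
        = ((2 * Real.sinh (w₁ * t / 2) * Real.sinh (w₂ * t / 2) : ℝ) : ℂ) := by push_cast; ring
    have e2 : (w₁ * w₂ * t : ℂ) = ((w₁ * w₂ * t : ℝ) : ℂ) := by push_cast; ring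
    rw [e1, e2, Complex.div_ofReal_re, Complex.sub_re, Complex.div_ofReal_re, Complex.div_ofReal_re,
      show (2 * z).re = 2 * z.re by simp]
  have h1 : (Complex.sinh ((r + y * Complex.I) * t)).re = Real.sinh (r * t) * Real.cos (y * t) := by
    rw [show ((r + y * Complex.I) * t : ℂ) = ((r * t : ℝ) : ℂ) + ((y * t : ℝ) : ℂ) * Complex.I by
      push_cast; ring, Complex.sinh_add, Complex.sinh_mul_I, Complex.cosh_mul_I,
      ← Complex.ofReal_sinh, ← Complex.ofReal_cosh, ← Complex.ofReal_cos, ← Complex.ofReal_sin,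
      ← mul_assoc, ← Complex.ofReal_mul, ← Complex.ofReal_mul, Complex.add_re, Complex.ofReal_re,
      Complex.re_ofReal_mul, Complex.I_re, mul_zero, add_zero]
  have h2 : (Complex.sinh ((r : ℂ) * t)).re = Real.sinh (r * t) := by
    rw [← Complex.ofReal_mul, Complex.sinh_ofReal_re]
  rw [key, key, h1, h2]
  simp only [Complex.add_re, Complex.ofReal_re, Complex.mul_re, Complex.I_re, Complex.ofReal_im,
    Complex.I_im, mul_zero, mul_one, sub_zero, add_zero]
  field_simp
  ring

/-- In `re_dsKernel` the first term is bounded by the kernel at the real point `r`, uniformly in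
`y`. The second integrates to a multiple of `|y|` by scaling. The constant `∫ (1 - cos t)/t²` is
left unevaluated here. -/
theorem exists_abs_log_norm_doubleSineStrip_le {w₁ w₂ : ℝ} (hw₁ : 0 < w₁) (hw₂ : 0 < w₂) {s : ℝ}
    (hs : s < (w₁ + w₂) / 2) :
    ∃ K, ∀ x : ℂ, |x.re - (w₁ + w₂) / 2| ≤ s →
      |Real.log ‖doubleSineStrip w₁ w₂ x‖ + 2 * (x.re - (w₁ + w₂) / 2) / (w₁ * w₂)
        * (|x.im| * ∫ t in Set.Ioi (0 : ℝ), (1 - Real.cos t) / t ^ 2)| ≤ K := by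
  obtain ⟨K, hK0, hK⟩ := exists_norm_dsKernel_le hw₁ hw₂ ((w₁ + w₂) / 2) hs
  refine ⟨∫ t in Set.Ioi (0 : ℝ), K * (1 + t ^ 2)⁻¹, fun x hx => ?_⟩
  set r : ℝ := x.re - (w₁ + w₂) / 2 with hr
  set y : ℝ := x.im with hy
  have ha : x - (w₁ + w₂) / 2 = r + y * Complex.I := by
    conv_lhs => rw [← Complex.re_add_im x]
    rw [hr, hy]; push_cast; ring
  have hre : ((r : ℂ) + y * Complex.I).re = r := by simp
  have hrs : |r| < (w₁ + w₂) / 2 := lt_of_le_of_lt hx hs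
  have hint : IntegrableOn (dsKernel w₁ w₂ (r + y * Complex.I)) (Set.Ioi 0) :=
    integrableOn_dsKernel hw₁ hw₂ (by rwa [hre])
  have hint' : IntegrableOn (fun t => (dsKernel w₁ w₂ (r + y * Complex.I) t).re) (Set.Ioi 0) :=
    hint.re
  have hi2 : IntegrableOn (fun t : ℝ => 2 * r / (w₁ * w₂) * ((1 - Real.cos (y * t)) / t ^ 2))
      (Set.Ioi 0) := (integrableOn_one_sub_cos_div_sq y).const_mul _
  have hre2 : ∀ t ∈ Set.Ioi (0 : ℝ), (dsKernel w₁ w₂ r t).re * Real.cos (y * t)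
      = (dsKernel w₁ w₂ (r + y * Complex.I) t).re
        + 2 * r / (w₁ * w₂) * ((1 - Real.cos (y * t)) / t ^ 2) := by
    intro t ht
    rw [re_dsKernel _ _ _ _ ht]; ring
  have e1 : Real.log ‖doubleSineStrip w₁ w₂ x‖
      = ∫ t in Set.Ioi (0 : ℝ), (dsKernel w₁ w₂ (r + y * Complex.I) t).re := by
    rw [doubleSineStrip_eq, Complex.norm_exp, Real.log_exp, ha]
    exact (integral_re hint).symm
  have e2 : Real.log ‖doubleSineStrip w₁ w₂ x‖ + 2 * r / (w₁ * w₂)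
        * (|y| * ∫ t in Set.Ioi (0 : ℝ), (1 - Real.cos t) / t ^ 2)
      = ∫ t in Set.Ioi (0 : ℝ), (dsKernel w₁ w₂ r t).re * Real.cos (y * t) := by
    rw [setIntegral_congr_fun measurableSet_Ioi hre2, integral_add hint' hi2, integral_const_mul,
      integral_one_sub_cos_div_sq_eq_abs_mul, e1]
  rw [e2, ← Real.norm_eq_abs]
  refine norm_integral_le_of_norm_le (integrableOn_mul_inv_one_add_sq K (Set.Ioi 0)) ?_
  filter_upwards [ae_restrict_mem measurableSet_Ioi] with t ht
  have h1 := hK r (by rwa [Complex.ofReal_re]) (by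
    rw [Complex.norm_real, Real.norm_eq_abs]; exact hrs.le) t ht
  rw [norm_mul, Real.norm_eq_abs, Real.norm_eq_abs]
  calc |(dsKernel w₁ w₂ r t).re| * |Real.cos (y * t)| ≤ ‖dsKernel w₁ w₂ r t‖ * 1 := by
        gcongr
        · exact Complex.abs_re_le_norm _
        · exact Real.abs_cos_le_one _
    _ ≤ _ := by rwa [mul_one]

/-- The functional equation determines the value. For `w₁ = w₂ = 1` on `Re x = 1/2` the growth
estimate makes `log|S(x)| - log|S(x+1)|` equal to `2κy + O(1)`, while the functional equation makes
it `log(2 cosh πy) = πy + O(1)`. -/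
theorem integral_one_sub_cos_div_sq :
    ∫ t in Set.Ioi (0 : ℝ), (1 - Real.cos t) / t ^ 2 = Real.pi / 2 := by
  set κ := ∫ t in Set.Ioi (0 : ℝ), (1 - Real.cos t) / t ^ 2 with hκ
  obtain ⟨K, hK⟩ := exists_abs_log_norm_doubleSineStrip_le (w₁ := 1) (w₂ := 1) one_pos one_pos
    (s := 1 / 2) (by norm_num)
  have hbound : ∀ y : ℝ, 0 < y → |(2 * κ - Real.pi) * y| ≤ 2 * K + Real.log 2 := by
    intro y hy
    set x : ℂ := 1 / 2 + y * Complex.I with hx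
    have hre : x.re = 1 / 2 := by simp [hx]
    have him : x.im = y := by simp [hx]
    have h1 := hK x (by rw [hre]; norm_num)
    have h2 := hK (x + 1) (by rw [Complex.add_re, hre]; norm_num)
    have h3 := doubleSineStrip_add_mul_sin (w₁ := 1) (w₂ := 1) one_pos one_pos (x := x)
      (by rw [hre]; norm_num) (by rw [hre]; norm_num)
    have hsin : 2 * Complex.sin (Real.pi * x / (1 : ℝ)) = ((2 * Real.cosh (Real.pi * y) : ℝ) : ℂ) := by
      rw [hx, Complex.ofReal_one, div_one, show (Real.pi * (1 / 2 + y * Complex.I) : ℂ)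
        = (Real.pi * y : ℂ) * Complex.I + Real.pi / 2 by ring, Complex.sin_add_pi_div_two,
        Complex.cos_mul_I]
      push_cast
      rfl
    rw [hsin, Complex.ofReal_one] at h3
    have hc : 0 < Real.cosh (Real.pi * y) := Real.cosh_pos _
    have h4 : Real.log ‖doubleSineStrip 1 1 x‖ = Real.log ‖doubleSineStrip 1 1 (x + 1)‖
        + Real.log (2 * Real.cosh (Real.pi * y)) := by
      rw [← h3, norm_mul, Complex.norm_real, Real.norm_of_nonneg (by positivity),
        Real.log_mul (norm_ne_zero_iff.2 (doubleSineStrip_ne_zero _ _ _)) (by positivity)]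
    have h5 : Real.pi * y ≤ Real.log (2 * Real.cosh (Real.pi * y)) := by
      rw [Real.le_log_iff_exp_le (by positivity), Real.cosh_eq]
      linarith [Real.exp_pos (-(Real.pi * y))]
    have h6 : Real.log (2 * Real.cosh (Real.pi * y)) ≤ Real.log 2 + Real.pi * y := by
      rw [Real.log_le_iff_le_exp (by positivity), Real.exp_add, Real.exp_log two_pos, Real.cosh_eq]
      have : Real.exp (-(Real.pi * y)) ≤ Real.exp (Real.pi * y) :=
        Real.exp_le_exp.2 (by nlinarith [Real.pi_pos])
      linarith
    rw [Complex.add_re, Complex.add_im, hre, him, Complex.one_im, add_zero, abs_of_pos hy, abs_le] at h2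
    rw [hre, him, abs_of_pos hy, abs_le, h4] at h1
    norm_num at h1 h2
    rw [abs_le]
    have := Real.log_pos (x := 2) (by norm_num)
    constructor <;> nlinarith
  by_contra hne
  have hne' : 2 * κ - Real.pi ≠ 0 := fun h => hne (by linarith)
  have hpos := abs_pos.2 hne'
  have h0 := hbound 1 one_pos
  have hK0 : 0 ≤ 2 * K + Real.log 2 := (abs_nonneg _).trans h0
  -- For this `y` the left side of `hbound` exceeds its bound by `1`.
  have h := hbound ((2 * K + Real.log 2 + 1) / |2 * κ - Real.pi|) (by positivity)
  rw [abs_mul, abs_of_pos (a := _ / _) (by positivity), mul_div_cancel₀ _ hpos.ne'] at h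
  linarith

/-! ### The functions `q ^ x` and `⟨x⟩` -/

/-- Both points are moved to the same point of the basic strip, and the denominator only gains one
sine factor. The identity is therefore exact, with `1/0 = 0` at the poles. For `Re x ≤ 0` the sine
is a factor of the numerator instead, and the product form below is the one that survives its zeros.
-/
theorem doubleSine_add_of_re_pos {w₁ : ℝ} (hw₁ : 0 < w₁) (w₂ : ℝ) {x : ℂ} (hx : 0 < x.re) :
    doubleSine w₁ w₂ (x + w₁) = doubleSine w₁ w₂ x / (2 * Complex.sin (Real.pi * x / w₂)) := by
  have h1 : 1 ≤ ⌈x.re / w₁⌉ := Int.one_le_ceil_iff.2 (div_pos hx hw₁)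
  obtain ⟨k, hk⟩ : ∃ k : ℕ, ⌈x.re / w₁⌉ = k + 1 := ⟨(⌈x.re / w₁⌉ - 1).toNat, by omega⟩
  have h2 : ⌈(x + w₁).re / w₁⌉ = k + 1 + 1 := by
    rw [Complex.add_re, Complex.ofReal_re, add_div, div_self hw₁.ne', Int.ceil_add_one, hk]
  simp only [doubleSine]
  rw [hk, h2]
  rw [show (1 - ((k : ℤ) + 1 + 1)).toNat = 0 by omega, show (1 - ((k : ℤ) + 1)).toNat = 0 by omega,
    show (-(1 - ((k : ℤ) + 1 + 1))).toNat = k + 1 by omega,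
    show (-(1 - ((k : ℤ) + 1))).toNat = k by omega, Finset.prod_range_succ']
  push_cast
  rw [show x + w₁ + (1 - (k + 1 + 1)) * w₁ = x + (1 - (k + 1)) * w₁ by ring,
    show x + w₁ - (0 + 1) * w₁ = x by ring]
  simp_rw [show ∀ j : ℂ, x + w₁ - (j + 1 + 1) * w₁ = x - (j + 1) * w₁ from fun j => by ring]
  rw [div_div]
  simp only [Finset.range_zero, Finset.prod_empty]

theorem doubleSine_of_re_nonpos {w₁ : ℝ} (hw₁ : 0 < w₁) (w₂ : ℝ) {x : ℂ} (hx : x.re ≤ 0) :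
    doubleSine w₁ w₂ x = doubleSine w₁ w₂ (x + w₁) * (2 * Complex.sin (Real.pi * x / w₂)) := by
  have h1 : ⌈x.re / w₁⌉ ≤ 0 := Int.ceil_le.2 (by simpa using div_nonpos_of_nonpos_of_nonneg hx hw₁.le)
  obtain ⟨k, hk⟩ : ∃ k : ℕ, ⌈x.re / w₁⌉ = -k := ⟨(-⌈x.re / w₁⌉).toNat, by omega⟩
  have h2 : ⌈(x + w₁).re / w₁⌉ = -k + 1 := by
    rw [Complex.add_re, Complex.ofReal_re, add_div, div_self hw₁.ne', Int.ceil_add_one, hk]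
  simp only [doubleSine]
  rw [hk, h2]
  rw [show (1 - (-(k : ℤ))).toNat = k + 1 by omega, show (1 - (-(k : ℤ) + 1)).toNat = k by omega,
    show (-(1 - (-(k : ℤ)))).toNat = 0 by omega,
    show (-(1 - (-(k : ℤ) + 1))).toNat = 0 by omega, Finset.prod_range_succ']
  push_cast
  rw [show x + w₁ + (1 - (-k + 1)) * w₁ = x + (1 - -k) * w₁ by ring,
    show x + 0 * w₁ = x by ring]
  simp_rw [show ∀ j : ℂ, x + w₁ + j * w₁ = x + (j + 1) * w₁ from fun j => by ring]
  simp only [Finset.range_zero, Finset.prod_empty, div_one]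
  ring

theorem qpow_add (ω : ℝ) (s t : ℂ) : qpow ω (s + t) = qpow ω s * qpow ω t := by
  rw [qpow, qpow, qpow, ← Complex.exp_add]; ring_nf

theorem qpow_ne_zero (ω : ℝ) (s : ℂ) : qpow ω s ≠ 0 := Complex.exp_ne_zero _

@[simp] theorem qpow_zero (ω : ℝ) : qpow ω 0 = 1 := by simp [qpow]

theorem qpow_nat_mul (ω : ℝ) (s : ℂ) (k : ℕ) : qpow ω (k * s) = qpow ω s ^ k := by
  rw [qpow, qpow, ← Complex.exp_nat_mul]; ring_nf

theorem qpow_natCast (ω : ℝ) (k : ℕ) : qpow ω k = qpow ω 1 ^ k := by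
  rw [← qpow_nat_mul, mul_one]

theorem qpow_one_div {ω : ℝ} (hω : 0 < ω) : qpow ω (1 / ω) = 1 := by
  have : (ω : ℂ) ≠ 0 := Complex.ofReal_ne_zero.2 hω.ne'
  rw [qpow, mul_one_div, mul_div_cancel_right₀ _ this, Complex.exp_two_pi_mul_I]

theorem differentiable_qpow (ω : ℝ) : Differentiable ℂ (qpow ω) := by
  unfold qpow; fun_prop

theorem norm_qpow (ω : ℝ) (s : ℂ) : ‖qpow ω s‖ = Real.exp (-(2 * Real.pi * ω * s.im)) := by
  rw [qpow, Complex.norm_exp, show (2 * Real.pi * Complex.I * ω * s : ℂ)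
    = ((2 * Real.pi * ω : ℝ) : ℂ) * (Complex.I * s) by push_cast; ring, Complex.re_ofReal_mul,
    Complex.I_mul_re]
  ring_nf

theorem one_sub_qpow_eq_zero_iff {ω : ℝ} (hω : 0 < ω) {x : ℂ} :
    1 - qpow ω x = 0 ↔ ∃ p : ℤ, x = p / ω := by
  have hωc : (ω : ℂ) ≠ 0 := Complex.ofReal_ne_zero.2 hω.ne'
  have hpi : (2 * Real.pi * Complex.I : ℂ) ≠ 0 := Complex.two_pi_I_ne_zero
  rw [sub_eq_zero, eq_comm, qpow, Complex.exp_eq_one_iff]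
  refine exists_congr fun p => ?_
  rw [eq_div_iff hωc]
  constructor
  · intro h
    apply mul_left_cancel₀ hpi
    linear_combination h
  · intro h
    linear_combination (2 * Real.pi * Complex.I) * h

theorem one_sub_qpow_mul_exp (ω : ℝ) (x : ℂ) :
    (1 - qpow ω x) * (Complex.I * Complex.exp (-(Real.pi * ω * x * Complex.I)))
      = 2 * Complex.sin (Real.pi * x / (1 / ω : ℝ)) := by
  have h1 : (Real.pi * x / (1 / ω : ℝ) : ℂ) = Real.pi * ω * x := by
    push_cast; rw [div_div_eq_mul_div, div_one]; ring
  have h2 : qpow ω x = Complex.exp (Real.pi * ω * x * Complex.I) * Complex.exp (Real.pi * ω * x * Complex.I) := by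
    rw [qpow, ← Complex.exp_add]; ring_nf
  have h3 : Complex.exp (Real.pi * ω * x * Complex.I) * Complex.exp (-(Real.pi * ω * x * Complex.I)) = 1 := by
    rw [← Complex.exp_add, add_neg_cancel, Complex.exp_zero]
  rw [h1, h2, Complex.sin, neg_mul]
  linear_combination (-Complex.I * Complex.exp (Real.pi * ω * x * Complex.I)) * h3

/-- The extra factor is precisely the one by which `2 sin πωx` differs from `1 - q^x` in
`one_sub_qpow_mul_exp`. The quadratic exponent in `⟨·⟩` thus replaces the sine by `1 - q^x` in the
functional equation. -/
theorem exp_quadratic_add_one (ω : ℝ) (x : ℂ) :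
    Complex.exp (Real.pi * Complex.I / 2 * ((1 + ω) * (x + 1) - ω * (x + 1) ^ 2))
      = Complex.exp (Real.pi * Complex.I / 2 * ((1 + ω) * x - ω * x ^ 2))
        * (Complex.I * Complex.exp (-(Real.pi * ω * x * Complex.I))) := by
  rw [show Complex.I * Complex.exp (-(Real.pi * ω * x * Complex.I))
    = Complex.exp (Real.pi / 2 * Complex.I) * Complex.exp (-(Real.pi * ω * x * Complex.I)) by
    rw [Complex.exp_pi_div_two_mul_I], ← Complex.exp_add, ← Complex.exp_add]
  ring_nf

variable {ω : ℝ}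

theorem brk_add_one_of_re_pos {x : ℂ} (hx : 0 < x.re) :
    brk ω (x + 1) = brk ω x / (1 - qpow ω x) := by
  have h := doubleSine_add_of_re_pos one_pos (1 / ω) hx
  rw [Complex.ofReal_one, ← one_sub_qpow_mul_exp ω] at h
  have h2 : Complex.I * Complex.exp (-(Real.pi * ω * x * Complex.I)) ≠ 0 :=
    mul_ne_zero Complex.I_ne_zero (Complex.exp_ne_zero _)
  rw [brk, brk, h, exp_quadratic_add_one]
  rcases eq_or_ne (1 - qpow ω x) 0 with h3 | h3
  · simp [h3]
  · field_simp

theorem brk_of_re_nonpos {x : ℂ} (hx : x.re ≤ 0) :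
    brk ω x = brk ω (x + 1) * (1 - qpow ω x) := by
  have h := doubleSine_of_re_nonpos one_pos (1 / ω) hx
  rw [Complex.ofReal_one, ← one_sub_qpow_mul_exp ω] at h
  rw [brk, brk, h, exp_quadratic_add_one]
  ring

theorem one_sub_qpow_ne_zero_of_re_mem (hω : 0 < ω) {x : ℂ} (h0 : 0 < x.re) (h1 : x.re < 1 / ω) :
    1 - qpow ω x ≠ 0 := by
  rw [Ne, one_sub_qpow_eq_zero_iff hω]
  rintro ⟨p, rfl⟩
  rw [Complex.div_ofReal_re, Complex.intCast_re] at h0 h1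
  rw [div_lt_div_iff_of_pos_right hω] at h1
  have h2 := (div_pos_iff_of_pos_right hω).1 h0
  norm_cast at h1 h2
  omega

theorem brk_of_re_lt (hω : 0 < ω) {x : ℂ} (hx : x.re < 1 / ω) :
    brk ω x = brk ω (x + 1) * (1 - qpow ω x) := by
  rcases le_or_gt x.re 0 with h | h
  · exact brk_of_re_nonpos h
  · rw [brk_add_one_of_re_pos h, div_mul_cancel₀ _ (one_sub_qpow_ne_zero_of_re_mem hω h hx)]

/-- The definition evaluates the integral only for `0 < Re ≤ w₁`. On the rest of the strip the
functional equation of the integral shows, one step of `w₁` at a time, that both agree. -/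
theorem doubleSine_eq_doubleSineStrip {w₁ w₂ : ℝ} (hw₁ : 0 < w₁) (hw₂ : 0 < w₂) {x : ℂ}
    (h0 : 0 < x.re) (h1 : x.re < w₁ + w₂) : doubleSine w₁ w₂ x = doubleSineStrip w₁ w₂ x := by
  obtain ⟨N, hN⟩ := exists_nat_ge (x.re / w₁)
  rw [div_le_iff₀ hw₁] at hN
  induction N generalizing x with
  | zero => simp at hN; linarith
  | succ N ih =>
    rcases le_or_gt x.re w₁ with h | h
    · have : ⌈x.re / w₁⌉ = 1 := by
        rw [Int.ceil_eq_iff]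
        constructor
        · simpa using div_pos h0 hw₁
        · rw [div_le_iff₀ hw₁]; simpa using h
      simp [doubleSine, this]
    · push_cast at hN
      have e : x = (x - w₁) + w₁ := by ring
      have hre : (x - w₁).re = x.re - w₁ := by simp
      have h2 := doubleSineStrip_add_mul_sin hw₁ hw₂ (x := x - w₁) (by rw [hre]; linarith)
        (by rw [hre]; linarith)
      rw [e, doubleSine_add_of_re_pos hw₁ w₂ (by rw [hre]; linarith),
        ih (x := x - w₁) (by rw [hre]; linarith) (by rw [hre]; linarith) (by rw [hre]; linarith), ← h2,
        mul_div_cancel_right₀]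
      refine mul_ne_zero two_ne_zero ?_
      rw [mul_div_assoc]
      refine sin_pi_mul_ne_zero_of_re_mem ?_ ?_
      · rw [Complex.div_ofReal_re, hre]; apply div_pos _ hw₂; linarith
      · rw [Complex.div_ofReal_re, hre, div_lt_one hw₂]; linarith

theorem brk_eq_of_re_mem (hω : 0 < ω) {x : ℂ} (h0 : 0 < x.re) (h1 : x.re < 1 + 1 / ω) :
    brk ω x = Complex.exp (Real.pi * Complex.I / 2 * ((1 + ω) * x - ω * x ^ 2))
      * doubleSineStrip 1 (1 / ω) x := by
  rw [brk, doubleSine_eq_doubleSineStrip one_pos (by positivity) h0 h1]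

theorem brk_ne_zero_of_re_mem (hω : 0 < ω) {x : ℂ} (h0 : 0 < x.re) (h1 : x.re < 1 + 1 / ω) :
    brk ω x ≠ 0 := by
  rw [brk_eq_of_re_mem hω h0 h1]
  exact mul_ne_zero (Complex.exp_ne_zero _) (doubleSineStrip_ne_zero _ _ _)

theorem differentiableAt_brk_of_re_mem (hω : 0 < ω) {x : ℂ} (h0 : 0 < x.re)
    (h1 : x.re < 1 + 1 / ω) : DifferentiableAt ℂ (brk ω) x := by
  have h2 : brk ω =ᶠ[𝓝 x] fun x =>
      Complex.exp (Real.pi * Complex.I / 2 * ((1 + ω) * x - ω * x ^ 2))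
        * doubleSineStrip 1 (1 / ω) x := by
    filter_upwards [(isOpen_lt continuous_const Complex.continuous_re).mem_nhds h0,
      (isOpen_lt Complex.continuous_re continuous_const).mem_nhds h1] with z hz0 hz1
    exact brk_eq_of_re_mem hω hz0 hz1
  refine DifferentiableAt.congr_of_eventuallyEq ?_ h2
  exact DifferentiableAt.mul (by fun_prop)
    (differentiableAt_doubleSineStrip one_pos (by positivity) h0 h1)

/-- The exponent `(1 + ω)x - ωx²` takes the value `1` at both `x = 1` and `x = 1/ω`, so only the
ratio of the double sines remains. -/
theorem brk_one_div_eq (hω : 0 < ω) : brk ω (1 / ω) = ω * brk ω 1 := by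
  have hωc : (ω : ℂ) ≠ 0 := Complex.ofReal_ne_zero.2 hω.ne'
  have h1 : (0 : ℝ) < 1 / ω := by positivity
  have h := mul_doubleSineStrip_periods one_pos h1
  have hre : (1 / ω : ℂ).re = 1 / ω := by
    rw [← Complex.ofReal_one, ← Complex.ofReal_div, Complex.ofReal_re]
  rw [brk_eq_of_re_mem hω (x := 1) (by simp) (by simpa using hω),
    brk_eq_of_re_mem hω (x := 1 / ω) (by rw [hre]; exact h1) (by rw [hre]; linarith)]
  push_cast at h
  rw [show ((1 + ω) * (1 / ω) - ω * (1 / ω) ^ 2 : ℂ) = 1 by field_simp; ring,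
    show ((1 + ω) * 1 - ω * 1 ^ 2 : ℂ) = 1 by ring]
  rw [one_mul] at h
  rw [h]
  field_simp

/-! ### Holomorphy, zeros and poles of `⟨x⟩` on the whole plane. -/

/-- Downward induction for the half plane `Re x < 1 + 1 / ω`. -/
theorem shift_induction_left {P : ℂ → Prop}
    (hstrip : ∀ x : ℂ, 0 < x.re → x.re < 1 + 1 / ω → P x)
    (hstep : ∀ x : ℂ, x.re ≤ 0 → P (x + 1) → P x) {x : ℂ} (hx : x.re < 1 + 1 / ω) (hω : 0 < ω) :
    P x := by
  obtain ⟨N, hN⟩ := exists_nat_gt (-x.re)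
  induction N generalizing x with
  | zero => exact hstrip x (by simpa using hN) hx
  | succ N ih =>
    have := one_div_pos.2 hω
    rcases le_or_gt x.re 0 with h | h
    · refine hstep x h (ih ?_ ?_)
      · rw [Complex.add_re, Complex.one_re]; linarith
      · rw [Complex.add_re, Complex.one_re]; push_cast at hN; linarith
    · exact hstrip x h hx

theorem shift_induction {P : ℂ → Prop} (hω : 0 < ω)
    (hstrip : ∀ x : ℂ, 0 < x.re → x.re < 1 + 1 / ω → P x)
    (hleft : ∀ x : ℂ, x.re ≤ 0 → P (x + 1) → P x)
    (hright : ∀ x : ℂ, 1 / ω ≤ x.re → P x → P (x + 1)) (x : ℂ) : P x := by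
  have h1 := one_div_pos.2 hω
  obtain ⟨N, hN⟩ := exists_nat_gt (x.re - (1 + 1 / ω))
  induction N generalizing x with
  | zero => exact shift_induction_left hstrip hleft (by simpa using hN) hω
  | succ N ih =>
    rcases lt_or_ge x.re (1 + 1 / ω) with h | h
    · exact shift_induction_left hstrip hleft h hω
    · have := hright (x - 1) (by rw [Complex.sub_re, Complex.one_re]; linarith)
        (ih (x - 1) (by rw [Complex.sub_re, Complex.one_re]; push_cast at hN; linarith))
      rwa [sub_add_cancel] at this

theorem one_sub_qpow_ne_zero_of_notMem_latNonpos (hω : 0 < ω) {x : ℂ} (hx : x ∉ latNonpos ω)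
    (h : x.re ≤ 0) : 1 - qpow ω x ≠ 0 := by
  rw [Ne, one_sub_qpow_eq_zero_iff hω]
  rintro ⟨p, rfl⟩
  rw [Complex.div_ofReal_re, Complex.intCast_re] at h
  have hp : p ≤ 0 := by
    have := (div_nonpos_iff.1 h).resolve_left (fun h => by linarith [h.2])
    exact_mod_cast this.1
  obtain ⟨k, rfl⟩ : ∃ k : ℕ, p = -k := ⟨(-p).toNat, by omega⟩
  exact hx ⟨0, k, by push_cast; ring⟩

theorem one_sub_qpow_ne_zero_of_notMem_latPos (hω : 0 < ω) {x : ℂ} (hx : x + 1 ∉ latPos ω)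
    (h : 0 < x.re) : 1 - qpow ω x ≠ 0 := by
  rw [Ne, one_sub_qpow_eq_zero_iff hω]
  rintro ⟨p, rfl⟩
  rw [Complex.div_ofReal_re, Complex.intCast_re] at h
  have hp : 0 < p := by exact_mod_cast (div_pos_iff_of_pos_right hω).1 h
  obtain ⟨k, rfl⟩ : ∃ k : ℕ, p = k + 1 := ⟨(p - 1).toNat, by omega⟩
  exact hx ⟨0, k, by push_cast; ring⟩

theorem add_one_notMem_latNonpos {x : ℂ} (hx : x ∉ latNonpos ω) : x + 1 ∉ latNonpos ω := by
  rintro ⟨j, k, h⟩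
  exact hx ⟨j + 1, k, by push_cast; linear_combination h⟩

theorem notMem_latPos_of_add_one {x : ℂ} (hx : x + 1 ∉ latPos ω) : x ∉ latPos ω := by
  rintro ⟨j, k, h⟩
  exact hx ⟨j + 1, k, by push_cast; linear_combination h⟩

theorem notMem_latPos_of_re_lt (hω : 0 < ω) {x : ℂ} (hx : x.re < 1 + 1 / ω) : x ∉ latPos ω := by
  rintro ⟨j, k, rfl⟩
  have h1 : ((j + 1) + (k + 1) / ω : ℂ) = (((j + 1) + (k + 1) / ω : ℝ) : ℂ) := by push_cast; ring
  rw [h1, Complex.ofReal_re] at hx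
  have h2 : 1 / ω ≤ (k + 1) / ω := by gcongr; linarith [(Nat.cast_nonneg k : (0 : ℝ) ≤ k)]
  linarith [(Nat.cast_nonneg j : (0 : ℝ) ≤ j)]

theorem brk_eventuallyEq_left (hω : 0 < ω) {x : ℂ} (hx : x.re ≤ 0) :
    brk ω =ᶠ[𝓝 x] fun z => brk ω (z + 1) * (1 - qpow ω z) := by
  have h1 := one_div_pos.2 hω
  filter_upwards [(isOpen_lt Complex.continuous_re continuous_const).mem_nhds
    (show x.re < 1 / ω by linarith)] with z hz using brk_of_re_lt hω hz

theorem brk_eventuallyEq_right {x : ℂ} (hx : 0 < x.re) :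
    brk ω =ᶠ[𝓝 (x + 1)] fun z => brk ω (z - 1) / (1 - qpow ω (z - 1)) := by
  filter_upwards [(isOpen_lt continuous_const Complex.continuous_re).mem_nhds
    (show 1 < (x + 1).re by rw [Complex.add_re, Complex.one_re]; linarith)] with z hz
  have := brk_add_one_of_re_pos (ω := ω) (x := z - 1)
    (by rw [Complex.sub_re, Complex.one_re]; exact sub_pos.2 hz)
  rwa [sub_add_cancel] at this

theorem differentiableAt_brk (hω : 0 < ω) {x : ℂ} (hx : x ∉ latPos ω) :
    DifferentiableAt ℂ (brk ω) x := by
  have hq := differentiable_qpow ω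
  have h1 := one_div_pos.2 hω
  revert hx
  refine shift_induction (P := fun x => x ∉ latPos ω → DifferentiableAt ℂ (brk ω) x) hω
    (fun x h0 h1 _ => differentiableAt_brk_of_re_mem hω h0 h1) (fun x h ih _ => ?_)
    (fun x h ih hx => ?_) x
  · refine DifferentiableAt.congr_of_eventuallyEq ?_ (brk_eventuallyEq_left hω h)
    have h2 := ih (notMem_latPos_of_re_lt hω (by rw [Complex.add_re, Complex.one_re]; linarith))
    exact DifferentiableAt.mul (h2.comp (f := fun z => z + 1) x (by fun_prop)) (by fun_prop)
  · refine DifferentiableAt.congr_of_eventuallyEq ?_ (brk_eventuallyEq_right (h1.trans_le h))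
    have h2 := ih (notMem_latPos_of_add_one hx)
    refine DifferentiableAt.div ?_ (by fun_prop) ?_
    · rw [← add_sub_cancel_right x 1] at h2
      exact h2.comp (f := fun z => z - 1) (x + 1) (by fun_prop)
    · rw [add_sub_cancel_right]
      exact one_sub_qpow_ne_zero_of_notMem_latPos hω hx (h1.trans_le h)

theorem brk_ne_zero (hω : 0 < ω) {x : ℂ} (hx : x ∉ latPos ω) (hx' : x ∉ latNonpos ω) :
    brk ω x ≠ 0 := by
  have h1 := one_div_pos.2 hω
  revert hx hx'
  refine shift_induction (P := fun x => x ∉ latPos ω → x ∉ latNonpos ω → brk ω x ≠ 0) hω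
    (fun x h0 h1 _ _ => brk_ne_zero_of_re_mem hω h0 h1) (fun x h ih _ hx => ?_)
    (fun x h ih hx _ => ?_) x
  · rw [brk_of_re_nonpos h]
    exact mul_ne_zero (ih (notMem_latPos_of_re_lt hω (by rw [Complex.add_re, Complex.one_re]; linarith))
      (add_one_notMem_latNonpos hx)) (one_sub_qpow_ne_zero_of_notMem_latNonpos hω hx h)
  · rw [brk_add_one_of_re_pos (h1.trans_le h)]
    refine div_ne_zero (ih (notMem_latPos_of_add_one hx) ?_)
      (one_sub_qpow_ne_zero_of_notMem_latPos hω hx (h1.trans_le h))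
    rintro ⟨j, k, rfl⟩
    have e : (-(j + k / ω) : ℂ) = ((-(j + k / ω) : ℝ) : ℂ) := by push_cast; ring
    rw [e, Complex.ofReal_re] at h
    have : (0 : ℝ) ≤ j + k / ω := by positivity
    linarith

/-- Poles of `⟨·⟩` are harmless here: its value there is `0` by convention, and the inverse of `0`
is `0`, which is the true value of the holomorphic reciprocal. -/
theorem differentiableAt_inv_brk (hω : 0 < ω) {x : ℂ} (hx : x ∉ latNonpos ω) :
    DifferentiableAt ℂ (fun z => (brk ω z)⁻¹) x := by
  have hq := differentiable_qpow ω
  have h1 := one_div_pos.2 hω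
  revert hx
  refine shift_induction (P := fun x => x ∉ latNonpos ω → DifferentiableAt ℂ (fun z => (brk ω z)⁻¹) x) hω
    (fun x h0 h1 _ => (differentiableAt_brk_of_re_mem hω h0 h1).inv (brk_ne_zero_of_re_mem hω h0 h1))
    (fun x h ih hx => ?_) (fun x h ih _ => ?_) x
  · refine DifferentiableAt.congr_of_eventuallyEq ?_ (brk_eventuallyEq_left hω h).inv
    have h2 : DifferentiableAt ℂ (fun z => (brk ω (z + 1))⁻¹) x :=
      (ih (add_one_notMem_latNonpos hx)).comp (f := fun z => z + 1) x (by fun_prop)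
    have h3 : DifferentiableAt ℂ (fun z => (brk ω (z + 1))⁻¹ * (1 - qpow ω z)⁻¹) x :=
      h2.mul (DifferentiableAt.inv (by fun_prop) (one_sub_qpow_ne_zero_of_notMem_latNonpos hω hx h))
    refine h3.congr_of_eventuallyEq (Eventually.of_forall fun z => ?_)
    simp [mul_comm]
  · refine DifferentiableAt.congr_of_eventuallyEq ?_ (brk_eventuallyEq_right (h1.trans_le h)).inv
    have hx : x ∉ latNonpos ω := by
      rintro ⟨j, k, rfl⟩
      have e : (-(j + k / ω) : ℂ) = ((-(j + k / ω) : ℝ) : ℂ) := by push_cast; ring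
      rw [e, Complex.ofReal_re] at h
      have : (0 : ℝ) ≤ j + k / ω := by positivity
      linarith
    have h2 := ih hx
    rw [← add_sub_cancel_right x 1] at h2
    have h3 : DifferentiableAt ℂ (fun z => (brk ω (z - 1))⁻¹) (x + 1) :=
      h2.comp (f := fun z => z - 1) (x + 1) (by fun_prop)
    have h4 : DifferentiableAt ℂ (fun z => (brk ω (z - 1))⁻¹ * (1 - qpow ω (z - 1))) (x + 1) :=
      h3.mul (by fun_prop)
    refine h4.congr_of_eventuallyEq (Eventually.of_forall fun z => ?_)
    simp [div_eq_mul_inv, mul_comm]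

theorem meromorphicAt_brk (hω : 0 < ω) (x : ℂ) : MeromorphicAt (brk ω) x := by
  have hq : ∀ y, AnalyticAt ℂ (qpow ω) y := fun y => (differentiable_qpow ω).analyticAt y
  have h1 := one_div_pos.2 hω
  refine shift_induction (P := fun x => MeromorphicAt (brk ω) x) hω
    (fun x h0 h1 => ?_) (fun x h ih => ?_) (fun x h ih => ?_) x
  · refine (DifferentiableOn.analyticAt (s := {z : ℂ | 0 < z.re} ∩ {z : ℂ | z.re < 1 + 1 / ω})
      (fun z hz => (differentiableAt_brk_of_re_mem hω hz.1 hz.2).differentiableWithinAt)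
      (((isOpen_lt continuous_const Complex.continuous_re).inter
        (isOpen_lt Complex.continuous_re continuous_const)).mem_nhds ⟨h0, h1⟩)).meromorphicAt
  · refine MeromorphicAt.congr ?_ ((brk_eventuallyEq_left hω h).symm.filter_mono nhdsWithin_le_nhds)
    refine MeromorphicAt.mul (MeromorphicAt.comp_analyticAt (f := brk ω) (g := fun z => z + 1) ih
      (by fun_prop)) ?_
    exact (analyticAt_const.sub (hq x)).meromorphicAt
  · refine MeromorphicAt.congr ?_
      ((brk_eventuallyEq_right (h1.trans_le h)).symm.filter_mono nhdsWithin_le_nhds)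
    refine MeromorphicAt.div (MeromorphicAt.comp_analyticAt (f := brk ω) (g := fun z => z - 1)
      (by simpa using ih) (by fun_prop)) ?_
    exact (analyticAt_const.sub ((hq _).comp (g := qpow ω) (f := fun z => z - 1)
      (by fun_prop))).meromorphicAt

/-! ### The size of `⟨x⟩` far from the real axis -/

theorem im_eq_zero_of_mem_latPos {x : ℂ} (hx : x ∈ latPos ω) : x.im = 0 := by
  obtain ⟨j, k, rfl⟩ := hx
  have h1 : ((j + 1) + (k + 1) / ω : ℂ) = (((j + 1) + (k + 1) / ω : ℝ) : ℂ) := by push_cast; ring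
  rw [h1, Complex.ofReal_im]

theorem im_eq_zero_of_mem_latNonpos {x : ℂ} (hx : x ∈ latNonpos ω) : x.im = 0 := by
  obtain ⟨j, k, rfl⟩ := hx
  have h1 : (-(j + k / ω) : ℂ) = ((-(j + k / ω) : ℝ) : ℂ) := by push_cast; ring
  rw [h1, Complex.ofReal_im]

theorem brk_ne_zero_of_im_ne_zero (hω : 0 < ω) {x : ℂ} (hx : x.im ≠ 0) : brk ω x ≠ 0 :=
  brk_ne_zero hω (fun h => hx (im_eq_zero_of_mem_latPos h))
    (fun h => hx (im_eq_zero_of_mem_latNonpos h))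

/-- As `|q^x| = e^{-2πω Im x}`, the number `1 - q^x` is bounded above and away from `0` when `Im x ≥
1`. When `Im x ≤ -1` the factor `-q^x` is split off, and it supplies the term `2πω|Im x|`. -/
theorem exists_abs_log_norm_one_sub_qpow_le (hω : 0 < ω) :
    ∃ K, ∀ x : ℂ, 1 ≤ |x.im| →
      |Real.log ‖1 - qpow ω x‖ - Real.pi * ω * (|x.im| - x.im)| ≤ K := by
  have hpi := Real.pi_pos
  set ρ := Real.exp (-(2 * Real.pi * ω)) with hρ
  have hρ1 : ρ < 1 := by
    rw [hρ, Real.exp_lt_one_iff]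
    have : 0 < 2 * Real.pi * ω := by positivity
    linarith
  have key : ∀ x : ℂ, 1 ≤ x.im → |Real.log ‖1 - qpow ω x‖| ≤ max (Real.log 2) (-Real.log (1 - ρ)) := by
    intro x hx
    have h1 : ‖qpow ω x‖ ≤ ρ := by
      rw [norm_qpow, hρ]
      apply Real.exp_le_exp.2
      have : 0 < 2 * Real.pi * ω := by positivity
      nlinarith
    have h2 : 1 - ρ ≤ ‖1 - qpow ω x‖ := by
      have := norm_sub_norm_le (1 : ℂ) (qpow ω x)
      rw [norm_one] at this
      linarith
    have h3 : ‖1 - qpow ω x‖ ≤ 2 := by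
      have := norm_sub_le (1 : ℂ) (qpow ω x)
      rw [norm_one] at this
      linarith
    have h4 : 0 < 1 - ρ := by linarith
    rw [abs_le]
    constructor
    · rw [neg_le]
      exact le_max_of_le_right (neg_le_neg (Real.log_le_log h4 h2))
    · exact le_max_of_le_left (Real.log_le_log (h4.trans_le h2) h3)
  refine ⟨max (Real.log 2) (-Real.log (1 - ρ)), fun x hx => ?_⟩
  rcases le_abs.1 hx with h | h
  · rw [abs_of_pos (a := x.im) (by linarith), sub_self, mul_zero, sub_zero]
    exact key x h
  · have h2 : 1 - qpow ω x = -qpow ω x * (1 - qpow ω (-x)) := by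
      have : qpow ω x * qpow ω (-x) = 1 := by rw [← qpow_add, add_neg_cancel, qpow_zero]
      linear_combination -this
    have h3 := key (-x) (by rw [Complex.neg_im]; exact h)
    have h4 : 1 - qpow ω (-x) ≠ 0 := by
      rw [Ne, one_sub_qpow_eq_zero_iff hω]
      rintro ⟨p, hp⟩
      have := congrArg Complex.im hp
      rw [Complex.div_ofReal_im, Complex.intCast_im, zero_div, Complex.neg_im] at this
      linarith
    rw [h2, norm_mul, norm_neg, Real.log_mul (norm_ne_zero_iff.2 (qpow_ne_zero _ _))
      (norm_ne_zero_iff.2 h4), norm_qpow, Real.log_exp, abs_of_neg (a := x.im) (by linarith)]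
    convert h3 using 2
    ring

theorem log_norm_brk_of_re_mem (hω : 0 < ω) {x : ℂ} (h0 : 0 < x.re) (h1 : x.re < 1 + 1 / ω) :
    Real.log ‖brk ω x‖ = Real.pi * ω * (x.re - (1 + 1 / ω) / 2) * x.im
      + Real.log ‖doubleSineStrip 1 (1 / ω) x‖ := by
  rw [brk_eq_of_re_mem hω h0 h1, norm_mul, Real.log_mul (norm_ne_zero_iff.2 (Complex.exp_ne_zero _))
    (norm_ne_zero_iff.2 (doubleSineStrip_ne_zero _ _ _)), Complex.norm_exp, Real.log_exp]
  congr 1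
  have e : (Real.pi * Complex.I / 2 * ((1 + ω) * x - ω * x ^ 2) : ℂ)
      = ((Real.pi / 2 : ℝ) : ℂ) * (Complex.I * (((1 + ω : ℝ) : ℂ) * x - (ω : ℂ) * x ^ 2)) := by
    push_cast; ring
  rw [e, Complex.re_ofReal_mul, Complex.I_mul_re, Complex.sub_im, Complex.im_ofReal_mul,
    Complex.im_ofReal_mul, sq, Complex.mul_im]
  field_simp
  ring

/-- The quadratic exponential contributes a multiple of `Im x` and the double sine the opposite
multiple of `|Im x|`, so all growth cancels in the upper half plane. Outside the central strip each
shift by `1` changes the main term exactly as `log|1 - q^x|` does. -/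
theorem exists_abs_log_norm_brk_le (hω : 0 < ω) (M : ℝ) :
    ∃ K, ∀ x : ℂ, |x.re| ≤ M → 1 ≤ |x.im| →
      |Real.log ‖brk ω x‖ + Real.pi * ω * (x.re - (1 + 1 / ω) / 2) * (|x.im| - x.im)| ≤ K := by
  have hω' := one_div_pos.2 hω
  -- The window starts as the closed strip of width `1` about the axis of symmetry `Re x = (1 +
  -- 1/ω)/2`, and grows by `1` on each side.
  suffices H : ∀ N : ℕ, ∃ K, ∀ x : ℂ, 1 / ω / 2 - N ≤ x.re → x.re ≤ 1 + 1 / ω / 2 + N → 1 ≤ |x.im| →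
      |Real.log ‖brk ω x‖ + Real.pi * ω * (x.re - (1 + 1 / ω) / 2) * (|x.im| - x.im)| ≤ K by
    obtain ⟨N, hN⟩ := exists_nat_ge (M + 1 / ω / 2)
    obtain ⟨K, hK⟩ := H N
    refine ⟨K, fun x hx h1 => hK x ?_ ?_ h1⟩
    · have := (abs_le.1 hx).1; linarith
    · have := (abs_le.1 hx).2; linarith
  obtain ⟨K₁, hK₁⟩ := exists_abs_log_norm_one_sub_qpow_le hω
  have hqne : ∀ x : ℂ, 1 ≤ |x.im| → 1 - qpow ω x ≠ 0 := by
    intro x hx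
    rw [Ne, one_sub_qpow_eq_zero_iff hω]
    rintro ⟨p, rfl⟩
    rw [Complex.div_ofReal_im, Complex.intCast_im, zero_div, abs_zero] at hx
    linarith
  have hbne : ∀ x : ℂ, 1 ≤ |x.im| → brk ω x ≠ 0 := fun x hx =>
    brk_ne_zero_of_im_ne_zero hω (fun h => by rw [h, abs_zero] at hx; linarith)
  intro N
  induction N with
  | zero =>
    obtain ⟨K, hK⟩ := exists_abs_log_norm_doubleSineStrip_le (w₁ := 1) (w₂ := 1 / ω) one_pos hω'
      (s := 1 / 2) (by linarith)
    refine ⟨K, fun x h0 h1 _ => ?_⟩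
    rw [Nat.cast_zero, sub_zero] at h0
    rw [Nat.cast_zero, add_zero] at h1
    have h2 := hK x (by rw [abs_le]; constructor <;> linarith)
    rw [integral_one_sub_cos_div_sq] at h2
    rw [log_norm_brk_of_re_mem hω (by linarith) (by linarith)]
    convert h2 using 2
    field_simp
    ring
  | succ N ih =>
    obtain ⟨K, hK⟩ := ih
    refine ⟨K + K₁, fun x h0 h1 hx => ?_⟩
    push_cast at h0 h1
    rcases lt_or_ge x.re (1 / ω / 2) with h | h
    · have e1 : brk ω x = brk ω (x + 1) * (1 - qpow ω x) := brk_of_re_lt hω (by linarith)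
      have hx1 : 1 ≤ |(x + 1).im| := by rwa [Complex.add_im, Complex.one_im, add_zero]
      have h2 := hK (x + 1) (by rw [Complex.add_re, Complex.one_re]; linarith)
        (by rw [Complex.add_re, Complex.one_re]; linarith [(Nat.cast_nonneg N : (0 : ℝ) ≤ N)]) hx1
      have h3 := hK₁ x hx
      rw [e1, norm_mul, Real.log_mul (norm_ne_zero_iff.2 (hbne _ hx1)) (norm_ne_zero_iff.2 (hqne x hx))]
      rw [Complex.add_re, Complex.one_re, Complex.add_im, Complex.one_im, add_zero] at h2
      refine le_trans (le_of_eq ?_) ((abs_add_le _ _).trans (add_le_add h2 h3))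
      congr 1
      ring
    rcases le_or_gt x.re (1 + 1 / ω / 2) with h' | h'
    · have hK0 : 0 ≤ K₁ := (abs_nonneg _).trans (hK₁ x hx)
      have := hK x (by linarith [(Nat.cast_nonneg N : (0 : ℝ) ≤ N)])
        (by linarith [(Nat.cast_nonneg N : (0 : ℝ) ≤ N)]) hx
      linarith
    · have e1 := brk_add_one_of_re_pos (ω := ω) (x := x - 1)
        (by rw [Complex.sub_re, Complex.one_re]; linarith)
      rw [sub_add_cancel] at e1
      have hx1 : 1 ≤ |(x - 1).im| := by rwa [Complex.sub_im, Complex.one_im, sub_zero]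
      have h2 := hK (x - 1) (by rw [Complex.sub_re, Complex.one_re]; linarith [(Nat.cast_nonneg N : (0 : ℝ) ≤ N)])
        (by rw [Complex.sub_re, Complex.one_re]; linarith) hx1
      have h3 := hK₁ (x - 1) hx1
      rw [e1, norm_div, Real.log_div (norm_ne_zero_iff.2 (hbne _ hx1)) (norm_ne_zero_iff.2 (hqne _ hx1))]
      rw [Complex.sub_re, Complex.one_re, Complex.sub_im, Complex.one_im, sub_zero] at h2
      rw [Complex.sub_im, Complex.one_im, sub_zero] at h3
      refine le_trans (le_of_eq ?_) ((abs_sub _ _).trans (add_le_add h2 h3))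
      congr 1
      ring

/-- Replacing `Im (iy + a)` by `y` in the main term costs a bounded amount. The bound is uniform in
`a`, which is needed because `α` varies. -/
theorem exists_abs_log_norm_brk_add_mul_I_le (hω : 0 < ω) (M : ℝ) :
    ∃ K, ∀ a : ℂ, ‖a‖ ≤ M → ∀ y : ℝ, M + 1 ≤ |y| →
      |Real.log ‖brk ω (y * Complex.I + a)‖
        + Real.pi * ω * (a.re - (1 + 1 / ω) / 2) * (|y| - y)| ≤ K := by
  have hω' := one_div_pos.2 hω
  have hpi := Real.pi_pos
  obtain ⟨K, hK⟩ := exists_abs_log_norm_brk_le hω M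
  refine ⟨K + Real.pi * ω * (M + (1 + 1 / ω) / 2) * (2 * M), fun a ha y hy => ?_⟩
  have h1 := (Complex.abs_re_le_norm a).trans ha
  have h2 := (Complex.abs_im_le_norm a).trans ha
  have hre : (y * Complex.I + a).re = a.re := by simp
  have him : (y * Complex.I + a).im = y + a.im := by simp
  have h3 : |y| - |a.im| ≤ |y + a.im| := by
    have := abs_sub_abs_le_abs_sub y (-a.im)
    rwa [abs_neg, sub_neg_eq_add] at this
  have h4 := hK (y * Complex.I + a) (by rwa [hre]) (by rw [him]; linarith)
  rw [hre, him] at h4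
  have h5 : |(|y| - y) - (|y + a.im| - (y + a.im))| ≤ 2 * M := by
    have h6 : |(|y| - |y + a.im|)| ≤ |a.im| := by
      have := abs_abs_sub_abs_le y (y + a.im)
      rwa [sub_add_cancel_left, abs_neg] at this
    rw [show (|y| - y) - (|y + a.im| - (y + a.im)) = (|y| - |y + a.im|) + a.im by ring]
    exact (abs_add_le _ _).trans (by linarith)
  have h7 : |a.re - (1 + 1 / ω) / 2| ≤ M + (1 + 1 / ω) / 2 :=
    (abs_sub _ _).trans (by rw [abs_of_pos (a := (1 + 1 / ω) / 2) (by positivity)]; linarith)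
  have e : Real.log ‖brk ω (y * Complex.I + a)‖
        + Real.pi * ω * (a.re - (1 + 1 / ω) / 2) * (|y| - y)
      = (Real.log ‖brk ω (y * Complex.I + a)‖
        + Real.pi * ω * (a.re - (1 + 1 / ω) / 2) * (|y + a.im| - (y + a.im)))
        + Real.pi * ω * (a.re - (1 + 1 / ω) / 2) * ((|y| - y) - (|y + a.im| - (y + a.im))) := by ring
  rw [e]
  refine (abs_add_le _ _).trans (add_le_add h4 ?_)
  rw [abs_mul, abs_mul, abs_of_pos (by positivity : 0 < Real.pi * ω)]
  have hM : 0 ≤ M := (norm_nonneg _).trans ha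
  gcongr

/-! ### The integrand -/

/-- In the combination of the four brackets the constants `(1 + 1/ω)/2` cancel. For `y > 0` the
brackets stay bounded and `q^{xz}` decays with rate `Re x`. For `y < 0` the total rate is `1 + 1/ω +
Re(γ - α - β - x)`. The number `η` is a common lower bound for both rates, in units of `2πω`. -/
theorem exists_norm_integrand_le (hω : 0 < ω) (β γ x : ℂ) (M : ℝ) :
    ∃ K T : ℝ, 0 ≤ K ∧ 0 < T ∧ ∀ α : ℂ, ‖α‖ ≤ M → ∀ η : ℝ, η ≤ x.re →
      η ≤ 1 + 1 / ω + γ.re - α.re - β.re - x.re → ∀ y : ℝ, T ≤ |y| →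
        ‖integrand ω α β γ x (y * Complex.I)‖ ≤ K * Real.exp (-(2 * Real.pi * ω * η) * |y|) := by
  have hω' := one_div_pos.2 hω
  have hpi := Real.pi_pos
  set M' := max (max M ‖β‖) (max ‖γ‖ ‖(1 + 1 / ω : ℂ)‖) with hM'
  obtain ⟨K, hK⟩ := exists_abs_log_norm_brk_add_mul_I_le hω M'
  have hM0 : 0 ≤ M' := (norm_nonneg β).trans ((le_max_right _ _).trans (le_max_left _ _))
  refine ⟨Real.exp (4 * K), M' + 1, (Real.exp_pos _).le, by linarith,
    fun α hα η h1 h2 y hy => ?_⟩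
  have kα := hK α (hα.trans ((le_max_left _ _).trans (le_max_left _ _))) y hy
  have kβ := hK β ((le_max_right _ _).trans (le_max_left _ _)) y hy
  have kγ := hK γ ((le_max_left _ _).trans (le_max_right _ _)) y hy
  have k1 := hK (1 + 1 / ω) ((le_max_right _ _).trans (le_max_right _ _)) y hy
  have hre : (1 + 1 / ω : ℂ).re = 1 + 1 / ω := by
    rw [Complex.add_re, Complex.one_re, ← Complex.ofReal_one, ← Complex.ofReal_div, Complex.ofReal_re]
  rw [hre] at k1
  have hne : ∀ a : ℂ, ‖a‖ ≤ M' → ‖brk ω (y * Complex.I + a)‖ ≠ 0 := by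
    intro a ha
    refine norm_ne_zero_iff.2 (brk_ne_zero_of_im_ne_zero hω ?_)
    have him : (y * Complex.I + a).im = y + a.im := by simp
    rw [him]
    intro h0
    have h3 := (Complex.abs_im_le_norm a).trans ha
    rw [show y = -a.im by linarith, abs_neg] at hy
    linarith
  have nα := hne α (hα.trans ((le_max_left _ _).trans (le_max_left _ _)))
  have nβ := hne β ((le_max_right _ _).trans (le_max_left _ _))
  have nγ := hne γ ((le_max_left _ _).trans (le_max_right _ _))
  have n1 := hne (1 + 1 / ω) ((le_max_right _ _).trans (le_max_right _ _))
  have him : (x * (y * Complex.I)).im = x.re * y := by simp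
  have hpos : 0 < ‖integrand ω α β γ x (y * Complex.I)‖ := by
    rw [integrand, add_assoc _ (1 : ℂ), norm_div, norm_mul, norm_mul, norm_mul, norm_qpow]
    have := Real.exp_pos (-(2 * Real.pi * ω * (x * (y * Complex.I)).im))
    positivity
  rw [← Real.log_le_log_iff hpos (by positivity), Real.log_mul (Real.exp_ne_zero _) (Real.exp_ne_zero _),
    Real.log_exp, Real.log_exp, integrand, add_assoc _ (1 : ℂ), norm_div, norm_mul, norm_mul, norm_mul,
    norm_qpow, Real.log_div (by have := Real.exp_ne_zero (-(2 * Real.pi * ω * (x * (y * Complex.I)).im)); positivity)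
      (by positivity), Real.log_mul (Real.exp_ne_zero _) (by positivity), Real.log_mul n1 nγ,
    Real.log_mul nα nβ, Real.log_exp, him]
  rw [abs_le] at kα kβ kγ k1
  have main : -(2 * Real.pi * ω * (x.re * y)) - Real.pi * ω *
      (1 + 1 / ω + γ.re - α.re - β.re) * (|y| - y) ≤ -(2 * Real.pi * ω * η) * |y| := by
    have hpo : 0 < Real.pi * ω := by positivity
    rcases abs_cases y with ⟨h3, h4⟩ | ⟨h3, h4⟩
    · rw [h3]
      have : 0 ≤ Real.pi * ω * ((x.re - η) * y) := by
        have := sub_nonneg.2 h1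
        positivity
      nlinarith
    · rw [h3]
      have : 0 ≤ Real.pi * ω * ((1 + 1 / ω + γ.re - α.re - β.re - x.re - η) * (-y)) := by
        have := sub_nonneg.2 h2
        have h5 : 0 ≤ -y := by linarith
        positivity
      nlinarith
  nlinarith [kα.1, kβ.1, kγ.2, k1.2, main]

theorem integrand_eq_mul_inv (ω : ℝ) (α β γ x z : ℂ) :
    integrand ω α β γ x z = qpow ω (x * z) * (brk ω (z + 1 + 1 / ω) * brk ω (z + γ))
      * ((brk ω (z + α))⁻¹ * (brk ω (z + β))⁻¹) := by
  rw [integrand, div_eq_mul_inv, mul_inv]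

theorem neg_mem_latNonpos_iff {z : ℂ} : -z ∈ latNonpos ω ↔ z + 1 + 1 / ω ∈ latPos ω := by
  refine exists_congr fun j => exists_congr fun k => ?_
  constructor
  · intro h
    linear_combination -h
  · intro h
    linear_combination -h

theorem continuousAt_integrand (hω : 0 < ω) {α β γ z : ℂ} (x : ℂ) (h1 : z ∉ leftPoles ω α β)
    (h2 : z ∉ rightPoles ω γ) :
    ContinuousAt (fun p : ℂ × ℂ => integrand ω p.1 β γ x p.2) (α, z) := by
  simp only [leftPoles, rightPoles, Set.mem_ofPred_eq, not_or] at h1 h2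
  have hq := (differentiable_qpow ω).continuous
  have c1 := (differentiableAt_brk hω (fun h => h2.1 (neg_mem_latNonpos_iff.2 h))).continuousAt
  have c2 := (differentiableAt_brk hω h2.2).continuousAt
  have c3 := (differentiableAt_inv_brk hω h1.1).continuousAt
  have c4 := (differentiableAt_inv_brk hω h1.2).continuousAt
  simp_rw [integrand_eq_mul_inv]
  refine ContinuousAt.mul (ContinuousAt.mul (by fun_prop) (ContinuousAt.mul ?_ ?_))
    (ContinuousAt.mul ?_ ?_)
  · exact ContinuousAt.comp (g := brk ω) (f := fun p : ℂ × ℂ => p.2 + 1 + 1 / ω) c1 (by fun_prop)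
  · exact ContinuousAt.comp (g := brk ω) (f := fun p : ℂ × ℂ => p.2 + γ) c2 (by fun_prop)
  · exact ContinuousAt.comp (g := fun z => (brk ω z)⁻¹) (f := fun p : ℂ × ℂ => p.2 + p.1) c3 (by fun_prop)
  · exact ContinuousAt.comp (g := fun z => (brk ω z)⁻¹) (f := fun p : ℂ × ℂ => p.2 + β) c4 (by fun_prop)

theorem differentiableAt_integrand (hω : 0 < ω) {α β γ z : ℂ} (x : ℂ) (h1 : z ∉ leftPoles ω α β)
    (h2 : z ∉ rightPoles ω γ) : DifferentiableAt ℂ (integrand ω α β γ x) z := by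
  simp only [leftPoles, rightPoles, Set.mem_ofPred_eq, not_or] at h1 h2
  have hq := differentiable_qpow ω
  have c1 := differentiableAt_brk hω (fun h => h2.1 (neg_mem_latNonpos_iff.2 h))
  have c2 := differentiableAt_brk hω h2.2
  have c3 := differentiableAt_inv_brk hω h1.1
  have c4 := differentiableAt_inv_brk hω h1.2
  have e : integrand ω α β γ x = fun z => qpow ω (x * z) * (brk ω (z + 1 + 1 / ω) * brk ω (z + γ))
      * ((brk ω (z + α))⁻¹ * (brk ω (z + β))⁻¹) := funext (integrand_eq_mul_inv ω α β γ x)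
  rw [e]
  refine DifferentiableAt.mul (DifferentiableAt.mul (by fun_prop) (DifferentiableAt.mul ?_ ?_))
    (DifferentiableAt.mul ?_ ?_)
  · exact DifferentiableAt.comp (g := brk ω) (f := fun z : ℂ => z + 1 + 1 / ω) z c1 (by fun_prop)
  · exact DifferentiableAt.comp (g := brk ω) (f := fun z => z + γ) z c2 (by fun_prop)
  · exact DifferentiableAt.comp (g := fun z => (brk ω z)⁻¹) (f := fun z => z + α) z c3 (by fun_prop)
  · exact DifferentiableAt.comp (g := fun z => (brk ω z)⁻¹) (f := fun z => z + β) z c4 (by fun_prop)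

theorem meromorphicAt_integrand (hω : 0 < ω) (α β γ x z : ℂ) :
    MeromorphicAt (integrand ω α β γ x) z := by
  have h : ∀ a, MeromorphicAt (fun z => brk ω (z + a)) z := fun a =>
    MeromorphicAt.comp_analyticAt (f := brk ω) (g := fun z => z + a) (meromorphicAt_brk hω _)
      (by fun_prop)
  have h1 : MeromorphicAt (fun z => brk ω (z + 1 + 1 / ω)) z := by
    simp_rw [add_assoc]; exact h _
  have hq : MeromorphicAt (fun z => qpow ω (x * z)) z := by
    have : Differentiable ℂ fun z => qpow ω (x * z) :=
      (differentiable_qpow ω).comp (by fun_prop : Differentiable ℂ fun z => x * z)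
    exact (this.analyticAt z).meromorphicAt
  exact (hq.mul (h1.mul (h γ))).div ((h α).mul (h β))

/-! ### Integrals along polygonal paths -/

/-- The integral of `f` along the segment from `v` to `w`. -/
noncomputable def segIntegral (f : ℂ → ℂ) (v w : ℂ) : ℂ :=
  (∫ t in (0 : ℝ)..1, f (v + t * (w - v))) * (w - v)

theorem polyIntegral_cons_cons (f : ℂ → ℂ) (v w : ℂ) (l : List ℂ) :
    polyIntegral f (v :: w :: l) = segIntegral f v w + polyIntegral f (w :: l) := rfl

theorem polyIntegral_singleton (f : ℂ → ℂ) (v : ℂ) : polyIntegral f [v] = 0 := rfl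

theorem polySupport_cons_cons (v w : ℂ) (l : List ℂ) :
    polySupport (v :: w :: l) = segment ℝ v w ∪ polySupport (w :: l) := rfl

theorem polySupport_singleton (v : ℂ) : polySupport [v] = ∅ := rfl

theorem polyIntegral_append (f : ℂ → ℂ) (l₁ : List ℂ) (v : ℂ) (l₂ : List ℂ) :
    polyIntegral f (l₁ ++ v :: l₂) = polyIntegral f (l₁ ++ [v]) + polyIntegral f (v :: l₂) := by
  induction l₁ with
  | nil => simp [polyIntegral_singleton]
  | cons a l ih =>
    cases l with
    | nil => simp [polyIntegral_cons_cons, polyIntegral_singleton]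
    | cons b l =>
      simp only [List.cons_append, polyIntegral_cons_cons] at ih ⊢
      rw [ih, add_assoc]

theorem polySupport_append (l₁ : List ℂ) (v : ℂ) (l₂ : List ℂ) :
    polySupport (l₁ ++ v :: l₂) = polySupport (l₁ ++ [v]) ∪ polySupport (v :: l₂) := by
  induction l₁ with
  | nil => simp [polySupport_singleton]
  | cons a l ih =>
    cases l with
    | nil => simp [polySupport_cons_cons, polySupport_singleton]
    | cons b l =>
      simp only [List.cons_append, polySupport_cons_cons] at ih ⊢
      rw [ih, Set.union_assoc]

theorem isCompact_polySupport (l : List ℂ) : IsCompact (polySupport l) := by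
  induction l with
  | nil => exact isCompact_empty
  | cons a l ih =>
    cases l with
    | nil => exact isCompact_empty
    | cons b l =>
      refine IsCompact.union ?_ ih
      rw [segment_eq_image_lineMap]
      exact isCompact_Icc.image AffineMap.lineMap_continuous

theorem add_mul_sub_mem_segment (v w : ℂ) {t : ℝ} (ht : t ∈ Set.Icc (0 : ℝ) 1) :
    v + t * (w - v) ∈ segment ℝ v w := by
  rw [segment_eq_image']
  exact ⟨t, ht, by simp⟩

theorem continuousOn_comp_segment {f : ℂ → ℂ} {v w : ℂ} (hf : ContinuousOn f (segment ℝ v w)) :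
    ContinuousOn (fun t : ℝ => f (v + t * (w - v))) (Set.uIcc 0 1) := by
  rw [Set.uIcc_of_le zero_le_one]
  exact hf.comp (by fun_prop) fun t ht => add_mul_sub_mem_segment v w ht

theorem segIntegral_eq_sub {g G : ℂ → ℂ} {v w : ℂ} (hg : ContinuousOn g (segment ℝ v w))
    (hG : ∀ z ∈ segment ℝ v w, HasDerivAt G (g z) z) : segIntegral g v w = G w - G v := by
  have h1 : ∀ t ∈ Set.uIcc (0 : ℝ) 1,
      HasDerivAt (fun t : ℝ => G (v + t * (w - v))) (g (v + t * (w - v)) * (w - v)) t := by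
    intro t ht
    rw [Set.uIcc_of_le zero_le_one] at ht
    have h2 : HasDerivAt (fun t : ℝ => v + (t : ℂ) * (w - v)) (w - v) t := by
      have := ((Complex.ofRealCLM.hasDerivAt (x := t)).mul_const (w - v)).const_add v
      simpa using this
    exact (hG _ (add_mul_sub_mem_segment v w ht)).comp t h2
  have h3 := intervalIntegral.integral_eq_sub_of_hasDerivAt h1
    (((continuousOn_comp_segment hg).mul continuousOn_const).intervalIntegrable)
  rw [intervalIntegral.integral_mul_const] at h3
  rw [segIntegral, h3]
  simp

theorem polyIntegral_eq_sub {g G : ℂ → ℂ} (v : ℂ) (l : List ℂ) (w : ℂ)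
    (hg : ContinuousOn g (polySupport (v :: (l ++ [w]))))
    (hG : ∀ z ∈ polySupport (v :: (l ++ [w])), HasDerivAt G (g z) z) :
    polyIntegral g (v :: (l ++ [w])) = G w - G v := by
  induction l generalizing v with
  | nil =>
    rw [List.nil_append, polySupport_cons_cons, polySupport_singleton, Set.union_empty] at hg hG
    rw [List.nil_append, polyIntegral_cons_cons, polyIntegral_singleton, add_zero]
    exact segIntegral_eq_sub hg hG
  | cons a l ih =>
    rw [List.cons_append, polySupport_cons_cons] at hg hG
    rw [List.cons_append, polyIntegral_cons_cons, ih a (hg.mono Set.subset_union_right)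
      (fun z hz => hG z (Or.inr hz)), segIntegral_eq_sub (hg.mono Set.subset_union_left)
      (fun z hz => hG z (Or.inl hz))]
    ring

theorem polyIntegral_add {f g : ℂ → ℂ} (l : List ℂ) (hf : ContinuousOn f (polySupport l))
    (hg : ContinuousOn g (polySupport l)) :
    polyIntegral (fun z => f z + g z) l = polyIntegral f l + polyIntegral g l := by
  induction l with
  | nil => simp [polyIntegral]
  | cons a l ih =>
    cases l with
    | nil => simp [polyIntegral]
    | cons b l =>
      rw [polySupport_cons_cons] at hf hg
      rw [polyIntegral_cons_cons, polyIntegral_cons_cons, polyIntegral_cons_cons,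
        ih (hf.mono Set.subset_union_right) (hg.mono Set.subset_union_right)]
      have : segIntegral (fun z => f z + g z) a b = segIntegral f a b + segIntegral g a b := by
        unfold segIntegral
        rw [intervalIntegral.integral_add
          (continuousOn_comp_segment (hf.mono Set.subset_union_left)).intervalIntegrable
          (continuousOn_comp_segment (hg.mono Set.subset_union_left)).intervalIntegrable]
        ring
      rw [this]
      ring

theorem polyIntegral_const_mul (c : ℂ) (f : ℂ → ℂ) (l : List ℂ) :
    polyIntegral (fun z => c * f z) l = c * polyIntegral f l := by
  induction l with
  | nil => simp [polyIntegral]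
  | cons a l ih =>
    cases l with
    | nil => simp [polyIntegral]
    | cons b l =>
      rw [polyIntegral_cons_cons, polyIntegral_cons_cons, ih]
      unfold segIntegral
      rw [intervalIntegral.integral_const_mul]
      ring

theorem polyIntegral_congr {f g : ℂ → ℂ} (l : List ℂ) (h : Set.EqOn f g (polySupport l)) :
    polyIntegral f l = polyIntegral g l := by
  induction l with
  | nil => rfl
  | cons a l ih =>
    cases l with
    | nil => rfl
    | cons b l =>
      rw [polySupport_cons_cons] at h
      rw [polyIntegral_cons_cons, polyIntegral_cons_cons, ih (h.mono Set.subset_union_right)]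
      congr 1
      unfold segIntegral
      congr 1
      refine intervalIntegral.integral_congr fun t ht => ?_
      rw [Set.uIcc_of_le zero_le_one] at ht
      exact h (Or.inl (add_mul_sub_mem_segment a b ht))

/-- The constant is the length of the path; it must not depend on `f`, since the bound is applied to
a family of integrands. -/
theorem exists_norm_polyIntegral_le (l : List ℂ) : ∃ A, 0 ≤ A ∧ ∀ (f : ℂ → ℂ) (M : ℝ), 0 ≤ M →
    (∀ z ∈ polySupport l, ‖f z‖ ≤ M) → ‖polyIntegral f l‖ ≤ A * M := by
  induction l with
  | nil => exact ⟨0, le_rfl, fun f M _ _ => by simp [polyIntegral]⟩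
  | cons a l ih =>
    cases l with
    | nil => exact ⟨0, le_rfl, fun f M _ _ => by simp [polyIntegral]⟩
    | cons b l =>
      obtain ⟨A, hA0, hA⟩ := ih
      refine ⟨‖b - a‖ + A, by positivity, fun f M hM h => ?_⟩
      rw [polySupport_cons_cons] at h
      rw [polyIntegral_cons_cons, add_mul]
      refine (norm_add_le _ _).trans (add_le_add ?_ (hA f M hM fun z hz => h z (Or.inr hz)))
      rw [segIntegral, norm_mul, mul_comm]
      gcongr
      have := intervalIntegral.norm_integral_le_of_norm_le_const (a := (0 : ℝ)) (b := 1) (C := M)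
        (f := fun t : ℝ => f (a + t * (b - a))) (fun t ht => by
          rw [Set.uIoc_of_le zero_le_one] at ht
          exact h _ (Or.inl (add_mul_sub_mem_segment a b ⟨ht.1.le, ht.2⟩)))
      simpa using this

theorem segIntegral_symm (f : ℂ → ℂ) (v w : ℂ) : segIntegral f w v = -segIntegral f v w := by
  unfold segIntegral
  have h := intervalIntegral.integral_comp_sub_left (a := 0) (b := 1)
    (fun t : ℝ => f (v + t * (w - v))) 1
  simp only [sub_self, sub_zero] at h
  rw [← h]
  have : ∀ t : ℝ, v + ((1 - t : ℝ) : ℂ) * (w - v) = w + t * (v - w) := by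
    intro t; push_cast; ring
  simp_rw [this]
  ring

theorem segIntegral_mul_I (f : ℂ → ℂ) (a b : ℝ) :
    segIntegral f (a * Complex.I) (b * Complex.I) = (∫ y in a..b, f (y * Complex.I)) * Complex.I := by
  unfold segIntegral
  have h := intervalIntegral.smul_integral_comp_mul_add (a := 0) (b := 1)
    (fun y : ℝ => f (y * Complex.I)) (b - a) a
  rw [mul_zero, zero_add, mul_one, sub_add_cancel] at h
  rw [← h, Complex.real_smul]
  have : ∀ t : ℝ, (a * Complex.I + t * (b * Complex.I - a * Complex.I) : ℂ)
      = (((b - a) * t + a : ℝ) : ℂ) * Complex.I := by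
    intro t; push_cast; ring
  simp_rw [this]
  push_cast
  ring

theorem mem_segment_mul_I {a b : ℝ} {z : ℂ} (h : z ∈ segment ℝ (a * Complex.I) (b * Complex.I)) :
    ∃ y ∈ Set.uIcc a b, z = y * Complex.I := by
  rw [← segment_eq_uIcc]
  obtain ⟨s, t, hs, ht, hst, rfl⟩ := h
  exact ⟨s • a + t • b, ⟨s, t, hs, ht, hst, rfl⟩, by
    simp only [Complex.real_smul, smul_eq_mul]; push_cast; ring⟩

/-! ### Contours as limits of finite polygonal paths. -/

namespace Contour

/-- The part of the contour between `-iT` and `iT`. -/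
noncomputable def path (C : Contour) (T : ℝ) : List ℂ :=
  (-(T * Complex.I)) :: (C.vertices ++ [T * Complex.I])

theorem polyIntegral_path (C : Contour) (f : ℂ → ℂ) (T : ℝ) :
    polyIntegral f (C.path T) = (∫ y in (-T)..(-C.R), f (y * Complex.I)) * Complex.I
      + polyIntegral f C.vertices + (∫ y in C.R..T, f (y * Complex.I)) * Complex.I := by
  rw [← segIntegral_mul_I, ← segIntegral_mul_I, path, vertices]
  have : (-(C.R * Complex.I) :: (C.mid ++ [C.R * Complex.I])) ++ [T * Complex.I]
      = (-(C.R * Complex.I) :: C.mid) ++ (C.R * Complex.I) :: [T * Complex.I] := by simp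
  rw [this, List.cons_append, polyIntegral_cons_cons, ← List.cons_append, polyIntegral_append,
    polyIntegral_cons_cons, polyIntegral_singleton]
  push_cast
  simp only [neg_mul, List.cons_append, add_zero]
  ring

theorem axis_mem_support (C : Contour) {y : ℝ} (hy : C.R ≤ |y|) : y * Complex.I ∈ C.support :=
  Or.inl ⟨y, hy, rfl⟩

theorem polySupport_path_subset (C : Contour) {T : ℝ} (hT : C.R ≤ T) :
    polySupport (C.path T) ⊆ C.support := by
  have hR := C.R_pos
  rw [path, vertices]
  have : (-(C.R * Complex.I) :: (C.mid ++ [C.R * Complex.I])) ++ [T * Complex.I]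
      = (-(C.R * Complex.I) :: C.mid) ++ (C.R * Complex.I) :: [T * Complex.I] := by simp
  rw [this, List.cons_append, polySupport_cons_cons, ← List.cons_append, polySupport_append,
    polySupport_cons_cons, polySupport_singleton, Set.union_empty]
  rintro z (h | h | h)
  · have h' : z ∈ segment ℝ (((-T : ℝ) : ℂ) * Complex.I) (((-C.R : ℝ) : ℂ) * Complex.I) := by
      push_cast; simpa using h
    obtain ⟨y, hy, rfl⟩ := mem_segment_mul_I h'
    rw [Set.uIcc_of_le (by linarith)] at hy
    exact C.axis_mem_support (by rw [abs_of_nonpos (by linarith [hy.2])]; linarith [hy.2])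
  · exact Or.inr h
  · obtain ⟨y, hy, rfl⟩ := mem_segment_mul_I h
    rw [Set.uIcc_of_le hT] at hy
    exact C.axis_mem_support (by rw [abs_of_nonneg (by linarith [hy.1])]; linarith [hy.1])

theorem intervalIntegrable_axis {C : Contour} {f : ℂ → ℂ} (hf : ContinuousOn f C.support) {a b : ℝ}
    (h : ∀ y ∈ Set.uIcc a b, C.R ≤ |y|) :
    IntervalIntegrable (fun y : ℝ => f (y * Complex.I)) volume a b :=
  (hf.comp (by fun_prop) fun y hy => C.axis_mem_support (h y hy)).intervalIntegrable

theorem polyIntegral_path_extend {C : Contour} {f : ℂ → ℂ} (hf : ContinuousOn f C.support) {T T' : ℝ}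
    (hT : C.R ≤ T) (hT' : T ≤ T') :
    polyIntegral f (C.path T') = (∫ y in (-T')..(-T), f (y * Complex.I)) * Complex.I
      + polyIntegral f (C.path T) + (∫ y in T..T', f (y * Complex.I)) * Complex.I := by
  have hR := C.R_pos
  have hneg : ∀ a b : ℝ, a ≤ b → b ≤ -C.R → ∀ y ∈ Set.uIcc a b, C.R ≤ |y| := by
    intro a b hab hb y hy
    rw [Set.uIcc_of_le hab] at hy
    rw [abs_of_nonpos (by linarith [hy.2])]; linarith [hy.2]
  have hpos : ∀ a b : ℝ, a ≤ b → C.R ≤ a → ∀ y ∈ Set.uIcc a b, C.R ≤ |y| := by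
    intro a b hab hb y hy
    rw [Set.uIcc_of_le hab] at hy
    rw [abs_of_nonneg (by linarith [hy.1])]; linarith [hy.1]
  rw [polyIntegral_path, polyIntegral_path,
    ← intervalIntegral.integral_add_adjacent_intervals
      (intervalIntegrable_axis hf (hneg (-T') (-T) (by linarith) (by linarith)))
      (intervalIntegrable_axis hf (hneg (-T) (-C.R) (by linarith) (by linarith))),
    ← intervalIntegral.integral_add_adjacent_intervals
      (intervalIntegrable_axis hf (hpos C.R T hT le_rfl))
      (intervalIntegrable_axis hf (hpos T T' hT' hT))]
  ring

theorem polyIntegral_path_sub_eq {C₁ C₂ : Contour} {f : ℂ → ℂ} (h₁ : ContinuousOn f C₁.support)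
    (h₂ : ContinuousOn f C₂.support) {T T' : ℝ} (hT₁ : C₁.R ≤ T) (hT₂ : C₂.R ≤ T) (hT' : T ≤ T') :
    polyIntegral f (C₁.path T') - polyIntegral f (C₂.path T')
      = polyIntegral f (C₁.path T) - polyIntegral f (C₂.path T) := by
  rw [polyIntegral_path_extend h₁ hT₁ hT', polyIntegral_path_extend h₂ hT₂ hT']
  ring

theorem continuousOn_inv_sub {s : Set ℂ} {p : ℂ} (hp : p ∉ s) :
    ContinuousOn (fun z : ℂ => (z - p)⁻¹) s :=
  ContinuousOn.inv₀ (by fun_prop) fun z hz h => hp (by rwa [← sub_eq_zero.1 h])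

/-- Beyond both radii the two contours share the imaginary axis, so the difference of the truncated
integrals no longer depends on the cut-off. It therefore equals its limit already at finite `T`. -/
theorem polyIntegral_inv_path_sub_eq {C₁ C₂ : Contour} {p v₁ v₂ : ℂ} (hp₁ : p ∉ C₁.support)
    (hp₂ : p ∉ C₂.support) (h₁ : C₁.HasTurning p v₁) (h₂ : C₂.HasTurning p v₂) {T : ℝ}
    (hT₁ : C₁.R ≤ T) (hT₂ : C₂.R ≤ T) :
    polyIntegral (fun z => (z - p)⁻¹) (C₁.path T) - polyIntegral (fun z => (z - p)⁻¹) (C₂.path T)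
      = v₁ - v₂ := by
  have h := Filter.Tendsto.sub h₁ h₂
  refine tendsto_nhds_unique (Tendsto.congr' ?_ tendsto_const_nhds) h
  filter_upwards [eventually_ge_atTop T] with T' hT'
  exact (polyIntegral_path_sub_eq (continuousOn_inv_sub hp₁) (continuousOn_inv_sub hp₂) hT₁ hT₂ hT').symm

theorem integral_eq {C : Contour} {f : ℂ → ℂ} (hf : ContinuousOn f C.support) {T : ℝ} (hT : C.R ≤ T)
    (hneg : IntegrableOn (fun y : ℝ => f (y * Complex.I)) (Set.Iic (-T)))
    (hpos : IntegrableOn (fun y : ℝ => f (y * Complex.I)) (Set.Ioi T)) :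
    C.integral f = (∫ y in Set.Iic (-T), f (y * Complex.I)) * Complex.I
      + polyIntegral f (C.path T) + (∫ y in Set.Ioi T, f (y * Complex.I)) * Complex.I := by
  have hR := C.R_pos
  have i1 : IntervalIntegrable (fun y : ℝ => f (y * Complex.I)) volume (-T) (-C.R) :=
    intervalIntegrable_axis hf fun y hy => by
      rw [Set.uIcc_of_le (by linarith)] at hy
      rw [abs_of_nonpos (by linarith [hy.2])]; linarith [hy.2]
  have i2 : IntervalIntegrable (fun y : ℝ => f (y * Complex.I)) volume C.R T :=
    intervalIntegrable_axis hf fun y hy => by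
      rw [Set.uIcc_of_le hT] at hy
      rw [abs_of_nonneg (by linarith [hy.1])]; linarith [hy.1]
  have hIic : Set.Iic (-C.R) = Set.Iic (-T) ∪ Set.Ioc (-T) (-C.R) :=
    (Set.Iic_union_Ioc_eq_Iic (by linarith)).symm
  have hIoi : Set.Ioi C.R = Set.Ioc C.R T ∪ Set.Ioi T := (Set.Ioc_union_Ioi_eq_Ioi hT).symm
  rw [integral, polyIntegral_path, hIic, hIoi,
    setIntegral_union (Set.Iic_disjoint_Ioc le_rfl) measurableSet_Ioc hneg
      ((intervalIntegrable_iff_integrableOn_Ioc_of_le (by linarith)).1 i1),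
    setIntegral_union (Set.Ioc_disjoint_Ioi le_rfl) measurableSet_Ioi
      ((intervalIntegrable_iff_integrableOn_Ioc_of_le hT).1 i2) hpos,
    intervalIntegral.integral_of_le (by linarith), intervalIntegral.integral_of_le hT]
  ring

end Contour

/-! ### Existence of separating contours -/

theorem hasDerivAt_log_sub {p z : ℂ} (h : z - p ∈ Complex.slitPlane) :
    HasDerivAt (fun z => Complex.log (z - p)) (z - p)⁻¹ z := by
  simpa using ((hasDerivAt_id z).sub_const p).clog h

theorem hasDerivAt_log_const_sub {p z : ℂ} (h : p - z ∈ Complex.slitPlane) :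
    HasDerivAt (fun z => Complex.log (p - z)) (z - p)⁻¹ z := by
  have := ((hasDerivAt_id z).const_sub p).clog h
  refine this.congr_deriv ?_
  rw [← neg_sub p z, inv_neg, neg_div, one_div]
  rfl

/-- This gives a primitive of `1/(z - b)` on the disc about `p` that reaches up to `b`; it shows
that a small loop about `p` does not see `b`. -/
theorem hasDerivAt_log_one_sub_div {b p z : ℂ} (h : ‖z - p‖ < ‖b - p‖) :
    HasDerivAt (fun z => Complex.log (1 - (z - p) / (b - p))) (z - b)⁻¹ z := by
  have hb : b - p ≠ 0 := by
    intro h0; rw [h0, norm_zero] at h; exact absurd h (not_lt.2 (norm_nonneg _))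
  have hz : z - b ≠ 0 := by
    intro h0; rw [sub_eq_zero.1 h0] at h; exact lt_irrefl _ h
  have hs : 1 - (z - p) / (b - p) ∈ Complex.slitPlane := by
    rw [sub_eq_add_neg]
    refine Complex.mem_slitPlane_of_norm_lt_one ?_
    rw [norm_neg, norm_div, div_lt_one (norm_pos_iff.2 hb)]
    exact h
  have := ((((hasDerivAt_id z).sub_const p).div_const (b - p)).const_sub 1).clog hs
  refine this.congr_deriv ?_
  simp only [id]
  rw [show 1 - (z - p) / (b - p) = -(z - b) / (b - p) by field_simp; ring]
  field_simp

theorem tendsto_log_mul_sub {u : ℂ} (hu : u ∈ Complex.slitPlane) (p : ℂ) :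
    Tendsto (fun T : ℝ => Complex.log (T * u - p) - Real.log T) atTop (𝓝 (Complex.log u)) := by
  have h1 : Tendsto (fun T : ℝ => u - p * ((T⁻¹ : ℝ) : ℂ)) atTop (𝓝 u) := by
    have h2 := (Complex.continuous_ofReal.tendsto 0).comp tendsto_inv_atTop_zero
    simpa using (h2.const_mul p).const_sub u
  have h3 := (continuousAt_clog hu).tendsto.comp h1
  refine h3.congr' ?_
  filter_upwards [eventually_gt_atTop 0, h1.eventually_ne (Complex.slitPlane_ne_zero hu)] with T hT hne
  have hTc : (T : ℂ) ≠ 0 := Complex.ofReal_ne_zero.2 hT.ne'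
  have e : (T : ℂ) * u - p = T * (u - p * ((T⁻¹ : ℝ) : ℂ)) := by
    push_cast; field_simp
  rw [e, Complex.log_ofReal_mul hT hne, Function.comp_apply]
  ring

theorem I_mem_slitPlane : Complex.I ∈ Complex.slitPlane := by simp [Complex.mem_slitPlane_iff]

theorem neg_I_mem_slitPlane : -Complex.I ∈ Complex.slitPlane := by simp [Complex.mem_slitPlane_iff]

namespace Contour

theorem polyIntegral_inv_path_eq (C : Contour) {p : ℂ} {T : ℝ} (hT : C.R ≤ T) {G : ℂ → ℂ}
    (hp : p ∉ C.support) (hG : ∀ z ∈ C.support, HasDerivAt G (z - p)⁻¹ z) :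
    polyIntegral (fun z => (z - p)⁻¹) (C.path T) = G (T * Complex.I) - G (-(T * Complex.I)) := by
  have hsub := C.polySupport_path_subset hT
  exact polyIntegral_eq_sub _ C.vertices _ ((continuousOn_inv_sub hp).mono hsub)
    (fun z hz => hG z (hsub hz))

/-- If the contour misses the horizontal ray going left from `p`, then `log(z - p)` is a primitive
along it. At the two ends the divergent `log T` cancels and `log i - log(-i) = πi` remains. -/
theorem isLeft_of_slitPlane {C : Contour} {p : ℂ} (h : ∀ z ∈ C.support, z - p ∈ Complex.slitPlane) :
    C.IsLeft p := by
  have hp : p ∉ C.support := fun hp => by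
    have := h p hp
    rw [sub_self] at this
    exact Complex.zero_notMem_slitPlane this
  refine ⟨hp, ?_⟩
  have h1 := tendsto_log_mul_sub I_mem_slitPlane p
  have h2 := tendsto_log_mul_sub neg_I_mem_slitPlane p
  have h3 := h1.sub h2
  rw [Complex.log_I, Complex.log_neg_I] at h3
  rw [show (Real.pi / 2 * Complex.I - -(Real.pi / 2) * Complex.I : ℂ) = Real.pi * Complex.I by ring] at h3
  refine h3.congr' ?_
  filter_upwards [eventually_ge_atTop C.R] with T hT
  have := C.polyIntegral_inv_path_eq hT hp fun z hz => hasDerivAt_log_sub (h z hz)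
  rw [path] at this
  rw [this, mul_neg]
  ring

theorem isRight_of_slitPlane {C : Contour} {p : ℂ} (h : ∀ z ∈ C.support, p - z ∈ Complex.slitPlane) :
    C.IsRight p := by
  have hp : p ∉ C.support := fun hp => by
    have := h p hp
    rw [sub_self] at this
    exact Complex.zero_notMem_slitPlane this
  refine ⟨hp, ?_⟩
  have h1 := tendsto_log_mul_sub I_mem_slitPlane (-p)
  have h2 := tendsto_log_mul_sub neg_I_mem_slitPlane (-p)
  have h3 := h2.sub h1
  rw [Complex.log_I, Complex.log_neg_I] at h3
  rw [show (-(Real.pi / 2) * Complex.I - Real.pi / 2 * Complex.I : ℂ) = -(Real.pi * Complex.I) by ring] at h3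
  refine h3.congr' ?_
  filter_upwards [eventually_ge_atTop C.R] with T hT
  have := C.polyIntegral_inv_path_eq hT hp fun z hz => hasDerivAt_log_const_sub (h z hz)
  rw [path] at this
  rw [this, mul_neg, show (-(T * Complex.I) - -p : ℂ) = p - T * Complex.I by ring,
    show (T * Complex.I - -p : ℂ) = p - -(T * Complex.I) by ring]
  ring

/-- The contour running along `Re z = c` for `|Im z| ≤ R`. -/
noncomputable def bracket (R : ℝ) (hR : 0 < R) (c : ℝ) : Contour :=
  ⟨R, hR, [c - R * Complex.I, c + R * Complex.I]⟩

theorem im_eq_of_mem_segment {v w z : ℂ} {a : ℝ} (hv : v.im = a) (hw : w.im = a)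
    (hz : z ∈ segment ℝ v w) : z.im = a := by
  obtain ⟨s, t, _, _, hst, rfl⟩ := hz
  rw [Complex.add_im, Complex.smul_im, Complex.smul_im, hv, hw, ← add_smul, hst, one_smul]

theorem re_eq_of_mem_segment {v w z : ℂ} {a : ℝ} (hv : v.re = a) (hw : w.re = a)
    (hz : z ∈ segment ℝ v w) : z.re = a := by
  obtain ⟨s, t, _, _, hst, rfl⟩ := hz
  rw [Complex.add_re, Complex.smul_re, Complex.smul_re, hv, hw, ← add_smul, hst, one_smul]

theorem bracket_support {R : ℝ} (hR : 0 < R) {c : ℝ} {z : ℂ} (hz : z ∈ (bracket R hR c).support) :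
    R ≤ |z.im| ∨ z.re = c := by
  rcases hz with ⟨y, hy, rfl⟩ | hz
  · left
    have hy' : R ≤ |y| := hy
    simpa using hy'
  · simp only [bracket, vertices, List.cons_append, List.nil_append, polySupport_cons_cons,
      polySupport_singleton, Set.union_empty] at hz
    rcases hz with hz | hz | hz
    · left
      rw [im_eq_of_mem_segment (a := -R) (by simp) (by simp) hz, abs_neg, abs_of_pos hR]
    · right
      exact re_eq_of_mem_segment (by simp) (by simp) hz
    · left
      rw [im_eq_of_mem_segment (a := R) (by simp) (by simp) hz, abs_of_pos hR]

theorem bracket_isLeft {R : ℝ} (hR : 0 < R) {c : ℝ} {p : ℂ} (h1 : |p.im| < R) (h2 : p.re < c) :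
    (bracket R hR c).IsLeft p := by
  refine isLeft_of_slitPlane fun z hz => ?_
  rw [Complex.mem_slitPlane_iff, Complex.sub_re, Complex.sub_im]
  rcases bracket_support hR hz with h | h
  · right
    intro h0
    rw [sub_eq_zero.1 h0] at h
    linarith
  · left; linarith

theorem bracket_isRight {R : ℝ} (hR : 0 < R) {c : ℝ} {p : ℂ} (h1 : |p.im| < R) (h2 : c < p.re) :
    (bracket R hR c).IsRight p := by
  refine isRight_of_slitPlane fun z hz => ?_
  rw [Complex.mem_slitPlane_iff, Complex.sub_re, Complex.sub_im]
  rcases bracket_support hR hz with h | h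
  · right
    intro h0
    rw [← sub_eq_zero.1 h0] at h
    linarith
  · left; linarith

/-- The contour `C` preceded by a detour along a square with centre `p`. -/
noncomputable def lasso (C : Contour) (p : ℂ) (r : ℝ) (κ : ℂ) : Contour :=
  ⟨C.R, C.R_pos, [p + r, p + κ * r, p + κ ^ 2 * r, p + κ ^ 3 * r, p + r, -(C.R * Complex.I)] ++ C.mid⟩

/-- The segment leading to the square is run through in both directions and cancels, so only the
four sides remain. -/
theorem polyIntegral_lasso_path (C : Contour) (p : ℂ) (r : ℝ) (κ : ℂ) (f : ℂ → ℂ) (T : ℝ) :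
    polyIntegral f ((C.lasso p r κ).path T) = polyIntegral f (C.path T)
      + (segIntegral f (p + r) (p + κ * r) + segIntegral f (p + κ * r) (p + κ ^ 2 * r)
      + segIntegral f (p + κ ^ 2 * r) (p + κ ^ 3 * r) + segIntegral f (p + κ ^ 3 * r) (p + r)) := by
  simp only [path, vertices, lasso, List.cons_append, List.nil_append, polyIntegral_cons_cons]
  rw [segIntegral_symm f (-(C.R * Complex.I)) (p + r)]
  ring

theorem ne_and_dist_le_of_mem_segment_mul {p u z κ : ℂ} (hκ : κ = Complex.I ∨ κ = -Complex.I) (hu : u ≠ 0)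
    (hz : z ∈ segment ℝ (p + u) (p + κ * u)) : z ≠ p ∧ ‖z - p‖ ≤ ‖u‖ ∧ (z - p) / u ∈ Complex.slitPlane := by
  obtain ⟨s, t, hs, ht, hst, rfl⟩ := hz
  have e : s • (p + u) + t • (p + κ * u) - p = (s + t * κ) * u := by
    simp only [Complex.real_smul]
    have : (s : ℂ) + t = 1 := by exact_mod_cast hst
    linear_combination p * this
  have hslit : (s + t * κ : ℂ) ∈ Complex.slitPlane := by
    rw [Complex.mem_slitPlane_iff]
    rcases hs.eq_or_lt with h | h
    · right
      have : t = 1 := by linarith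
      rcases hκ with rfl | rfl <;> simp [this]
    · left
      rcases hκ with rfl | rfl <;> simpa using h
  have hn : ‖(s + t * κ : ℂ)‖ ≤ 1 := by
    have hκn : ‖κ‖ = 1 := by rcases hκ with rfl | rfl <;> simp
    refine (norm_add_le _ _).trans ?_
    rw [norm_mul, hκn, Complex.norm_real, Complex.norm_real, Real.norm_of_nonneg hs,
      Real.norm_of_nonneg ht, mul_one, hst]
  refine ⟨?_, ?_, ?_⟩
  · rw [← sub_ne_zero, e]
    exact mul_ne_zero (Complex.slitPlane_ne_zero hslit) hu
  · rw [e, norm_mul]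
    exact mul_le_of_le_one_left (norm_nonneg _) hn
  · rw [e, mul_div_cancel_right₀ _ hu]
    exact hslit

/-- Divided by `u`, the side from `p + u` to `p + κu` runs from `1` to `κ = ±i` within the slit
plane, where the principal logarithm is a primitive. -/
theorem segIntegral_inv_sub_mul {p u κ : ℂ} (hκ : κ = Complex.I ∨ κ = -Complex.I) (hu : u ≠ 0) :
    segIntegral (fun z => (z - p)⁻¹) (p + u) (p + κ * u) = Complex.log κ := by
  have h := segIntegral_eq_sub (g := fun z => (z - p)⁻¹) (G := fun z => Complex.log ((z - p) / u))
    (v := p + u) (w := p + κ * u)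
    (continuousOn_inv_sub fun hp => (ne_and_dist_le_of_mem_segment_mul hκ hu hp).1 rfl) (fun z hz => by
      obtain ⟨h1, _, h2⟩ := ne_and_dist_le_of_mem_segment_mul hκ hu hz
      refine ((((hasDerivAt_id z).sub_const p).div_const u).clog h2).congr_deriv ?_
      have := sub_ne_zero.2 h1
      simp only [id]
      field_simp)
  rw [h, add_sub_cancel_left, add_sub_cancel_left, mul_div_cancel_right₀ _ hu, div_self hu,
    Complex.log_one, sub_zero]

theorem square_segments {κ : ℂ} (hκ : κ = Complex.I ∨ κ = -Complex.I) (p : ℂ) (r : ℝ) :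
    p + κ ^ 2 * r = p + κ * (κ * r) ∧ p + κ ^ 3 * r = p + κ * (κ ^ 2 * r) ∧
      p + r = p + κ * (κ ^ 3 * r) := by
  have : κ ^ 4 = 1 := by
    rcases hκ with rfl | rfl
    · exact Complex.I_pow_four
    · rw [neg_pow, Complex.I_pow_four]; norm_num
  refine ⟨by ring, by ring, ?_⟩
  linear_combination (-r : ℂ) * this

/-- Here `4 log κ = ±2πi`: the loop changes `±πi` into its negative when `κ` is chosen with the
right sign, and so moves `p` to the other side. -/
theorem hasTurning_lasso_self {C : Contour} {p v κ : ℂ} {r : ℝ} (hr : 0 < r)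
    (hκ : κ = Complex.I ∨ κ = -Complex.I) (h : C.HasTurning p v) :
    (C.lasso p r κ).HasTurning p (v + 4 * Complex.log κ) := by
  have hκ0 : κ ≠ 0 := by rcases hκ with rfl | rfl <;> simp
  have hrc : (r : ℂ) ≠ 0 := Complex.ofReal_ne_zero.2 hr.ne'
  refine (h.add_const _).congr fun T => ?_
  refine Eq.trans ?_ (C.polyIntegral_lasso_path p r κ _ T).symm
  obtain ⟨e1, e2, e3⟩ := square_segments hκ p r
  have s1 := segIntegral_inv_sub_mul (p := p) hκ hrc
  have s2 := segIntegral_inv_sub_mul (p := p) hκ (mul_ne_zero hκ0 hrc)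
  have s3 := segIntegral_inv_sub_mul (p := p) hκ (mul_ne_zero (pow_ne_zero 2 hκ0) hrc)
  have s4 := segIntegral_inv_sub_mul (p := p) hκ (mul_ne_zero (pow_ne_zero 3 hκ0) hrc)
  rw [← e1] at s2
  rw [← e2] at s3
  rw [← e3] at s4
  rw [s1, s2, s3, s4, path]
  ring

theorem hasTurning_lasso_of_lt {C : Contour} {p b v κ : ℂ} {r : ℝ} (hr : 0 < r)
    (hκ : κ = Complex.I ∨ κ = -Complex.I) (hb : r < ‖b - p‖) (h : C.HasTurning b v) :
    (C.lasso p r κ).HasTurning b v := by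
  have hκ0 : κ ≠ 0 := by rcases hκ with rfl | rfl <;> simp
  have hκn : ‖κ‖ = 1 := by rcases hκ with rfl | rfl <;> simp
  have hrc : (r : ℂ) ≠ 0 := Complex.ofReal_ne_zero.2 hr.ne'
  refine h.congr fun T => ?_
  refine Eq.trans ?_ (C.polyIntegral_lasso_path p r κ _ T).symm
  obtain ⟨e1, e2, e3⟩ := square_segments hκ p r
  have key : ∀ u : ℂ, ‖u‖ = r → segIntegral (fun z => (z - b)⁻¹) (p + u) (p + κ * u)
      = Complex.log (1 - (p + κ * u - p) / (b - p)) - Complex.log (1 - (p + u - p) / (b - p)) := by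
    intro u hu
    have hu0 : u ≠ 0 := by rw [← norm_pos_iff, hu]; exact hr
    refine segIntegral_eq_sub (G := fun z => Complex.log (1 - (z - p) / (b - p)))
      (continuousOn_inv_sub fun hm => ?_) fun z hz => hasDerivAt_log_one_sub_div ?_
    · have := (ne_and_dist_le_of_mem_segment_mul hκ hu0 hm).2.1
      linarith
    · have := (ne_and_dist_le_of_mem_segment_mul hκ hu0 hz).2.1
      linarith
  have hn : ∀ k : ℕ, ‖κ ^ k * r‖ = r := by
    intro k
    rw [norm_mul, norm_pow, hκn, one_pow, one_mul, Complex.norm_real, Real.norm_of_nonneg hr.le]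
  have s1 := key r (by simpa using hn 0)
  have s2 := key (κ * r) (by simpa using hn 1)
  have s3 := key (κ ^ 2 * r) (hn 2)
  have s4 := key (κ ^ 3 * r) (hn 3)
  rw [← e1] at s2
  rw [← e2] at s3
  rw [← e3] at s4
  rw [s1, s2, s3, s4, path]
  ring

theorem mem_support_lasso {C : Contour} {p z κ : ℂ} {r : ℝ} (hr : 0 < r)
    (hκ : κ = Complex.I ∨ κ = -Complex.I) (hz : z ∈ (C.lasso p r κ).support) :
    z ∈ C.support ∨ z ∈ segment ℝ (-(C.R * Complex.I)) (p + r) ∨ (z ≠ p ∧ ‖z - p‖ ≤ r) := by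
  have hκ0 : κ ≠ 0 := by rcases hκ with rfl | rfl <;> simp
  have hκn : ‖κ‖ = 1 := by rcases hκ with rfl | rfl <;> simp
  have hrc : (r : ℂ) ≠ 0 := Complex.ofReal_ne_zero.2 hr.ne'
  obtain ⟨e1, e2, e3⟩ := square_segments hκ p r
  have hn : ∀ k : ℕ, ‖κ ^ k * r‖ = r := by
    intro k
    rw [norm_mul, norm_pow, hκn, one_pow, one_mul, Complex.norm_real, Real.norm_of_nonneg hr.le]
  have key : ∀ u : ℂ, ‖u‖ = r → z ∈ segment ℝ (p + u) (p + κ * u) → z ≠ p ∧ ‖z - p‖ ≤ r := by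
    intro u hu hz
    have hu0 : u ≠ 0 := by rw [← norm_pos_iff, hu]; exact hr
    have := ne_and_dist_le_of_mem_segment_mul hκ hu0 hz
    rw [hu] at this
    exact ⟨this.1, this.2.1⟩
  rcases hz with ⟨y, hy, rfl⟩ | hz
  · exact Or.inl (Or.inl ⟨y, hy, rfl⟩)
  · simp only [vertices, lasso, List.cons_append, List.nil_append, polySupport_cons_cons] at hz
    rcases hz with hz | hz | hz | hz | hz | hz | hz
    · exact Or.inr (Or.inl hz)
    · exact Or.inr (Or.inr (key r (by simpa using hn 0) hz))
    · rw [e1] at hz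
      exact Or.inr (Or.inr (key (κ * r) (by simpa using hn 1) hz))
    · rw [e2] at hz
      exact Or.inr (Or.inr (key (κ ^ 2 * r) (hn 2) hz))
    · rw [e3] at hz
      exact Or.inr (Or.inr (key (κ ^ 3 * r) (hn 3) hz))
    · rw [segment_symm] at hz
      exact Or.inr (Or.inl hz)
    · exact Or.inl (Or.inr hz)

end Contour

/-! ### Locally finite sets and the contour separating two of them. -/

/-- Every disc contains only finitely many points of `B`. -/
def LocFinite (B : Set ℂ) : Prop := ∀ ρ : ℝ, (B ∩ {z | ‖z‖ ≤ ρ}).Finite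

theorem LocFinite.countable {B : Set ℂ} (hB : LocFinite B) : B.Countable := by
  have : B = ⋃ n : ℕ, B ∩ {z | ‖z‖ ≤ n} := by
    ext z
    simp only [Set.mem_iUnion, Set.mem_inter_iff, Set.mem_ofPred_eq]
    exact ⟨fun h => (exists_nat_ge ‖z‖).imp fun n hn => ⟨h, hn⟩, fun ⟨n, h⟩ => h.1⟩
  rw [this]
  exact Set.countable_iUnion fun n => (hB n).countable

theorem exists_mem_Ioo_notMem_of_countable {S : Set ℝ} (hS : S.Countable) {a b : ℝ} (hab : a < b) :
    ∃ c ∈ Set.Ioo a b, c ∉ S := by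
  obtain ⟨c, hc, hc'⟩ := (hS.dense_compl ℝ).exists_between hab
  exact ⟨c, hc', hc⟩

theorem LocFinite.exists_pos_lt_norm_sub {B : Set ℂ} (hB : LocFinite B) (p : ℂ) :
    ∃ δ, 0 < δ ∧ ∀ b ∈ B, b ≠ p → δ < ‖b - p‖ := by
  have hfin : ((B ∩ {z | ‖z‖ ≤ ‖p‖ + 1}) \ {p}).Finite := (hB _).subset Set.sdiff_subset
  have hcl := hfin.isClosed
  have hp : p ∉ ((B ∩ {z | ‖z‖ ≤ ‖p‖ + 1}) \ {p}) := fun h => h.2 rfl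
  obtain ⟨ε, hε, hball⟩ := Metric.isOpen_iff.1 hcl.isOpen_compl p hp
  refine ⟨min ε 1 / 2, by positivity, fun b hb hbp => ?_⟩
  by_contra! h
  have h1 : ‖b - p‖ < ε := by
    have := min_le_left ε 1
    have : 0 < min ε 1 := by positivity
    linarith
  have hbb : b ∈ Metric.ball p ε := by rwa [Metric.mem_ball, dist_eq_norm]
  refine hball hbb ⟨⟨hb, ?_⟩, hbp⟩
  have h2 := norm_le_norm_add_norm_sub' b p
  have := min_le_right ε 1
  rw [Set.mem_ofPred_eq]
  linarith

/-- The segment from `a` to `p + r` must miss `B`. Since `a` lies strictly below `B`, the imaginary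
part of a point `b` fixes its parameter on the segment, which is nonzero, and then the real part
fixes `r`. So each `b` excludes at most one radius, and `B` is countable. -/
theorem exists_lasso_radius {B : Set ℂ} (hB : LocFinite B) {a : ℂ} (ha : ∀ b ∈ B, a.im < b.im) {p : ℂ}
    (hp : p ∈ B) : ∃ r : ℝ, 0 < r ∧ (∀ b ∈ B, b ≠ p → r < ‖b - p‖) ∧ ∀ b ∈ B, b ∉ segment ℝ a (p + r) := by
  obtain ⟨δ, hδ, h⟩ := hB.exists_pos_lt_norm_sub p
  have hS : (⋃ b ∈ B, {r : ℝ | b ∈ segment ℝ a (p + r)}).Countable := by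
    refine hB.countable.biUnion fun b hb => Set.Subsingleton.countable ?_
    rintro r₁ ⟨s₁, t₁, _, _, h₁, e₁⟩ r₂ ⟨s₂, t₂, _, _, h₂, e₂⟩
    have i₁ := congrArg Complex.im e₁
    have i₂ := congrArg Complex.im e₂
    have j₁ := congrArg Complex.re e₁
    have j₂ := congrArg Complex.re e₂
    simp only [Complex.add_im, Complex.smul_im, Complex.add_re, Complex.smul_re, Complex.ofReal_re,
      Complex.ofReal_im, smul_eq_mul, add_zero] at i₁ i₂ j₁ j₂
    have hpa := ha p hp
    have hba := ha b hb
    obtain rfl : s₁ = 1 - t₁ := by linarith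
    obtain rfl : s₂ = 1 - t₂ := by linarith
    have ht : t₁ = t₂ := by
      have : (t₁ - t₂) * (p.im - a.im) = 0 := by linarith
      rcases mul_eq_zero.1 this with h | h
      · linarith
      · linarith
    have ht0 : t₁ ≠ 0 := by
      rintro rfl
      linarith
    subst ht
    have : t₁ * (r₁ - r₂) = 0 := by linarith
    rcases mul_eq_zero.1 this with h | h
    · exact absurd h ht0
    · linarith
  obtain ⟨r, hr, hrS⟩ := exists_mem_Ioo_notMem_of_countable hS hδ
  refine ⟨r, hr.1, fun b hb hbp => hr.2.trans (h b hb hbp), fun b hb hm => hrS ?_⟩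
  simp only [Set.mem_iUnion]
  exact ⟨b, hb, hm⟩

/-- `F` is the set of points whose side is to be reversed relative to the line `Re z = c`. Each one
gets its own loop, clockwise if it was on the left and counterclockwise if it was on the right, with
no effect on the other points of `B`. -/
theorem exists_contour_avoiding {B : Set ℂ} (hB : LocFinite B) {R : ℝ} (hR : 0 < R)
    (him : ∀ b ∈ B, |b.im| < R) (c : ℝ) (hc : ∀ b ∈ B, b.re ≠ c) (F : Finset ℂ) (hF : ↑F ⊆ B) :
    ∃ C : Contour, C.R = R ∧ ∀ b ∈ B, b ∉ C.support ∧
      ((b.re < c ↔ b ∉ F) → C.HasTurning b (Real.pi * Complex.I)) ∧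
      (¬(b.re < c ↔ b ∉ F) → C.HasTurning b (-(Real.pi * Complex.I))) := by
  induction F using Finset.induction_on with
  | empty =>
    refine ⟨Contour.bracket R hR c, rfl, fun b hb => ?_⟩
    simp only [Finset.notMem_empty, not_false_eq_true, iff_true, not_lt]
    rcases lt_or_ge b.re c with h | h
    · have := Contour.bracket_isLeft hR (him b hb) h
      exact ⟨this.1, fun _ => this.2, fun h' => absurd h (not_lt.2 h')⟩
    · have := Contour.bracket_isRight hR (him b hb) (lt_of_le_of_ne h (hc b hb).symm)
      exact ⟨this.1, fun h' => absurd h' (not_lt.2 h), fun _ => this.2⟩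
  | insert p F hpF ih =>
    obtain ⟨C, hCR, hC⟩ := ih ((Finset.coe_subset.2 (Finset.subset_insert p F)).trans hF)
    have hp : p ∈ B := hF (by simp)
    obtain ⟨r, hr, hr1, hr2⟩ := exists_lasso_radius hB (a := -(C.R * Complex.I)) (fun b hb => by
      rw [hCR]
      have := (abs_lt.1 (him b hb)).1
      simpa using this) hp
    have hav : ∀ κ : ℂ, (κ = Complex.I ∨ κ = -Complex.I) → ∀ b ∈ B, b ∉ (C.lasso p r κ).support := by
      intro κ hκ b hb hm
      rcases Contour.mem_support_lasso hr hκ hm with h | h | h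
      · exact (hC b hb).1 h
      · exact hr2 b hb h
      · have := hr1 b hb h.1
        linarith [h.2]
    have hother : ∀ κ : ℂ, (κ = Complex.I ∨ κ = -Complex.I) → ∀ b ∈ B, b ≠ p →
        ((b.re < c ↔ b ∉ insert p F) → (C.lasso p r κ).HasTurning b (Real.pi * Complex.I)) ∧
        (¬(b.re < c ↔ b ∉ insert p F) → (C.lasso p r κ).HasTurning b (-(Real.pi * Complex.I))) := by
      intro κ hκ b hb hbp
      rw [Finset.mem_insert, or_iff_right hbp]
      exact ⟨fun h => Contour.hasTurning_lasso_of_lt hr hκ (hr1 b hb hbp) ((hC b hb).2.1 h),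
        fun h => Contour.hasTurning_lasso_of_lt hr hκ (hr1 b hb hbp) ((hC b hb).2.2 h)⟩
    rcases lt_or_ge p.re c with h | h
    · refine ⟨C.lasso p r (-Complex.I), hCR, fun b hb => ⟨hav _ (Or.inr rfl) b hb, ?_⟩⟩
      rcases eq_or_ne b p with rfl | hbp
      · have h1 := Contour.hasTurning_lasso_self (κ := -Complex.I) hr (Or.inr rfl)
          ((hC b hb).2.1 (by simp [h, hpF]))
        refine ⟨fun h' => absurd h (by simp [h']), fun _ => ?_⟩
        convert h1 using 1
        rw [Complex.log_neg_I]
        ring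
      · exact hother _ (Or.inr rfl) b hb hbp
    · refine ⟨C.lasso p r Complex.I, hCR, fun b hb => ⟨hav _ (Or.inl rfl) b hb, ?_⟩⟩
      rcases eq_or_ne b p with rfl | hbp
      · have h1 := Contour.hasTurning_lasso_self (κ := Complex.I) hr (Or.inl rfl)
          ((hC b hb).2.2 (by simp [h, hpF]))
        refine ⟨fun _ => ?_, fun h' => absurd h (by simpa using h')⟩
        convert h1 using 1
        rw [Complex.log_I]
        ring
      · exact hother _ (Or.inl rfl) b hb hbp

/-- The bounds on the real and imaginary parts confine the points on the wrong side of a vertical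
line to a bounded region. There are finitely many of them by local finiteness, and these form the
set `F` of `exists_contour_avoiding`. -/
theorem exists_contour_separating {L Rt : Set ℂ} (hL : LocFinite L) (hRt : LocFinite Rt)
    (hdisj : Disjoint L Rt) {Y A : ℝ} (hLim : ∀ b ∈ L, |b.im| ≤ Y) (hRim : ∀ b ∈ Rt, |b.im| ≤ Y)
    (hLre : ∀ b ∈ L, b.re ≤ A) (hRre : ∀ b ∈ Rt, -A ≤ b.re) :
    ∃ C : Contour, (∀ p ∈ L, C.IsLeft p) ∧ ∀ p ∈ Rt, C.IsRight p := by
  have hB : LocFinite (L ∪ Rt) := fun ρ => by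
    rw [Set.union_inter_distrib_right]
    exact (hL ρ).union (hRt ρ)
  obtain ⟨c, hc01, hc⟩ := exists_mem_Ioo_notMem_of_countable
    (hB.countable.image Complex.re) (zero_lt_one' ℝ)
  have hbound : ∀ b : ℂ, |b.im| ≤ Y → |b.re| ≤ |A| + 1 → ‖b‖ ≤ |A| + 1 + Y := fun b h1 h2 =>
    (Complex.norm_le_abs_re_add_abs_im b).trans (add_le_add h2 h1)
  have hW : ((L ∩ {b | c < b.re}) ∪ (Rt ∩ {b | b.re < c})).Finite := by
    refine ((hL (|A| + 1 + Y)).subset ?_).union ((hRt (|A| + 1 + Y)).subset ?_)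
    · rintro b ⟨hb, hb'⟩
      refine ⟨hb, hbound b (hLim b hb) (abs_le.2 ⟨?_, ?_⟩)⟩
      · have : c < b.re := hb'
        linarith [abs_nonneg A, hc01.1]
      · linarith [hLre b hb, le_abs_self A]
    · rintro b ⟨hb, hb'⟩
      refine ⟨hb, hbound b (hRim b hb) (abs_le.2 ⟨?_, ?_⟩)⟩
      · linarith [hRre b hb, le_abs_self A]
      · have : b.re < c := hb'
        linarith [abs_nonneg A, hc01.2]
  obtain ⟨C, _, hC⟩ := exists_contour_avoiding hB (R := |Y| + 1) (by positivity)
    (fun b hb => by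
      rcases hb with h | h
      · linarith [hLim b h, le_abs_self Y]
      · linarith [hRim b h, le_abs_self Y]) c (fun b hb h => hc ⟨b, hb, h⟩) hW.toFinset (by
      rw [Set.Finite.coe_toFinset]
      exact Set.union_subset_union Set.inter_subset_left Set.inter_subset_left)
  refine ⟨C, fun p hp => ?_, fun p hp => ?_⟩
  · have h := hC p (Or.inl hp)
    refine ⟨h.1, h.2.1 ?_⟩
    have hne : p.re ≠ c := fun h => hc ⟨p, Or.inl hp, h⟩
    have hpR : p ∉ Rt := fun h => Set.disjoint_left.1 hdisj hp h
    simp only [Set.Finite.mem_toFinset, Set.mem_union, Set.mem_inter_iff, hp, true_and, hpR,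
      false_and, or_false, Set.mem_ofPred_eq, not_lt]
    exact ⟨fun h => h.le, fun h => lt_of_le_of_ne h hne⟩
  · have h := hC p (Or.inr hp)
    refine ⟨h.1, h.2.2 ?_⟩
    have hpL : p ∉ L := fun h => Set.disjoint_left.1 hdisj h hp
    simp only [Set.Finite.mem_toFinset, Set.mem_union, Set.mem_inter_iff, hp, true_and, hpL,
      false_and, false_or, Set.mem_ofPred_eq, not_lt]
    intro h
    rcases lt_or_ge p.re c with h' | h'
    · linarith [h.1 h']
    · linarith [h.2 h']

/-! ### Stability of the turning number -/

namespace Contour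

/-- The function `log((z - p)/(z - p₀))` is single-valued along `C`, because its argument stays
within distance `1` of `1`, and it tends to `0` at both ends. Hence `p` and `p₀` have the same
turning. -/
theorem hasTurning_of_norm_sub_lt {C : Contour} {p₀ p v : ℂ}
    (h : ∀ z ∈ C.support, ‖p - p₀‖ < ‖z - p₀‖) (hv : C.HasTurning p₀ v) :
    p ∉ C.support ∧ C.HasTurning p v := by
  have hp : p ∉ C.support := fun hp => lt_irrefl _ (h p hp)
  have hp₀ : p₀ ∉ C.support := fun hp => by
    have := h p₀ hp
    rw [sub_self, norm_zero] at this
    exact absurd this (not_lt.2 (norm_nonneg _))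
  refine ⟨hp, ?_⟩
  set G : ℂ → ℂ := fun z => Complex.log (1 - (p - p₀) / (z - p₀)) with hG
  have hder : ∀ z ∈ C.support, HasDerivAt G ((z - p)⁻¹ + (-1) * (z - p₀)⁻¹) z := by
    intro z hz
    have h1 : z - p₀ ≠ 0 := fun h0 => hp₀ (by rwa [← sub_eq_zero.1 h0])
    have h2 : z - p ≠ 0 := fun h0 => hp (by rwa [← sub_eq_zero.1 h0])
    have hs : 1 - (p - p₀) / (z - p₀) ∈ Complex.slitPlane := by
      rw [sub_eq_add_neg]
      refine Complex.mem_slitPlane_of_norm_lt_one ?_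
      rw [norm_neg, norm_div, div_lt_one (norm_pos_iff.2 h1)]
      exact h z hz
    have h3 := ((((hasDerivAt_const z (p - p₀)).div ((hasDerivAt_id z).sub_const p₀) h1).const_sub 1).clog hs)
    refine h3.congr_deriv ?_
    simp only [id, Pi.div_apply]
    rw [show 1 - (p - p₀) / (z - p₀) = (z - p) / (z - p₀) by field_simp; ring]
    field_simp
    ring
  have hlim : ∀ u : ℂ, u ≠ 0 → Tendsto (fun T : ℝ => G (T * u)) atTop (𝓝 0) := by
    intro u hu
    have h1 : Tendsto (fun T : ℝ => (p - p₀) / (T * u - p₀)) atTop (𝓝 0) := by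
      have h2 : Tendsto (fun T : ℝ => ‖(T : ℂ) * u - p₀‖) atTop atTop := by
        refine tendsto_atTop_mono (fun T => ?_)
          (tendsto_atTop_add_const_right _ (-‖p₀‖) (tendsto_id.atTop_mul_const (norm_pos_iff.2 hu)))
        have := norm_sub_norm_le ((T : ℂ) * u) p₀
        rw [norm_mul, Complex.norm_real] at this
        have h3 : T * ‖u‖ ≤ ‖T‖ * ‖u‖ :=
          mul_le_mul_of_nonneg_right (Real.le_norm_self T) (norm_nonneg u)
        simp only [id]
        linarith
      simpa [div_eq_mul_inv] using
        (tendsto_inv₀_cobounded.comp (tendsto_norm_atTop_iff_cobounded.1 h2)).const_mul (p - p₀)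
    have h4 := (continuousAt_clog (x := 1 - 0) (by simp)).tendsto.comp (h1.const_sub 1)
    simp only [hG]
    simpa [Function.comp_def] using h4
  have h5 : Tendsto (fun T : ℝ => G (T * Complex.I) - G (-(T * Complex.I))) atTop (𝓝 0) := by
    have := (hlim Complex.I Complex.I_ne_zero).sub (hlim (-Complex.I) (neg_ne_zero.2 Complex.I_ne_zero))
    simpa using this
  have h6 := hv.add h5
  rw [add_zero] at h6
  refine h6.congr' ?_
  filter_upwards [eventually_ge_atTop C.R] with T hT
  have hsub := C.polySupport_path_subset hT
  have c1 := (continuousOn_inv_sub hp).mono hsub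
  have c2 : ContinuousOn (fun z : ℂ => (-1) * (z - p₀)⁻¹) (polySupport (C.path T)) :=
    continuousOn_const.mul ((continuousOn_inv_sub hp₀).mono hsub)
  have e1 : polyIntegral (fun z => (z - p)⁻¹ + (-1) * (z - p₀)⁻¹) (C.path T)
      = G (T * Complex.I) - G (-(T * Complex.I)) :=
    polyIntegral_eq_sub _ C.vertices _ (c1.add c2) (fun z hz => hder z (hsub hz))
  rw [polyIntegral_add _ c1 c2, polyIntegral_const_mul] at e1
  change polyIntegral (fun z => (z - p₀)⁻¹) (C.path T) + _ = polyIntegral (fun z => (z - p)⁻¹) (C.path T)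
  rw [← e1]
  ring

theorem isClosed_support (C : Contour) : IsClosed C.support := by
  refine IsClosed.union ?_ (isCompact_polySupport _).isClosed
  have : {z : ℂ | ∃ y : ℝ, C.R ≤ |y| ∧ z = y * Complex.I} = {z : ℂ | z.re = 0} ∩ {z : ℂ | C.R ≤ |z.im|} := by
    ext z
    constructor
    · rintro ⟨y, hy, rfl⟩
      exact ⟨by simp, by simpa using hy⟩
    · rintro ⟨h1, h2⟩
      refine ⟨z.im, h2, ?_⟩
      apply Complex.ext
      · simpa using h1
      · simp
  rw [this]
  exact (isClosed_eq (f := Complex.re) (g := fun _ => (0 : ℝ)) Complex.continuous_re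
    continuous_const).inter (isClosed_le continuous_const (by fun_prop))

theorem exists_abs_re_le (C : Contour) : ∃ ρ, 0 ≤ ρ ∧ ∀ z ∈ C.support, |z.re| ≤ ρ := by
  obtain ⟨ρ, hρ⟩ := (isCompact_polySupport C.vertices).isBounded.exists_norm_le
  refine ⟨max ρ 0, le_max_right _ _, ?_⟩
  rintro z (⟨y, _, rfl⟩ | hz)
  · simp
  · exact le_max_of_le_left ((Complex.abs_re_le_norm z).trans (hρ z hz))

/-- The points of `P` in a large disc form a finite set disjoint from the closed support. All others
have a real part differing by more than `1` from every real part on the contour. -/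
theorem exists_pos_lt_norm_sub (C : Contour) {P : Set ℂ} (hP : LocFinite P) {Y : ℝ}
    (him : ∀ p ∈ P, |p.im| ≤ Y) (hC : ∀ p ∈ P, p ∉ C.support) :
    ∃ δ, 0 < δ ∧ ∀ p ∈ P, ∀ z ∈ C.support, δ < ‖z - p‖ := by
  obtain ⟨ρ, hρ0, hρ⟩ := C.exists_abs_re_le
  obtain ⟨r, hr, h⟩ := Metric.exists_pos_forall_lt_edist (hP (ρ + 1 + Y)).isCompact C.isClosed_support
    (Set.disjoint_left.2 fun p hp => hC p hp.1)
  refine ⟨min r (1 / 2), by positivity, fun p hp z hz => ?_⟩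
  by_cases hp2 : ‖p‖ ≤ ρ + 1 + Y
  · have := h p ⟨hp, hp2⟩ z hz
    rw [edist_nndist, ENNReal.coe_lt_coe] at this
    have h2 : (r : ℝ) < dist p z := by exact_mod_cast this
    rw [dist_comm, dist_eq_norm] at h2
    exact (min_le_left _ _).trans_lt h2
  · have h1 : ρ + 1 < |p.re| := by
      by_contra! h1
      exact hp2 ((Complex.norm_le_abs_re_add_abs_im p).trans (add_le_add h1 (him p hp)))
    have h2 := hρ z hz
    have h3 := Complex.abs_re_le_norm (z - p)
    rw [Complex.sub_re] at h3
    have h4 := abs_sub_abs_le_abs_sub p.re z.re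
    rw [abs_sub_comm] at h4
    have := min_le_right (r : ℝ) (1 / 2)
    linarith

end Contour

/-! ### Residues -/

/-- Near `p`, the function `f` is the sum of `r / (z - p)`, a derivative of a function holomorphic
off `p`, and a holomorphic function. -/
def HasRes (f : ℂ → ℂ) (p r : ℂ) : Prop :=
  ∃ G g : ℂ → ℂ, (∀ z, z ≠ p → DifferentiableAt ℂ G z) ∧ AnalyticAt ℂ g p ∧
    ∀ᶠ z in 𝓝[≠] p, f z = r * (z - p)⁻¹ + deriv G z + g z

theorem analyticAt_dslope {h : ℂ → ℂ} {p : ℂ} (hh : AnalyticAt ℂ h p) : AnalyticAt ℂ (dslope h p) p := by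
  obtain ⟨s, hs⟩ := hh
  exact ⟨_, hs.has_fpower_series_dslope_fslope⟩

theorem hasRes_of_mul_inv {f h : ℂ → ℂ} {p : ℂ} (hh : AnalyticAt ℂ h p)
    (hf : ∀ᶠ z in 𝓝[≠] p, f z = h z * (z - p)⁻¹) : HasRes f p (h p) := by
  refine ⟨fun _ => 0, dslope h p, fun z _ => by fun_prop, analyticAt_dslope hh, ?_⟩
  filter_upwards [hf, self_mem_nhdsWithin] with z hz hzp
  have hzp' : z - p ≠ 0 := sub_ne_zero.2 hzp
  rw [hz, dslope_of_ne _ hzp, slope_def_field, deriv_const]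
  field_simp
  ring

/-- The leading Laurent term is split off with `dslope`. For order at least two it is a derivative
and goes into `G`, so the induction ends with a simple pole. -/
theorem exists_hasRes_of_mul_inv_pow (n : ℕ) {f h : ℂ → ℂ} {p : ℂ} (hh : AnalyticAt ℂ h p)
    (hf : ∀ᶠ z in 𝓝[≠] p, f z = h z * ((z - p) ^ n)⁻¹) : ∃ r, HasRes f p r := by
  induction n generalizing f h with
  | zero =>
    refine ⟨0, fun _ => 0, h, fun z _ => by fun_prop, hh, ?_⟩
    filter_upwards [hf] with z hz
    simpa using hz
  | succ n ih =>
    rcases Nat.eq_zero_or_pos n with rfl | hn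
    · exact ⟨_, hasRes_of_mul_inv hh (by simpa using hf)⟩
    · obtain ⟨r, G, g, hG, hg, hfg⟩ := ih (f := fun z => dslope h p z * ((z - p) ^ n)⁻¹)
        (analyticAt_dslope hh) (Eventually.of_forall fun z => rfl)
      have hd : ∀ z, z ≠ p → HasDerivAt (fun z => -(h p / n) * ((z - p) ^ n)⁻¹)
          (h p * ((z - p) ^ (n + 1))⁻¹) z := by
        intro z hz
        have hz' : z - p ≠ 0 := sub_ne_zero.2 hz
        have hnc : (n : ℂ) ≠ 0 := Nat.cast_ne_zero.2 hn.ne'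
        have h1 := ((((hasDerivAt_id z).sub_const p).pow n).inv (pow_ne_zero n hz')).const_mul (-(h p / n))
        refine h1.congr_deriv ?_
        obtain ⟨m, rfl⟩ : ∃ m, n = m + 1 := ⟨n - 1, by omega⟩
        simp only [id, Nat.add_sub_cancel, Pi.pow_apply]
        field_simp
        ring
      refine ⟨r, fun z => G z + -(h p / n) * ((z - p) ^ n)⁻¹, g,
        fun z hz => (hG z hz).add (hd z hz).differentiableAt, hg, ?_⟩
      filter_upwards [hf, hfg, self_mem_nhdsWithin] with z hz hz2 hzp
      have hzp' : z - p ≠ 0 := sub_ne_zero.2 hzp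
      have e : deriv (fun z => G z + -(h p / n) * ((z - p) ^ n)⁻¹) z
          = deriv G z + h p * ((z - p) ^ (n + 1))⁻¹ := by
        have := ((hG z hzp).hasDerivAt.add (hd z hzp)).deriv
        exact this
      have h3 : h z * ((z - p) ^ (n + 1))⁻¹
          = dslope h p z * ((z - p) ^ n)⁻¹ + h p * ((z - p) ^ (n + 1))⁻¹ := by
        rw [dslope_of_ne _ hzp, slope_def_field]
        field_simp
        ring
      rw [hz, e, h3, hz2]
      ring

theorem _root_.MeromorphicAt.exists_hasRes {f : ℂ → ℂ} {p : ℂ} (hf : MeromorphicAt f p) :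
    ∃ r, HasRes f p r := by
  obtain ⟨n, hn⟩ := hf
  refine exists_hasRes_of_mul_inv_pow n hn ?_
  filter_upwards [self_mem_nhdsWithin] with z hz
  have : z - p ≠ 0 := sub_ne_zero.2 hz
  rw [smul_eq_mul]
  field_simp

theorem HasRes.add_analyticAt {f h : ℂ → ℂ} {p r : ℂ} (hf : HasRes f p r) (hh : AnalyticAt ℂ h p) :
    HasRes (fun z => f z + h z) p r := by
  obtain ⟨G, g, hG, hg, hfg⟩ := hf
  refine ⟨G, fun z => g z + h z, hG, hg.add hh, ?_⟩
  filter_upwards [hfg] with z hz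
  rw [hz]; ring

theorem HasRes.congr {f h : ℂ → ℂ} {p r : ℂ} (hf : HasRes f p r) (hh : ∀ᶠ z in 𝓝[≠] p, f z = h z) :
    HasRes h p r := by
  obtain ⟨G, g, hG, hg, hfg⟩ := hf
  refine ⟨G, g, hG, hg, ?_⟩
  filter_upwards [hfg, hh] with z hz hz2
  rw [← hz2, hz]

/-- The residue theorem for two paths with the same end points in a disc. -/
theorem polyIntegral_sub_eq_sum_residues {v w : ℂ} {m₁ m₂ : List ℂ} {ρ : ℝ}
    (h₁ : polySupport (v :: (m₁ ++ [w])) ⊆ Metric.ball 0 ρ)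
    (h₂ : polySupport (v :: (m₂ ++ [w])) ⊆ Metric.ball 0 ρ) (r : ℂ → ℂ) (S : Finset ℂ)
    (hS₁ : ∀ p ∈ S, p ∉ polySupport (v :: (m₁ ++ [w])))
    (hS₂ : ∀ p ∈ S, p ∉ polySupport (v :: (m₂ ++ [w]))) (f : ℂ → ℂ)
    (hf : ∀ z ∈ Metric.ball (0 : ℂ) ρ, z ∉ S → DifferentiableAt ℂ f z)
    (hr : ∀ p ∈ S, HasRes f p (r p)) :
    polyIntegral f (v :: (m₁ ++ [w])) - polyIntegral f (v :: (m₂ ++ [w]))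
      = ∑ p ∈ S, r p * (polyIntegral (fun z => (z - p)⁻¹) (v :: (m₁ ++ [w]))
          - polyIntegral (fun z => (z - p)⁻¹) (v :: (m₂ ++ [w]))) := by
  induction S using Finset.induction_on generalizing f with
  | empty =>
    have hd : DifferentiableOn ℂ f (Metric.ball 0 ρ) := fun z hz =>
      (hf z hz (Finset.notMem_empty z)).differentiableWithinAt
    obtain ⟨F, hF⟩ := hd.isExactOn_ball
    rw [polyIntegral_eq_sub (G := F) v m₁ w (hd.continuousOn.mono h₁) (fun z hz => hF z (h₁ hz)),
      polyIntegral_eq_sub (G := F) v m₂ w (hd.continuousOn.mono h₂) (fun z hz => hF z (h₂ hz))]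
    simp
  | insert p S hpS ih =>
    have hp₁ := hS₁ p (Finset.mem_insert_self p S)
    have hp₂ := hS₂ p (Finset.mem_insert_self p S)
    obtain ⟨G, g, hG, hg, hfg⟩ := hr p (Finset.mem_insert_self p S)
    have hGo : DifferentiableOn ℂ G {p}ᶜ := fun z hz => (hG z hz).differentiableWithinAt
    have hGa : ∀ z, z ≠ p → AnalyticAt ℂ (deriv G) z := fun z hz =>
      (hGo.analyticAt (isOpen_compl_singleton.mem_nhds hz)).deriv
    have hia : ∀ z, z ≠ p → AnalyticAt ℂ (fun z => -(r p * (z - p)⁻¹ + deriv G z)) z := by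
      intro z hz
      have : AnalyticAt ℂ (fun z : ℂ => (z - p)⁻¹) z :=
        AnalyticAt.inv (by fun_prop) (sub_ne_zero.2 hz)
      exact ((analyticAt_const.mul this).add (hGa z hz)).neg
    -- Subtracting the singular part at `p` and filling in the value `g p` removes this singularity,
    -- so `f₁` falls under the induction hypothesis with one point fewer.
    set f₁ : ℂ → ℂ := Function.update (fun z => f z + -(r p * (z - p)⁻¹ + deriv G z)) p (g p) with hf₁
    have hf₁ne : ∀ z, z ≠ p → f₁ =ᶠ[𝓝 z] fun z => f z + -(r p * (z - p)⁻¹ + deriv G z) := by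
      intro z hz
      filter_upwards [isOpen_compl_singleton.mem_nhds hz] with y hy
      rw [hf₁, Function.update_of_ne hy]
    have hf₁p : f₁ =ᶠ[𝓝 p] g := by
      refine eventuallyEq_nhds_of_eventuallyEq_nhdsNE ?_ (by rw [hf₁, Function.update_self])
      filter_upwards [hfg, self_mem_nhdsWithin] with z hz hzp
      rw [hf₁, Function.update_of_ne hzp, hz]
      ring
    have hd₁ : ∀ z ∈ Metric.ball (0 : ℂ) ρ, z ∉ S → DifferentiableAt ℂ f₁ z := by
      intro z hz hzS
      rcases eq_or_ne z p with rfl | hzp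
      · exact hg.differentiableAt.congr_of_eventuallyEq hf₁p
      · refine DifferentiableAt.congr_of_eventuallyEq ?_ (hf₁ne z hzp)
        exact (hf z hz (by simp [hzp, hzS])).add (hia z hzp).differentiableAt
    have hr₁ : ∀ q ∈ S, HasRes f₁ q (r q) := by
      intro q hq
      have hqp : q ≠ p := fun h => hpS (h ▸ hq)
      refine ((hr q (Finset.mem_insert_of_mem hq)).add_analyticAt (hia q hqp)).congr ?_
      filter_upwards [(hf₁ne q hqp).filter_mono nhdsWithin_le_nhds] with z hz
      exact hz.symm
    have key : ∀ m : List ℂ, polySupport (v :: (m ++ [w])) ⊆ Metric.ball 0 ρ →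
        (∀ q ∈ insert p S, q ∉ polySupport (v :: (m ++ [w]))) →
        polyIntegral f (v :: (m ++ [w])) = polyIntegral f₁ (v :: (m ++ [w]))
          + r p * polyIntegral (fun z => (z - p)⁻¹) (v :: (m ++ [w])) + (G w - G v) := by
      intro m hm hSm
      have hpm := hSm p (Finset.mem_insert_self p S)
      have c1 : ContinuousOn f₁ (polySupport (v :: (m ++ [w]))) := fun z hz =>
        (hd₁ z (hm hz) fun h => hSm z (Finset.mem_insert_of_mem h) hz).continuousAt.continuousWithinAt
      have c2 : ContinuousOn (fun z => r p * (z - p)⁻¹) (polySupport (v :: (m ++ [w]))) :=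
        continuousOn_const.mul (Contour.continuousOn_inv_sub hpm)
      have c3 : ContinuousOn (deriv G) (polySupport (v :: (m ++ [w]))) := fun z hz =>
        (hGa z fun h => hpm (h ▸ hz)).continuousAt.continuousWithinAt
      have c12 : ContinuousOn (fun z => f₁ z + r p * (z - p)⁻¹) (polySupport (v :: (m ++ [w]))) :=
        c1.add c2
      rw [← polyIntegral_eq_sub v m w c3 fun z hz => (hG z fun h => hpm (h ▸ hz)).hasDerivAt,
        ← polyIntegral_const_mul, ← polyIntegral_add _ c1 c2, ← polyIntegral_add _ c12 c3]
      refine polyIntegral_congr _ fun z hz => ?_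
      have hzp : z ≠ p := fun h => hpm (h ▸ hz)
      simp only [hf₁]
      rw [Function.update_of_ne hzp]
      ring
    have hrec := ih (fun q hq => hS₁ q (Finset.mem_insert_of_mem hq))
      (fun q hq => hS₂ q (Finset.mem_insert_of_mem hq)) f₁ hd₁ hr₁
    rw [Finset.sum_insert hpS, ← hrec, key m₁ h₁ hS₁, key m₂ h₂ hS₂]
    ring

/-! ### The sets of poles -/

theorem locFinite_latNonpos (hω : 0 < ω) : LocFinite (latNonpos ω) := by
  intro ρ
  refine ((Set.finite_Iic ⌊ρ⌋₊).prod (Set.finite_Iic ⌊ρ * ω⌋₊)).image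
    (fun p : ℕ × ℕ => (-(p.1 + p.2 / ω) : ℂ)) |>.subset ?_
  rintro z ⟨⟨j, k, rfl⟩, hz⟩
  have e : (-(j + k / ω) : ℂ) = ((-(j + k / ω) : ℝ) : ℂ) := by push_cast; ring
  have h0 : (0 : ℝ) ≤ j + k / ω := by positivity
  have hz' : (j : ℝ) + k / ω ≤ ρ := by
    rw [Set.mem_ofPred_eq, e, Complex.norm_real, norm_neg, Real.norm_of_nonneg h0] at hz
    exact hz
  have hk0 : (0 : ℝ) ≤ k / ω := by positivity
  refine ⟨(j, k), ⟨?_, ?_⟩, rfl⟩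
  · exact Nat.le_floor (by linarith)
  · refine Nat.le_floor ?_
    rw [← div_le_iff₀ hω]
    linarith [(Nat.cast_nonneg j : (0 : ℝ) ≤ j)]

theorem LocFinite.preimage_add {B : Set ℂ} (hB : LocFinite B) (a : ℂ) : LocFinite {p | p + a ∈ B} := by
  intro ρ
  refine ((hB (ρ + ‖a‖)).image fun z => z - a).subset ?_
  rintro p ⟨hp, hp'⟩
  refine ⟨p + a, ⟨hp, ?_⟩, by ring⟩
  have : ‖p‖ ≤ ρ := hp'
  exact (norm_add_le _ _).trans (by linarith)

theorem LocFinite.preimage_neg {B : Set ℂ} (hB : LocFinite B) : LocFinite {p | -p ∈ B} := by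
  intro ρ
  refine ((hB ρ).image fun z => -z).subset ?_
  rintro p ⟨hp, hp'⟩
  exact ⟨-p, ⟨hp, by rw [Set.mem_ofPred_eq, norm_neg]; exact hp'⟩, by ring⟩

theorem LocFinite.union {A B : Set ℂ} (hA : LocFinite A) (hB : LocFinite B) : LocFinite (A ∪ B) :=
  fun ρ => by
    rw [Set.union_inter_distrib_right]
    exact (hA ρ).union (hB ρ)

theorem LocFinite.mono {A B : Set ℂ} (hB : LocFinite B) (h : A ⊆ B) : LocFinite A :=
  fun ρ => (hB ρ).subset (Set.inter_subset_inter_left _ h)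

theorem locFinite_latPos (hω : 0 < ω) : LocFinite (latPos ω) := by
  refine (((locFinite_latNonpos hω).preimage_neg).preimage_add (-(1 + 1 / ω))).mono fun z hz => ?_
  rw [Set.mem_ofPred_eq, Set.mem_ofPred_eq, neg_mem_latNonpos_iff]
  convert hz using 1
  ring

theorem LocFinite.eventually_notMem {B : Set ℂ} (hB : LocFinite B) (p : ℂ) :
    ∀ᶠ z in 𝓝[≠] p, z ∉ B := by
  obtain ⟨δ, hδ, h⟩ := hB.exists_pos_lt_norm_sub p
  filter_upwards [self_mem_nhdsWithin, nhdsWithin_le_nhds (Metric.ball_mem_nhds p hδ)] with z hz hz' hzB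
  rw [Metric.mem_ball, dist_eq_norm] at hz'
  exact absurd hz' (not_lt.2 (h z hzB hz).le)

theorem LocFinite.eventually_notMem_of_notMem {B : Set ℂ} (hB : LocFinite B) {p : ℂ} (hp : p ∉ B) :
    ∀ᶠ z in 𝓝 p, z ∉ B := by
  have := hB.eventually_notMem p
  rw [eventually_nhdsWithin_iff] at this
  filter_upwards [this] with z hz
  by_cases h : z = p
  · rwa [h]
  · exact hz h

theorem locFinite_leftPoles (hω : 0 < ω) (α β : ℂ) : LocFinite (leftPoles ω α β) :=
  ((locFinite_latNonpos hω).preimage_add α).union ((locFinite_latNonpos hω).preimage_add β)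

theorem locFinite_rightPoles (hω : 0 < ω) (γ : ℂ) : LocFinite (rightPoles ω γ) :=
  ((locFinite_latNonpos hω).preimage_neg).union ((locFinite_latPos hω).preimage_add γ)

theorem re_nonpos_of_mem_latNonpos (hω : 0 < ω) {x : ℂ} (hx : x ∈ latNonpos ω) : x.re ≤ 0 := by
  obtain ⟨j, k, rfl⟩ := hx
  have h1 : (-(j + k / ω) : ℂ) = ((-(j + k / ω) : ℝ) : ℂ) := by push_cast; ring
  rw [h1, Complex.ofReal_re]
  have : (0 : ℝ) ≤ j + k / ω := by positivity
  linarith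

theorem le_re_of_mem_latPos (hω : 0 < ω) {x : ℂ} (hx : x ∈ latPos ω) : 1 + 1 / ω ≤ x.re := by
  by_contra! h
  exact notMem_latPos_of_re_lt hω h hx

theorem abs_im_le_of_mem_leftPoles {α β p : ℂ} (hp : p ∈ leftPoles ω α β) : |p.im| ≤ |α.im| + |β.im| := by
  rcases hp with h | h
  · have := im_eq_zero_of_mem_latNonpos h
    rw [Complex.add_im] at this
    rw [show p.im = -α.im by linarith, abs_neg]
    linarith [abs_nonneg β.im]
  · have := im_eq_zero_of_mem_latNonpos h
    rw [Complex.add_im] at this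
    rw [show p.im = -β.im by linarith, abs_neg]
    linarith [abs_nonneg α.im]

theorem re_le_of_mem_leftPoles (hω : 0 < ω) {α β p : ℂ} (hp : p ∈ leftPoles ω α β) :
    p.re ≤ |α.re| + |β.re| := by
  rcases hp with h | h
  · have := re_nonpos_of_mem_latNonpos hω h
    rw [Complex.add_re] at this
    linarith [abs_nonneg β.re, neg_abs_le α.re]
  · have := re_nonpos_of_mem_latNonpos hω h
    rw [Complex.add_re] at this
    linarith [abs_nonneg α.re, neg_abs_le β.re]

theorem abs_im_le_of_mem_rightPoles {γ p : ℂ} (hp : p ∈ rightPoles ω γ) : |p.im| ≤ |γ.im| := by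
  rcases hp with h | h
  · have := im_eq_zero_of_mem_latNonpos h
    rw [Complex.neg_im, neg_eq_zero] at this
    rw [this, abs_zero]
    exact abs_nonneg _
  · have := im_eq_zero_of_mem_latPos h
    rw [Complex.add_im] at this
    rw [show p.im = -γ.im by linarith, abs_neg]

theorem neg_abs_re_le_of_mem_rightPoles (hω : 0 < ω) {γ p : ℂ} (hp : p ∈ rightPoles ω γ) :
    -|γ.re| ≤ p.re := by
  rcases hp with h | h
  · have := re_nonpos_of_mem_latNonpos hω h
    rw [Complex.neg_re] at this
    linarith [abs_nonneg γ.re]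
  · have := le_re_of_mem_latPos hω h
    rw [Complex.add_re] at this
    linarith [one_div_pos.2 hω, le_abs_self γ.re]

theorem mem_latNonpos_of_add_of_neg {p a : ℂ} (h1 : p + a ∈ latNonpos ω) (h2 : -p ∈ latNonpos ω) :
    a ∈ latNonpos ω := by
  obtain ⟨j, k, h1⟩ := h1
  obtain ⟨j', k', h2⟩ := h2
  exact ⟨j + j', k + k', by push_cast; linear_combination h1 + h2⟩

theorem sub_mem_latPos_of_add_of_add {p a c : ℂ} (h1 : p + a ∈ latNonpos ω) (h2 : p + c ∈ latPos ω) :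
    c - a ∈ latPos ω := by
  obtain ⟨j, k, h1⟩ := h1
  obtain ⟨j', k', h2⟩ := h2
  exact ⟨j + j', k + k', by push_cast; linear_combination h2 - h1⟩

theorem exists_contour_of_disjoint (hω : 0 < ω) {α β γ : ℂ} {Rt : Set ℂ} (hRt : Rt ⊆ rightPoles ω γ)
    (h : Disjoint (leftPoles ω α β) Rt) :
    ∃ C : Contour, (∀ p ∈ leftPoles ω α β, C.IsLeft p) ∧ ∀ p ∈ Rt, C.IsRight p := by
  refine exists_contour_separating (locFinite_leftPoles hω α β) ((locFinite_rightPoles hω γ).mono hRt) h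
    (Y := max (|α.im| + |β.im|) |γ.im|) (A := max (|α.re| + |β.re|) |γ.re|)
    (fun b hb => le_max_of_le_left (abs_im_le_of_mem_leftPoles hb))
    (fun b hb => le_max_of_le_right (abs_im_le_of_mem_rightPoles (hRt hb)))
    (fun b hb => le_max_of_le_left (re_le_of_mem_leftPoles hω hb)) fun b hb => ?_
  have := neg_abs_re_le_of_mem_rightPoles hω (hRt hb)
  linarith [le_max_right (|α.re| + |β.re|) |γ.re|]

theorem disjoint_leftPoles_rightPoles {α β γ : ℂ} (hα : α ∉ latNonpos ω) (hβ : β ∉ latNonpos ω)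
    (hγα : γ - α ∉ latPos ω) (hγβ : γ - β ∉ latPos ω) :
    Disjoint (leftPoles ω α β) (rightPoles ω γ) := by
  rw [Set.disjoint_left]
  rintro p (h1 | h1) (h2 | h2)
  · exact hα (mem_latNonpos_of_add_of_neg h1 h2)
  · exact hγα (sub_mem_latPos_of_add_of_add h1 h2)
  · exact hβ (mem_latNonpos_of_add_of_neg h1 h2)
  · exact hγβ (sub_mem_latPos_of_add_of_add h1 h2)

/-- The points `0, 1, …, n`. -/
def natsUpTo (n : ℕ) : Set ℂ := {z | ∃ k : ℕ, k ≤ n ∧ z = k}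

theorem natsUpTo_subset_leftPoles (ω : ℝ) (n : ℕ) (β : ℂ) : natsUpTo n ⊆ leftPoles ω (-n) β := by
  rintro z ⟨k, hk, rfl⟩
  refine Or.inl ⟨n - k, 0, ?_⟩
  rw [Nat.cast_sub hk]
  push_cast
  ring

theorem natsUpTo_subset_rightPoles (ω : ℝ) (n : ℕ) (γ : ℂ) : natsUpTo n ⊆ rightPoles ω γ := by
  rintro z ⟨k, _, rfl⟩
  exact Or.inl ⟨k, 0, by push_cast; ring⟩

/-- Adding the two lattice relations gives `k + k' = (n - j - j')ω`. Irrationality forces both sides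
to vanish, so `p = j'` with `j' ≤ n`. -/
theorem mem_natsUpTo_of_sub_of_neg (hω : 0 < ω) (hirr : Irrational ω) {n : ℕ} {p : ℂ}
    (h1 : p + -n ∈ latNonpos ω) (h2 : -p ∈ latNonpos ω) : p ∈ natsUpTo n := by
  obtain ⟨j, k, h1⟩ := h1
  obtain ⟨j', k', h2⟩ := h2
  have hωc : (ω : ℂ) ≠ 0 := Complex.ofReal_ne_zero.2 hω.ne'
  have h3 : ((k + k' : ℕ) : ℂ) = ((n : ℤ) - j - j' : ℤ) * ω := by
    push_cast
    have : (k / ω + k' / ω : ℂ) = n - j - j' := by linear_combination h1 + h2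
    rw [← this]
    field_simp
  have h4 : ((k + k' : ℕ) : ℝ) = ((n : ℤ) - j - j' : ℤ) * ω := by exact_mod_cast h3
  have h5 : (n : ℤ) - j - j' = 0 := by
    by_contra h
    apply (hirr.intCast_mul h).ne_nat (k + k')
    exact h4.symm
  rw [h5] at h4
  have hk : k' = 0 := by
    have : k + k' = 0 := by exact_mod_cast (by simpa using h4 : ((k + k' : ℕ) : ℝ) = 0)
    omega
  subst hk
  exact ⟨j', by omega, by push_cast at h2; linear_combination -h2⟩

theorem disjoint_leftPoles_rightPoles_diff (hω : 0 < ω) (hirr : Irrational ω) {n : ℕ} {β γ : ℂ}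
    (hβ : β ∉ latNonpos ω) (hγn : γ + n ∉ latPos ω) (hγβ : γ - β ∉ latPos ω) :
    Disjoint (leftPoles ω (-n) β) (rightPoles ω γ \ natsUpTo n) := by
  rw [Set.disjoint_left]
  rintro p (h1 | h1) ⟨h2 | h2, h3⟩
  · exact h3 (mem_natsUpTo_of_sub_of_neg hω hirr h1 h2)
  · exact hγn (by simpa using sub_mem_latPos_of_add_of_add h1 h2)
  · exact hβ (mem_latNonpos_of_add_of_neg h1 h2)
  · exact hγβ (sub_mem_latPos_of_add_of_add h1 h2)

/-! ### Shifts by natural numbers -/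

theorem qPoch_succ (q a : ℂ) (k : ℕ) : qPoch q a (k + 1) = qPoch q a k * (1 - a * q ^ k) :=
  Finset.prod_range_succ _ _

theorem brk_eq_mul_qPoch (hω : 0 < ω) {x : ℂ} (k : ℕ) (hx : x + k ∉ latPos ω) :
    brk ω x = brk ω (x + k) * qPoch (qpow ω 1) (qpow ω x) k := by
  induction k with
  | zero => simp [qPoch]
  | succ k ih =>
    push_cast at hx
    rw [← add_assoc] at hx
    have h1 : brk ω (x + k) = brk ω (x + k + 1) * (1 - qpow ω (x + k)) := by
      rcases le_or_gt (x + k).re 0 with h | h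
      · exact brk_of_re_nonpos h
      · rw [brk_add_one_of_re_pos h,
          div_mul_cancel₀ _ (one_sub_qpow_ne_zero_of_notMem_latPos hω hx h)]
    rw [ih (notMem_latPos_of_add_one hx), h1, qPoch_succ, qpow_add, qpow_natCast]
    push_cast
    rw [add_assoc]
    ring

theorem inv_brk_add_natCast (hω : 0 < ω) {x : ℂ} (hx : x ∉ latNonpos ω) (k : ℕ) :
    x + k ∉ latNonpos ω ∧ (brk ω (x + k))⁻¹ = (brk ω x)⁻¹ * qPoch (qpow ω 1) (qpow ω x) k := by
  induction k with
  | zero => simpa [qPoch] using hx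
  | succ k ih =>
    push_cast
    rw [← add_assoc]
    refine ⟨add_one_notMem_latNonpos ih.1, ?_⟩
    have h1 : (brk ω (x + k + 1))⁻¹ = (brk ω (x + k))⁻¹ * (1 - qpow ω (x + k)) := by
      rcases le_or_gt (x + k).re 0 with h | h
      · rw [brk_of_re_nonpos h, mul_inv, inv_mul_cancel_right₀]
        exact one_sub_qpow_ne_zero_of_notMem_latNonpos hω ih.1 h
      · rw [brk_add_one_of_re_pos h, inv_div]
        ring
    rw [h1, ih.2, qPoch_succ, qpow_add, qpow_natCast]
    ring

theorem brk_add_natCast_of_re_pos {x : ℂ} (hx : 0 < x.re) (k : ℕ) :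
    brk ω (x + k) = brk ω x / qPoch (qpow ω 1) (qpow ω x) k := by
  induction k with
  | zero => simp [qPoch]
  | succ k ih =>
    push_cast
    rw [← add_assoc, brk_add_one_of_re_pos (by
      rw [Complex.add_re, Complex.natCast_re]; positivity), ih, qPoch_succ, qpow_add, qpow_natCast,
      div_div]

theorem qPoch_ne_zero_of_le {q a : ℂ} {k n : ℕ} (hk : k ≤ n) (h : qPoch q a n ≠ 0) : qPoch q a k ≠ 0 := by
  rw [qPoch, Finset.prod_ne_zero_iff] at h ⊢
  exact fun j hj => h j (Finset.mem_range.2 ((Finset.mem_range.1 hj).trans_le hk))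

theorem qPoch_qpow_neg_eq_zero (ω : ℝ) {n k : ℕ} (h : n < k) :
    qPoch (qpow ω 1) (qpow ω (-n)) k = 0 := by
  refine Finset.prod_eq_zero (Finset.mem_range.2 h) ?_
  rw [← qpow_natCast, ← qpow_add, neg_add_cancel, qpow_zero, sub_self]

theorem qPoch_self_ne_zero (hω : 0 < ω) (hirr : Irrational ω) (k : ℕ) :
    qPoch (qpow ω 1) (qpow ω 1) k ≠ 0 := by
  rw [qPoch, Finset.prod_ne_zero_iff]
  intro j _
  rw [← pow_succ', ← qpow_natCast, Ne, one_sub_qpow_eq_zero_iff hω]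
  rintro ⟨p, hp⟩
  have hωc : (ω : ℂ) ≠ 0 := Complex.ofReal_ne_zero.2 hω.ne'
  rw [eq_div_iff hωc] at hp
  have h2 : ((j + 1 : ℕ) : ℝ) * ω = p := by exact_mod_cast hp
  exact (hirr.natCast_mul (Nat.succ_ne_zero j)).ne_int p h2

/-- This zero of the prefactor annihilates the integral over the unpinched contour in the limit. -/
theorem brk_neg_natCast (hω : 0 < ω) (n : ℕ) : brk ω (-n) = 0 := by
  rw [brk_eq_mul_qPoch hω (n + 1), qPoch_qpow_neg_eq_zero ω (Nat.lt_succ_self n), mul_zero]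
  refine notMem_latPos_of_re_lt hω ?_
  have : (-(n : ℂ) + ((n + 1 : ℕ) : ℂ)) = 1 := by push_cast; ring
  rw [this, Complex.one_re]
  linarith [one_div_pos.2 hω]

/-- If `γ + k = (j+1) + (m+1)/ω` with `j < k`, then `q^{γ+i} = 1` for `i = k - j - 1 < n`, a
vanishing factor of `(q^γ; q)_n`. If `j ≥ k`, then `γ` itself is a pole. -/
theorem Admissible.gamma_add_notMem_latPos {n : ℕ} {β γ : ℂ} (hω : 0 < ω) (h : Admissible ω n β γ) {k : ℕ}
    (hk : k ≤ n) : γ + k ∉ latPos ω := by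
  rintro ⟨j, m, hjm⟩
  rcases lt_or_ge j k with hjk | hjk
  · obtain ⟨i, rfl⟩ : ∃ i, k = j + 1 + i := ⟨k - (j + 1), by omega⟩
    refine qPoch_ne_zero_of_le (k := i + 1) (by omega) h.denom_ne_zero ?_
    refine Finset.prod_eq_zero (Finset.mem_range.2 (Nat.lt_succ_self i)) ?_
    rw [← qpow_natCast, ← qpow_add, one_sub_qpow_eq_zero_iff hω]
    exact ⟨m + 1, by push_cast at hjm ⊢; linear_combination hjm⟩
  · exact h.gamma_pos ⟨j - k, m, by rw [Nat.cast_sub hjk]; linear_combination hjm⟩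

/-! ### The residues at the points `0, 1, …, n` -/

theorem analyticAt_brk (hω : 0 < ω) {x : ℂ} (hx : x ∉ latPos ω) : AnalyticAt ℂ (brk ω) x := by
  rw [Complex.analyticAt_iff_eventually_differentiableAt]
  filter_upwards [(locFinite_latPos hω).eventually_notMem_of_notMem hx] with z hz
  exact differentiableAt_brk hω hz

theorem analyticAt_inv_brk (hω : 0 < ω) {x : ℂ} (hx : x ∉ latNonpos ω) :
    AnalyticAt ℂ (fun z => (brk ω z)⁻¹) x := by
  rw [Complex.analyticAt_iff_eventually_differentiableAt]
  filter_upwards [(locFinite_latNonpos hω).eventually_notMem_of_notMem hx] with z hz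
  exact differentiableAt_inv_brk hω hz

theorem hasDerivAt_one_sub_qpow (ω : ℝ) (p : ℂ) :
    HasDerivAt (fun z => 1 - qpow ω (z - p)) (-(2 * Real.pi * Complex.I * ω)) p := by
  have h := ((((hasDerivAt_id p).sub_const p).const_mul (2 * Real.pi * Complex.I * ω)).cexp).const_sub 1
  simpa [qpow] using h

/-- The residue of the integrand at `z = k`. -/
noncomputable def integrandRes (ω : ℝ) (α β γ x : ℂ) (k : ℕ) : ℂ :=
  qpow ω (x * k) * brk ω (k + γ) * ((brk ω (k + α))⁻¹ * (brk ω (k + β))⁻¹)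
    * (brk ω (1 / ω) * (qPoch (qpow ω 1) (qpow ω 1) k)⁻¹ * (-(2 * Real.pi * Complex.I * ω))⁻¹)

/-- The pole comes from `⟨z + 1 + 1/ω⟩ = ⟨z - k + 1/ω⟩ / (q^{z-k}; q)_{k+1}`. Only the factor `1 -
q^{z-k} = (z - k) u(z)` vanishes at `z = k`, since `(q; q)_k ≠ 0` for irrational `ω`. So the pole is
at most simple and the residue is read off from the cofactor. -/
theorem hasRes_integrand (hω : 0 < ω) (hirr : Irrational ω) {α β γ : ℂ} (x : ℂ) {k : ℕ}
    (hγ : γ + k ∉ latPos ω) (hα : α ∉ latNonpos ω) (hβ : β ∉ latNonpos ω) :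
    HasRes (integrand ω α β γ x) k (integrandRes ω α β γ x k) := by
  have hωc : (ω : ℂ) ≠ 0 := Complex.ofReal_ne_zero.2 hω.ne'
  set u : ℂ → ℂ := dslope (fun z => 1 - qpow ω (z - k)) k with hu
  have hu_an : AnalyticAt ℂ u k := by
    refine analyticAt_dslope (Differentiable.analyticAt ?_ _)
    have := differentiable_qpow ω
    fun_prop
  have hu_k : u k = -(2 * Real.pi * Complex.I * ω) := by
    rw [hu, dslope_same, (hasDerivAt_one_sub_qpow ω k).deriv]
  have hu_ne : u k ≠ 0 := by
    rw [hu_k]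
    exact neg_ne_zero.2 (mul_ne_zero Complex.two_pi_I_ne_zero hωc)
  have hP_an : AnalyticAt ℂ (fun z : ℂ => qPoch (qpow ω 1) (qpow ω (z - k + 1)) k) k := by
    refine Differentiable.analyticAt ?_ _
    have := differentiable_qpow ω
    unfold qPoch
    fun_prop
  have hP_k : qPoch (qpow ω 1) (qpow ω ((k : ℂ) - k + 1)) k = qPoch (qpow ω 1) (qpow ω 1) k := by
    rw [sub_self, zero_add]
  have h1 : AnalyticAt ℂ (fun z : ℂ => brk ω (z - k + 1 / ω)) k := by
    refine AnalyticAt.fun_comp (g := brk ω) ?_ (by fun_prop)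
    refine analyticAt_brk hω (notMem_latPos_of_re_lt hω ?_)
    rw [sub_self, zero_add, show (1 / ω : ℂ) = ((1 / ω : ℝ) : ℂ) by push_cast; rfl, Complex.ofReal_re]
    linarith
  have h2 : AnalyticAt ℂ (fun z : ℂ => brk ω (z + γ)) k :=
    AnalyticAt.fun_comp (g := brk ω) (analyticAt_brk hω (by rwa [add_comm])) (by fun_prop)
  have h3 : ∀ a : ℂ, a ∉ latNonpos ω → AnalyticAt ℂ (fun z : ℂ => (brk ω (z + a))⁻¹) k := fun a ha =>
    AnalyticAt.fun_comp (g := fun z => (brk ω z)⁻¹)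
      (analyticAt_inv_brk hω (by rw [add_comm]; exact (inv_brk_add_natCast hω ha k).1)) (by fun_prop)
  have h4 : AnalyticAt ℂ (fun z : ℂ => qpow ω (x * z)) k :=
    ((differentiable_qpow ω).comp (differentiable_id.const_mul x)).analyticAt _
  have key := hasRes_of_mul_inv (f := integrand ω α β γ x) (((h4.mul h2).mul ((h3 α hα).mul (h3 β hβ))).mul
    ((h1.mul (hP_an.inv (by rw [hP_k]; exact qPoch_self_ne_zero hω hirr k))).mul (hu_an.inv hu_ne))) ?_
  · convert key using 1
    simp only [Pi.mul_apply, Pi.inv_apply, hu_k, sub_self, zero_add]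
    rfl
  · have hre : ∀ᶠ z : ℂ in 𝓝[≠] (k : ℂ), 0 < (z - k + 1 / ω).re := by
      refine nhdsWithin_le_nhds ?_
      have hc : ContinuousAt (fun z : ℂ => (z - k + 1 / ω).re) k := by fun_prop
      refine hc.eventually_const_lt ?_
      beta_reduce
      rw [sub_self, zero_add, show (1 / ω : ℂ) = ((1 / ω : ℝ) : ℂ) by push_cast; rfl, Complex.ofReal_re]
      exact one_div_pos.2 hω
    filter_upwards [hre, self_mem_nhdsWithin] with z hz hzk
    have e1 : brk ω (z + 1 + 1 / ω) = brk ω (z - k + 1 / ω) /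
        (qPoch (qpow ω 1) (qpow ω (z - k + 1)) k * ((z - k) * u z)) := by
      have e2 : z + 1 + 1 / ω = (z - k + 1 / ω) + ((k + 1 : ℕ) : ℂ) := by push_cast; ring
      rw [e2, brk_add_natCast_of_re_pos hz]
      congr 1
      rw [qpow_add, qpow_one_div hω, mul_one, qPoch, Finset.prod_range_succ', qPoch]
      congr 1
      · refine Finset.prod_congr rfl fun j _ => ?_
        rw [qpow_add, pow_succ]
        ring
      · have := sub_smul_dslope (fun z => 1 - qpow ω (z - k)) (k : ℂ) z
        rw [smul_eq_mul] at this
        rw [hu, this]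
        simp
    rw [integrand_eq_mul_inv, e1]
    simp only [Pi.mul_apply, Pi.inv_apply, div_eq_mul_inv, mul_inv]
    ring

/-- The shifts by `k` turn the ratios of brackets into `q`-Pochhammer symbols, and the factor `ω`
from the derivative of `1 - q^{z-k}` cancels against `⟨1/ω⟩ = ω⟨1⟩`. -/
theorem prefactor_mul_integrandRes (hω : 0 < ω) (hirr : Irrational ω) {α β γ : ℂ} (x : ℂ) {k : ℕ}
    (hα : α ∉ latNonpos ω) (hα' : α ∉ latPos ω) (hβ : β ∉ latNonpos ω) (hβ' : β ∉ latPos ω)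
    (hγ : γ ∉ latNonpos ω) (hγ' : γ ∉ latPos ω) (hγk : γ + k ∉ latPos ω) :
    brk ω α * brk ω β / (brk ω 1 * brk ω γ)
        * (integrandRes ω α β γ x k * (-(2 * Real.pi * Complex.I)))
      = qPoch (qpow ω 1) (qpow ω α) k * qPoch (qpow ω 1) (qpow ω β) k
        / (qPoch (qpow ω 1) (qpow ω 1) k * qPoch (qpow ω 1) (qpow ω γ) k) * qpow ω x ^ k := by
  have hωc : (ω : ℂ) ≠ 0 := Complex.ofReal_ne_zero.2 hω.ne'
  have hbα := brk_ne_zero hω hα' hα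
  have hbβ := brk_ne_zero hω hβ' hβ
  have hbγ := brk_ne_zero hω hγ' hγ
  have hb1 : brk ω 1 ≠ 0 := brk_ne_zero_of_re_mem hω (by simp) (by simpa using hω)
  have hq := qPoch_self_ne_zero hω hirr k
  have e := brk_eq_mul_qPoch hω k hγk
  rw [e] at hbγ ⊢
  have hg1 := left_ne_zero_of_mul hbγ
  have hg2 := right_ne_zero_of_mul hbγ
  unfold integrandRes
  rw [brk_one_div_eq hω, add_comm (k : ℂ) γ, add_comm (k : ℂ) α, add_comm (k : ℂ) β,
    (inv_brk_add_natCast hω hα k).2, (inv_brk_add_natCast hω hβ k).2, mul_comm x, qpow_nat_mul]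
  have hpi : (Real.pi : ℂ) ≠ 0 := Complex.ofReal_ne_zero.2 Real.pi_ne_zero
  have hI := Complex.I_ne_zero
  generalize brk ω (γ + k) = g at *
  field_simp

/-! ### Comparison of two contours -/

theorem integral_axis_of_decay {C : Contour} {f : ℂ → ℂ} (hf : ContinuousOn f C.support) {K T c : ℝ}
    (hc : 0 < c) (hT : C.R ≤ T)
    (hK : ∀ y : ℝ, T ≤ |y| → ‖f (y * Complex.I)‖ ≤ K * Real.exp (-c * |y|)) :
    C.integral f = (∫ y in Set.Iic (-T), f (y * Complex.I)) * Complex.I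
      + polyIntegral f (C.path T) + (∫ y in Set.Ioi T, f (y * Complex.I)) * Complex.I ∧
    ‖C.integral f‖ ≤ (∫ y in Set.Iic (-T), K * Real.exp (c * y)) + ‖polyIntegral f (C.path T)‖
      + ∫ y in Set.Ioi T, K * Real.exp (-c * y) := by
  have hT0 : 0 < T := C.R_pos.trans_le hT
  have hneg : ∀ y ∈ Set.Iic (-T), T ≤ |y| ∧ |y| = -y := fun y hy => by
    have hy' : y ≤ -T := hy
    rw [abs_of_nonpos (by linarith)]
    exact ⟨by linarith, rfl⟩
  have hpos : ∀ y ∈ Set.Ioi T, T ≤ |y| ∧ |y| = y := fun y hy => by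
    have hy' : T < y := hy
    rw [abs_of_nonneg (by linarith)]
    exact ⟨by linarith, rfl⟩
  have hcont : ∀ s : Set ℝ, (∀ y ∈ s, T ≤ |y|) → ContinuousOn (fun y : ℝ => f (y * Complex.I)) s :=
    fun s hs => hf.comp (by fun_prop) fun y hy => C.axis_mem_support (hT.trans (hs y hy))
  have hbneg : ∀ᵐ y : ℝ ∂volume.restrict (Set.Iic (-T)), ‖f (y * Complex.I)‖ ≤ K * Real.exp (c * y) := by
    filter_upwards [ae_restrict_mem measurableSet_Iic] with y hy
    have := hK y (hneg y hy).1
    rwa [(hneg y hy).2, neg_mul_neg] at this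
  have hbpos : ∀ᵐ y : ℝ ∂volume.restrict (Set.Ioi T), ‖f (y * Complex.I)‖ ≤ K * Real.exp (-c * y) := by
    filter_upwards [ae_restrict_mem measurableSet_Ioi] with y hy
    have := hK y (hpos y hy).1
    rwa [(hpos y hy).2] at this
  have hgneg : IntegrableOn (fun y => K * Real.exp (c * y)) (Set.Iic (-T)) :=
    (integrableOn_exp_mul_Iic hc _).const_mul K
  have hgpos : IntegrableOn (fun y => K * Real.exp (-c * y)) (Set.Ioi T) :=
    (integrableOn_exp_mul_Ioi (neg_neg_of_pos hc) _).const_mul K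
  have h := C.integral_eq hf hT
    (hgneg.mono' ((hcont _ fun y hy => (hneg y hy).1).aestronglyMeasurable measurableSet_Iic) hbneg)
    (hgpos.mono' ((hcont _ fun y hy => (hpos y hy).1).aestronglyMeasurable measurableSet_Ioi) hbpos)
  refine ⟨h, ?_⟩
  rw [h]
  refine (norm_add₃_le).trans ?_
  rw [norm_mul, norm_mul, Complex.norm_I, mul_one, mul_one]
  gcongr
  · exact norm_integral_le_of_norm_le hgneg hbneg
  · exact norm_integral_le_of_norm_le hgpos hbpos

theorem continuousOn_integrand_support (hω : 0 < ω) {α β γ : ℂ} (x : ℂ) {C : Contour}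
    (hL : ∀ p ∈ leftPoles ω α β, p ∉ C.support) (hR : ∀ p ∈ rightPoles ω γ, p ∉ C.support) :
    ContinuousOn (integrand ω α β γ x) C.support := fun z hz =>
  (differentiableAt_integrand hω x (fun h => hL z h hz) fun h =>
    hR z h hz).continuousAt.continuousWithinAt

/-- The tails on the imaginary axis coincide, so the residue theorem applies to the truncated paths.
The points `0, …, n` pass from the right of `C₁` to the left of `C₂`, with weight `-πi - πi`; every
other pole lies on the same side of both and has weight `0`. -/
theorem integral_integrand_eq_add_sum (hω : 0 < ω) (hirr : Irrational ω) {α β γ : ℂ} (x : ℂ) {n : ℕ}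
    (hα : α ∉ latNonpos ω) (hβ : β ∉ latNonpos ω) (hγ : ∀ k ≤ n, γ + (k : ℕ) ∉ latPos ω)
    {C₁ C₂ : Contour} (h₁ : IsSeparating ω α β γ C₁) (h₂L : ∀ p ∈ leftPoles ω α β, C₂.IsLeft p)
    (h₂R : ∀ p ∈ rightPoles ω γ \ natsUpTo n, C₂.IsRight p) (h₂n : ∀ p ∈ natsUpTo n, C₂.IsLeft p)
    {K T c : ℝ} (hc : 0 < c)
    (hK : ∀ y : ℝ, T ≤ |y| → ‖integrand ω α β γ x (y * Complex.I)‖ ≤ K * Real.exp (-c * |y|)) :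
    C₁.integral (integrand ω α β γ x) = C₂.integral (integrand ω α β γ x)
      + ∑ k ∈ Finset.range (n + 1), integrandRes ω α β γ x k * (-(2 * Real.pi * Complex.I)) := by
  classical
  set f := integrand ω α β γ x with hf
  have h₂r : ∀ p ∈ rightPoles ω γ, p ∉ C₂.support := fun p hp => by
    by_cases h : p ∈ natsUpTo n
    · exact (h₂n p h).1
    · exact (h₂R p ⟨hp, h⟩).1
  have hc₁ : ContinuousOn f C₁.support :=
    continuousOn_integrand_support hω x (fun p hp => (h₁.1 p hp).1) fun p hp => (h₁.2 p hp).1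
  have hc₂ : ContinuousOn f C₂.support :=
    continuousOn_integrand_support hω x (fun p hp => (h₂L p hp).1) h₂r
  set T' := max T (max C₁.R C₂.R) with hT'
  have hT₁ : C₁.R ≤ T' := (le_max_left _ _).trans (le_max_right _ _)
  have hT₂ : C₂.R ≤ T' := (le_max_right _ _).trans (le_max_right _ _)
  have hK' : ∀ y : ℝ, T' ≤ |y| → ‖f (y * Complex.I)‖ ≤ K * Real.exp (-c * |y|) := fun y hy =>
    hK y ((le_max_left _ _).trans hy)
  rw [(integral_axis_of_decay hc₁ hc hT₁ hK').1, (integral_axis_of_decay hc₂ hc hT₂ hK').1]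
  obtain ⟨ρ₁, hρ₁⟩ := (isCompact_polySupport (C₁.path T')).isBounded.subset_ball 0
  obtain ⟨ρ₂, hρ₂⟩ := (isCompact_polySupport (C₂.path T')).isBounded.subset_ball 0
  -- The radius is at least `n` so that all of `0, …, n` are among the poles collected in `S`.
  set ρ := max (max ρ₁ ρ₂) n with hρ
  have hb₁ : polySupport (C₁.path T') ⊆ Metric.ball 0 ρ :=
    hρ₁.trans (Metric.ball_subset_ball ((le_max_left _ _).trans (le_max_left _ _)))
  have hb₂ : polySupport (C₂.path T') ⊆ Metric.ball 0 ρ :=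
    hρ₂.trans (Metric.ball_subset_ball ((le_max_right _ _).trans (le_max_left _ _)))
  set S : Finset ℂ :=
    (((locFinite_leftPoles hω α β).union (locFinite_rightPoles hω γ)) ρ).toFinset with hS
  have hmem : ∀ p, p ∈ S ↔ (p ∈ leftPoles ω α β ∨ p ∈ rightPoles ω γ) ∧ ‖p‖ ≤ ρ := fun p => by
    rw [hS, Set.Finite.mem_toFinset]
    rfl
  -- Only the residues at `0, …, n` need to be known. Elsewhere existence suffices, because the
  -- residue is multiplied by zero.
  have hex : ∀ p : ℂ, ∃ r, HasRes f p r ∧ ∀ k ≤ n, p = (k : ℕ) → r = integrandRes ω α β γ x k := by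
    intro p
    by_cases h : ∃ k : ℕ, k ≤ n ∧ p = k
    · obtain ⟨k, hk, rfl⟩ := h
      refine ⟨_, hasRes_integrand hω hirr x (hγ k hk) hα hβ, fun j _ hj => ?_⟩
      rw [Nat.cast_injective hj]
    · obtain ⟨r, hr⟩ := (meromorphicAt_integrand hω α β γ x p).exists_hasRes
      exact ⟨r, hr, fun k hk hpk => absurd ⟨k, hk, hpk⟩ h⟩
  choose r hr hrk using hex
  have hS₁ : ∀ p ∈ S, p ∉ C₁.support := fun p hp => by
    rcases ((hmem p).1 hp).1 with h | h
    · exact (h₁.1 p h).1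
    · exact (h₁.2 p h).1
  have hS₂ : ∀ p ∈ S, p ∉ C₂.support := fun p hp => by
    rcases ((hmem p).1 hp).1 with h | h
    · exact (h₂L p h).1
    · exact h₂r p h
  have key := polyIntegral_sub_eq_sum_residues hb₁ hb₂ r S
    (fun p hp h => hS₁ p hp (C₁.polySupport_path_subset hT₁ h))
    (fun p hp h => hS₂ p hp (C₂.polySupport_path_subset hT₂ h)) f
    (fun z hz hzS => differentiableAt_integrand hω x
      (fun h => hzS ((hmem z).2 ⟨Or.inl h, (mem_ball_zero_iff.1 hz).le⟩))
      (fun h => hzS ((hmem z).2 ⟨Or.inr h, (mem_ball_zero_iff.1 hz).le⟩)))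
    (fun p _ => hr p)
  have hsum : ∑ p ∈ S, r p * (polyIntegral (fun z => (z - p)⁻¹) (C₁.path T')
        - polyIntegral (fun z => (z - p)⁻¹) (C₂.path T'))
      = ∑ k ∈ Finset.range (n + 1), integrandRes ω α β γ x k * (-(2 * Real.pi * Complex.I)) := by
    have himg : (Finset.range (n + 1)).image (fun k : ℕ => (k : ℂ)) ⊆ S := by
      intro p hp
      obtain ⟨k, hk, rfl⟩ := Finset.mem_image.1 hp
      have hk' : k ≤ n := Nat.lt_succ_iff.1 (Finset.mem_range.1 hk)
      refine (hmem _).2 ⟨Or.inr (natsUpTo_subset_rightPoles ω n γ ⟨k, hk', rfl⟩), ?_⟩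
      rw [Complex.norm_natCast]
      exact (Nat.cast_le.2 hk').trans (le_max_right _ _)
    rw [← Finset.sum_subset himg, Finset.sum_image fun a _ b _ h => Nat.cast_injective h]
    · refine Finset.sum_congr rfl fun k hk => ?_
      have hk' : k ≤ n := Nat.lt_succ_iff.1 (Finset.mem_range.1 hk)
      have hkn : (k : ℂ) ∈ natsUpTo n := ⟨k, hk', rfl⟩
      have hkR := h₁.2 _ (natsUpTo_subset_rightPoles ω n γ hkn)
      have hkL := h₂n _ hkn
      rw [hrk k k hk' rfl, Contour.polyIntegral_inv_path_sub_eq hkR.1 hkL.1 hkR.2 hkL.2 hT₁ hT₂]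
      ring
    · intro p hp hpn
      have hpn' : p ∉ natsUpTo n := by
        rintro ⟨k, hk, rfl⟩
        exact hpn (Finset.mem_image.2 ⟨k, Finset.mem_range.2 (Nat.lt_succ_iff.2 hk), rfl⟩)
      rcases ((hmem p).1 hp).1 with h | h
      · have a := h₁.1 p h
        have b := h₂L p h
        rw [Contour.polyIntegral_inv_path_sub_eq a.1 b.1 a.2 b.2 hT₁ hT₂, sub_self, mul_zero]
      · have a := h₁.2 p h
        have b := h₂R p ⟨h, hpn'⟩
        rw [Contour.polyIntegral_inv_path_sub_eq a.1 b.1 a.2 b.2 hT₁ hT₂, sub_self, mul_zero]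
  have key' : polyIntegral f (C₁.path T') - polyIntegral f (C₂.path T') = _ := key.trans hsum
  linear_combination key'

/-- The tails have a common exponential majorant, and on the bounded part the integrand is jointly
continuous in `(α, z)` over a compact set. -/
theorem exists_norm_integral_integrand_le (hω : 0 < ω) {β γ x : ℂ} {C : Contour} {A : Set ℂ}
    (hA : IsCompact A) (hL : ∀ α ∈ A, ∀ p ∈ leftPoles ω α β, p ∉ C.support)
    (hR : ∀ p ∈ rightPoles ω γ, p ∉ C.support) {K T c : ℝ} (hc : 0 < c)
    (hK : ∀ α ∈ A, ∀ y : ℝ, T ≤ |y| →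
      ‖integrand ω α β γ x (y * Complex.I)‖ ≤ K * Real.exp (-c * |y|)) :
    ∃ M, ∀ α ∈ A, ‖C.integral (integrand ω α β γ x)‖ ≤ M := by
  set T' := max T C.R
  obtain ⟨a, ha, hpoly⟩ := exists_norm_polyIntegral_le (C.path T')
  have hcont : ContinuousOn (fun p : ℂ × ℂ => integrand ω p.1 β γ x p.2)
      (A ×ˢ polySupport (C.path T')) := by
    rintro ⟨α, z⟩ ⟨hα, hz⟩
    have hz' := C.polySupport_path_subset (le_max_right T C.R) hz
    exact (continuousAt_integrand hω x (fun h => hL α hα z h hz')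
      fun h => hR z h hz').continuousWithinAt
  obtain ⟨B, hB⟩ := (hA.prod (isCompact_polySupport _)).exists_bound_of_continuousOn hcont
  refine ⟨(∫ y in Set.Iic (-T'), K * Real.exp (c * y)) + a * max B 0
      + ∫ y in Set.Ioi T', K * Real.exp (-c * y), fun α hα => ?_⟩
  refine (integral_axis_of_decay (continuousOn_integrand_support hω x (hL α hα) hR) hc
    (le_max_right T C.R) fun y hy => hK α hα y ((le_max_left _ _).trans hy)).2.trans ?_
  gcongr
  exact hpoly _ _ (le_max_right _ _) fun z hz => (hB (α, z) ⟨hα, hz⟩).trans (le_max_left _ _)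

/-! ### The terminating series -/

theorem basicHyp_qpow_neg (ω : ℝ) (n : ℕ) (b c t : ℂ) :
    basicHyp (qpow ω 1) (qpow ω (-n)) b c t = ∑ k ∈ Finset.range (n + 1),
      qPoch (qpow ω 1) (qpow ω (-n)) k * qPoch (qpow ω 1) b k
        / (qPoch (qpow ω 1) (qpow ω 1) k * qPoch (qpow ω 1) c k) * t ^ k := by
  refine tsum_eq_sum fun k hk => ?_
  rw [qPoch_qpow_neg_eq_zero ω (by simpa using hk), zero_mul, zero_div, zero_mul]

theorem exists_polynomial_basicHyp (ω : ℝ) (n : ℕ) (b c : ℂ) :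
    ∃ P : Polynomial ℂ, P.natDegree ≤ n ∧
      ∀ t : ℂ, basicHyp (qpow ω 1) (qpow ω (-n)) b c t = P.eval t := by
  refine ⟨∑ k ∈ Finset.range (n + 1), Polynomial.C (qPoch (qpow ω 1) (qpow ω (-n)) k
    * qPoch (qpow ω 1) b k / (qPoch (qpow ω 1) (qpow ω 1) k * qPoch (qpow ω 1) c k))
      * Polynomial.X ^ k, ?_, fun t => ?_⟩
  · refine Polynomial.natDegree_sum_le_of_forall_le _ _ fun k hk => ?_
    exact (Polynomial.natDegree_C_mul_X_pow_le _ _).trans (Nat.lt_succ_iff.1 (Finset.mem_range.1 hk))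
  · rw [basicHyp_qpow_neg, Polynomial.eval_finsetSum]
    simp

/-! ### The limit formula -/

theorem tendsto_Psi (hω : 0 < ω) (hirr : Irrational ω) {n : ℕ} {β γ : ℂ} (h : Admissible ω n β γ)
    {x : ℂ} (hx0 : 0 < x.re) (hx1 : x.re < 1 + 1 / ω + γ.re + n - β.re) :
    Tendsto (fun α : ℂ => Psi ω α β γ x) (𝓝[≠] (-(n : ℂ)))
      (𝓝 (basicHyp (qpow ω 1) (qpow ω (-n)) (qpow ω β) (qpow ω γ) (qpow ω x))) := by
  -- The contour is chosen for the limiting value `α = -n`, with the pinching points `0, …, n` left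
  -- out of the right family.
  obtain ⟨C, hCL, hCR⟩ := exists_contour_of_disjoint (Rt := rightPoles ω γ \ natsUpTo n) hω
    Set.sdiff_subset (disjoint_leftPoles_rightPoles_diff hω hirr h.beta_nonpos
      (h.gamma_add_notMem_latPos hω le_rfl) h.gamma_sub_beta)
  have hCn : ∀ p ∈ natsUpTo n, C.IsLeft p := fun p hp => hCL p (natsUpTo_subset_leftPoles ω n β hp)
  have hCr : ∀ p ∈ rightPoles ω γ, p ∉ C.support := fun p hp => by
    by_cases hp' : p ∈ natsUpTo n
    · exact (hCn p hp').1
    · exact (hCR p ⟨hp, hp'⟩).1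
  obtain ⟨δ, hδ, hCδ⟩ := C.exists_pos_lt_norm_sub (locFinite_leftPoles hω (-n) β)
    (fun p hp => abs_im_le_of_mem_leftPoles hp) fun p hp => (hCL p hp).1
  -- Half of the available decay is given up to the variation of `Re α`; the other half remains as
  -- the rate for `y < 0`.
  set g : ℝ := (1 + 1 / ω + γ.re + n - β.re - x.re) / 2 with hg
  have hg0 : 0 < g := by rw [hg]; linarith
  set d : ℝ := min δ (min g 1) with hd
  have hd0 : 0 < d := lt_min hδ (lt_min hg0 one_pos)
  have hdist : ∀ {α : ℂ}, α ∈ Metric.closedBall (-(n : ℂ)) d → ‖α + n‖ ≤ d := fun {α} hα => by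
    rwa [mem_closedBall_iff_norm, sub_neg_eq_add] at hα
  have hleft : ∀ α ∈ Metric.closedBall (-(n : ℂ)) d, ∀ p ∈ leftPoles ω α β, C.IsLeft p := by
    -- Only the poles attached to `α` move, each by `-(α + n)`, which is shorter than the distance
    -- from its limiting position to `C`.
    rintro α hα p (hp | hp)
    · have hp₀ : p + α + n ∈ leftPoles ω (-n) β := Or.inl (by simpa using hp)
      refine Contour.hasTurning_of_norm_sub_lt (fun z hz => lt_of_le_of_lt ?_ (hCδ _ hp₀ z hz))
        (hCL _ hp₀).2
      rw [show p - (p + α + n) = -(α + n) by ring, norm_neg]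
      exact (hdist hα).trans (min_le_left _ _)
    · exact hCL p (Or.inr hp)
  obtain ⟨K, T, -, -, hK⟩ := exists_norm_integrand_le hω β γ x (n + 1)
  set c : ℝ := 2 * Real.pi * ω * min x.re g with hc
  have hc0 : 0 < c := by
    have := lt_min hx0 hg0
    have := Real.pi_pos
    positivity
  have hdecay : ∀ α ∈ Metric.closedBall (-(n : ℂ)) d, ∀ y : ℝ, T ≤ |y| →
      ‖integrand ω α β γ x (y * Complex.I)‖ ≤ K * Real.exp (-c * |y|) := by
    intro α hα
    have hα' := hdist hα
    refine hK α ?_ _ (min_le_left _ _) ((min_le_right _ _).trans ?_)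
    · calc ‖α‖ = ‖(α + n) - n‖ := by rw [add_sub_cancel_right]
        _ ≤ ‖α + n‖ + ‖(n : ℂ)‖ := norm_sub_le _ _
        _ ≤ n + 1 := by
          rw [Complex.norm_natCast]
          linarith [(min_le_right δ (min g 1)).trans (min_le_right g 1)]
    · have h1 : α.re + n ≤ g := by
        have := Complex.re_le_norm (α + n)
        rw [Complex.add_re, Complex.natCast_re] at this
        linarith [(min_le_right δ (min g 1)).trans (min_le_left g 1)]
      linarith
  obtain ⟨M, hM⟩ := exists_norm_integral_integrand_le hω
    (isCompact_closedBall (-(n : ℂ)) d) (fun α hα p hp => (hleft α hα p hp).1) hCr hc0 hdecay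
  have hγk : ∀ k ≤ n, γ + (k : ℕ) ∉ latPos ω := fun k hk => h.gamma_add_notMem_latPos hω hk
  have hn : -(n : ℂ) ∉ latPos ω := notMem_latPos_of_re_lt hω (by
    rw [Complex.neg_re, Complex.natCast_re]
    linarith [one_div_pos.2 hω, (Nat.cast_nonneg n : (0 : ℝ) ≤ n)])
  have hball : ∀ᶠ α in 𝓝[≠] (-(n : ℂ)), α ∈ Metric.closedBall (-(n : ℂ)) d :=
    nhdsWithin_le_nhds (Metric.closedBall_mem_nhds _ hd0)
  have hPsi : ∀ᶠ α in 𝓝[≠] (-(n : ℂ)), Psi ω α β γ x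
      = brk ω α * brk ω β / (brk ω 1 * brk ω γ) * C.integral (integrand ω α β γ x)
        + ∑ k ∈ Finset.range (n + 1), qPoch (qpow ω 1) (qpow ω α) k * qPoch (qpow ω 1) (qpow ω β) k
          / (qPoch (qpow ω 1) (qpow ω 1) k * qPoch (qpow ω 1) (qpow ω γ) k) * qpow ω x ^ k := by
    have e1 : ∀ᶠ α in 𝓝[≠] (-(n : ℂ)), γ - α ∉ latPos ω := by
      refine nhdsWithin_le_nhds ?_
      have ht : Tendsto (fun α : ℂ => γ - α) (𝓝 (-(n : ℂ))) (𝓝 (γ + n)) := by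
        have : ContinuousAt (fun α : ℂ => γ - α) (-(n : ℂ)) := by fun_prop
        simpa [ContinuousAt] using this
      exact ht.eventually ((locFinite_latPos hω).eventually_notMem_of_notMem (hγk n le_rfl))
    filter_upwards [(locFinite_latNonpos hω).eventually_notMem (-(n : ℂ)),
      nhdsWithin_le_nhds ((locFinite_latPos hω).eventually_notMem_of_notMem hn), e1, hball]
      with α hα hα' hγα hαb
    have hsep : ∃ C₁ : Contour, IsSeparating ω α β γ C₁ := exists_contour_of_disjoint hω subset_rfl
      (disjoint_leftPoles_rightPoles hα h.beta_nonpos hγα h.gamma_sub_beta)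
    -- The residue formula holds for every separating contour, hence for the one chosen in `Psi`.
    rw [Psi, dif_pos hsep, integral_integrand_eq_add_sum hω hirr x hα h.beta_nonpos hγk hsep.choose_spec
      (hleft α hαb) hCR hCn hc0 (hdecay α hαb), mul_add, Finset.mul_sum]
    congr 1
    refine Finset.sum_congr rfl fun k hk => ?_
    exact prefactor_mul_integrandRes hω hirr x hα hα' h.beta_nonpos h.beta_pos h.gamma_nonpos h.gamma_pos
      (hγk k (Nat.lt_succ_iff.1 (Finset.mem_range.1 hk)))
  refine Tendsto.congr' (hPsi.mono fun α hα => hα.symm) ?_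
  rw [basicHyp_qpow_neg, ← zero_add (∑ k ∈ Finset.range (n + 1), _)]
  refine Tendsto.add ?_ ?_
  · have hpre : Tendsto (fun α => ‖brk ω α * brk ω β / (brk ω 1 * brk ω γ)‖ * M) (𝓝[≠] (-(n : ℂ)))
        (𝓝 0) := by
      have h1 : ContinuousAt (fun α => ‖brk ω α * brk ω β / (brk ω 1 * brk ω γ)‖ * M) (-(n : ℂ)) := by
        have := (differentiableAt_brk hω hn).continuousAt
        exact ((this.mul_const _).div_const _).norm.mul_const _
      have h2 := h1.tendsto.mono_left (nhdsWithin_le_nhds (s := {-(n : ℂ)}ᶜ))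
      simpa [brk_neg_natCast hω n] using h2
    refine squeeze_zero_norm' ?_ hpre
    filter_upwards [hball] with α hα
    rw [norm_mul]
    exact mul_le_mul_of_nonneg_left (hM α hα) (norm_nonneg _)
  · have h1 : Continuous fun α : ℂ => ∑ k ∈ Finset.range (n + 1),
        qPoch (qpow ω 1) (qpow ω α) k * qPoch (qpow ω 1) (qpow ω β) k
          / (qPoch (qpow ω 1) (qpow ω 1) k * qPoch (qpow ω 1) (qpow ω γ) k) * qpow ω x ^ k := by
      have := (differentiable_qpow ω).continuous
      unfold qPoch
      fun_prop
    exact (h1.tendsto _).mono_left nhdsWithin_le_nhds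

end QHyp

theorem mainTheorem5 (ω : ℝ) (hω : 0 < ω) (hirr : Irrational ω) (n : ℕ) :
    (∀ β γ : ℂ, QHyp.Admissible ω n β γ →
      (∃ P : Polynomial ℂ, P.natDegree ≤ n ∧ ∀ t : ℂ,
        QHyp.basicHyp (QHyp.qpow ω 1) (QHyp.qpow ω (-n)) (QHyp.qpow ω β) (QHyp.qpow ω γ) t
          = P.eval t) ∧
      ∀ x : ℂ, 0 < x.re → x.re < 1 + 1 / ω + γ.re + n - β.re →
        Tendsto (fun α : ℂ => QHyp.Psi ω α β γ x) (𝓝[≠] (-(n : ℂ)))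
          (𝓝 (QHyp.basicHyp (QHyp.qpow ω 1) (QHyp.qpow ω (-n)) (QHyp.qpow ω β) (QHyp.qpow ω γ)
            (QHyp.qpow ω x)))) ∧
    (∀ α β : ℂ, QHyp.Admissible ω n (α + β + n + 1) (α + 1) →
      ∀ x : ℂ, 0 < (x + 1).re → (x + 1).re < 1 + 1 / ω - β.re →
        Tendsto (fun a : ℂ => QHyp.Psi ω a (α + β + n + 1) (α + 1) (x + 1)) (𝓝[≠] (-(n : ℂ)))
          (𝓝 (QHyp.littleJacobi ω n α β (QHyp.qpow ω x)))) := by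
  refine ⟨fun β γ h => ⟨QHyp.exists_polynomial_basicHyp ω n _ _, fun x hx0 hx1 =>
    QHyp.tendsto_Psi hω hirr h hx0 hx1⟩, fun α β h x hx0 hx1 => ?_⟩
  rw [QHyp.littleJacobi, ← QHyp.qpow_add, add_comm 1 x]
  refine QHyp.tendsto_Psi hω hirr h hx0 ?_
  -- With parameters `α + β + n + 1` and `α + 1`, the quantity `γ + n - β` in the first part becomes
  -- `-β`.
  simp only [Complex.add_re, Complex.natCast_re, Complex.one_re] at hx1 ⊢
  linarith
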